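/- **Setting.** Let $\widetilde{\mathfrak L}$ be the free complex Lie algebra on $x,y$. For $f\in\widetilde{\mathfrak L}$ let $D_f$ be the derivation of $\widetilde{\mathfrak L}$ with $D_f(x)=0$, $D_f(y)=[y,f]$, and put $\langle f,g\rangle=[f,g]+D_f(g)-D_g(f)$. Let $\overline{\mathfrak L}=\overline{\mathfrak L}^0=[\widetilde{\mathfrak L},\widetilde{\mathfrak L}]$, $\overline{\mathfrak L}^{i+1}=[\overline{\mathfrak L},\overline{\mathfrak L}^i]$ and $\mathfrak L_i=\overline{\mathfrak L}^i/\overline{\mathfrak L}^{i+1}$. Put $e_{ij}=(\mathrm{ad}\,x)^i(\mathrm{ad}\,y)^j[x,y]$. Identify $\mathfrak L_0$ with $AB\,\mathbb C[A,B]$ by $[e_{ij}]\mapsto A^{i+1}B^{j+1}$, and identify $\mathfrak L_1$ with the space $M=ABA'B'\,\mathbb C[A,B,A',B']^{as}$ (polynomials antisymmetric under $(A,B)\leftrightarrow(A',B')$) by $[[e_{ij},e_{kl}]]\mapsto A^{i+1}B^{j+1}A'^{k+1}B'^{l+1}-A'^{i+1}B'^{j+1}A^{k+1}B^{l+1}$.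 The bracket $\langle\cdot,\cdot\rangle$ induces an action of $\mathfrak L_0$ on $\mathfrak L_1$. For $k\ge3$ odd let $\sigma_k=A^k+B^k+(-A-B)^k\in\mathfrak L_0$ and let $\Sigma=\bigoplus_{k\ge 3\text{ odd}}\mathbb C\sigma_k\subset\mathfrak L_0$. Put $F^0=\mathfrak L_1$, $F^{i+1}=\Sigma\cdot F^i$ (so $F^i=S^i(\Sigma)\cdot\mathfrak L_1$), and $\mathrm{gr}^i_\Sigma(\mathfrak L_1)=F^i/F^{i+1}$. Let $\mathbb M^{min}_0(\Sigma)\subset\mathrm{gr}^0_\Sigma(\mathfrak L_1)$ be the span of the classes of all $\langle f,g\rangle$, where $f,g\in\overline{\mathfrak L}$ are lifts of elements of $\Sigma$; let $\mathbb M^{min}_i(\Sigma)=S^i(\Sigma)\cdot\mathbb M^{min}_0(\Sigma)\subset \mathrm{gr}^i_\Sigma(\mathfrak L_1)$ and $\mathbb M^{min}(\Sigma)=\bigoplus_{i\ge0}\mathbb M_i^{min}(\Sigma)$. An element of $\Sigma$ acts on $\mathbb M^{min}(\Sigma)$, raising $i$ by one. The space $\mathbb M^{min}(\Sigma)$ is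 bigraded: $\mathbb M_i^{min}(\Sigma)$ has $\Sigma$-degree $i+2$, and the weight is induced by the degree of polynomials in $M$. For $k\ge0$ put $$\tilde\sigma_k=A^k+B^k+(-A-B)^k+A'^k+B'^k+(-A'-B')^k+(-A-A')^k+(-B-B')^k+(A+B+A'+B')^k,$$ $$\lambda_k=(A+B+A')^k-(A+A'+B')^k-(A+B+B')^k+(B+A'+B')^k+(A+B')^k-(A'+B)^k,$$ and $\tau_{35}=\tilde\sigma_3\lambda_5-\tilde\sigma_5\lambda_3\in M$. Multiplication by $\tilde\sigma_2,\tilde\sigma_6$ on $M$ induces operators $\dot\sigma_2,\dot\sigma_6$ of degree $0$ on $\mathrm{gr}_\Sigma(\mathfrak L_1)$, and multiplication by $\tilde\sigma_3,\tilde\sigma_5$ induces operators $\dot\sigma_3,\dot\sigma_5$ of degree $1$. Give $\mathbf x_2,\mathbf x_6,\mathbf x_3,\mathbf x_5$ the bidegrees (weight, $\Sigma$-degree) $(2,0),(6,0),(3,1),(5,1)$; $\{8,2\}$ denotes the shift of the bidegree by $(8,2)$. **Proposition.** There is a unique isomorphism of bigraded vector spaces $$\phi:\mathbb C[\mathbf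 x_2,\mathbf x_6,\mathbf x_3,\mathbf x_5]\{8,2\}\to\mathbb M^{min}(\Sigma)$$ such that $\phi(1)$ is the class of $\tau_{35}$ in $\mathbb M_0^{min}(\Sigma)$ and $\phi$ intertwines multiplication by $\mathbf x_2,\mathbf x_6,\mathbf x_3,\mathbf x_5$ with $\dot\sigma_2,\dot\sigma_6,\dot\sigma_3,\dot\sigma_5$. Let $$d(\mathbf x_2,\mathbf x_6,t)=\Bigl(1-\frac{\mathbf x_2}{4}t^2\Bigr)^2+\Bigl(-\frac16\mathbf x_6+\frac1{96}\mathbf x_2^3\Bigr)t^6,$$ $$\xi_3=t\frac{d}{dt}\Bigl(\frac{t^3}{3\,d(\mathbf x_2,\mathbf x_6,t)}\Bigr),\qquad \xi_5=t\frac{d}{dt}\Bigl(\frac{t^5}{5\,d(\mathbf x_2,\mathbf x_6,t)}\Bigr)$$ in $\mathbb C[\mathbf x_2,\mathbf x_6][[t]]$. Then, under $\phi^{-1}$, the action of $\sigma(t)=\sum_{k\ge3\text{ odd}}\sigma_kt^k\in\Sigma[[t]]$ on $\mathbb M^{min}(\Sigma)$ is multiplication by $$\xi_3(\mathbf x_2,\mathbf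 x_6,t)\,\mathbf x_3+\xi_5(\mathbf x_2,\mathbf x_6,t)\Bigl(\mathbf x_5-\frac56\mathbf x_2\mathbf x_3\Bigr),$$ that is, for every $k\ge0$ the coefficient of $t^k$ in $\sigma(t)$ acts as multiplication by the coefficient of $t^k$ in this series. -/

import Mathlib

namespace LcsGrt
noncomputable section

/-! ### The free Lie algebra and the bracket `⟨f, g⟩ = [f, g] + D_f g - D_g f` -/

/-- The free complex Lie algebra on two generators. -/
abbrev FL : Type := FreeLieAlgebra ℂ (Fin 2)

def x : FL := FreeLieAlgebra.of ℂ 0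

def y : FL := FreeLieAlgebra.of ℂ 1

theorem FL_induction {p : FL → Prop} (hx : p x) (hy : p y)
    (hadd : ∀ a b, p a → p b → p (a + b)) (hsmul : ∀ (c : ℂ) a, p a → p (c • a))
    (hlie : ∀ a b, p a → p b → p ⁅a, b⁆) (g : FL) : p g := by
  let S : LieSubalgebra ℂ FL :=
    { carrier := {g | p g}
      add_mem' := fun {a b} ha hb => hadd a b ha hb
      zero_mem' := by
        have := hsmul 0 x hx
        rwa [zero_smul] at this
      smul_mem' := fun c a ha => hsmul c a ha
      lie_mem' := fun {a b} ha hb => hlie a b ha hb }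
  have h : S.incl.comp (FreeLieAlgebra.lift ℂ ![(⟨x, hx⟩ : S), ⟨y, hy⟩]) = LieHom.id := by
    apply FreeLieAlgebra.hom_ext
    intro i
    fin_cases i <;> simp [x, y]
  have h2 := LieHom.congr_fun h g
  rw [LieHom.comp_apply, LieHom.id_apply] at h2
  rw [← h2]
  exact (FreeLieAlgebra.lift ℂ ![(⟨x, hx⟩ : S), ⟨y, hy⟩] g).2

/-- The semidirect product of the free Lie algebra with its adjoint module. -/
abbrev AdjExt : Type := LieAlgebra.ofTwoCocycle (0 : LieModule.Cohomology.twoCocycle ℂ FL FL)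

abbrev adjPair : FL × FL ≃ AdjExt :=
  LieAlgebra.ofProd (0 : LieModule.Cohomology.twoCocycle ℂ FL FL)

/-- The graph `g ↦ (g, D_f g)` of the derivation `D_f` below, as a Lie algebra morphism. -/
def graphHom (f : FL) : FL →ₗ⁅ℂ⁆ AdjExt :=
  FreeLieAlgebra.lift ℂ ![adjPair (x, 0), adjPair (y, ⁅y, f⁆)]

theorem adjPair_bracket (p q : FL × FL) :
    ⁅adjPair p, adjPair q⁆ = adjPair (⁅p.1, q.1⁆, ⁅p.1, q.2⁆ - ⁅q.1, p.2⁆) := by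
  rw [LieAlgebra.bracket_ofTwoCocycle]
  simp

theorem graphHom_fst (f g : FL) : (adjPair.symm (graphHom f g)).1 = g := by
  refine FL_induction (p := fun g => (adjPair.symm (graphHom f g)).1 = g) ?_ ?_ ?_ ?_ ?_ g
  · simp [graphHom, x]
  · simp [graphHom, y]
  · intro a b ha hb
    simp [ha, hb]
  · intro c a ha
    simp [ha]
  · intro a b ha hb
    rw [LieHom.map_lie, ← Equiv.apply_symm_apply adjPair (graphHom f a),
      ← Equiv.apply_symm_apply adjPair (graphHom f b), adjPair_bracket]
    simp [ha, hb]

/-- The derivation `D_f` of the free Lie algebra such that `D_f x = 0` and `D_f y = [y, f]`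
(see `D_x` and `D_y`). -/
def D (f : FL) : LieDerivation ℂ FL FL where
  toFun g := (adjPair.symm (graphHom f g)).2
  map_add' a b := by simp
  map_smul' c a := by simp
  leibniz' a b := by
    change (adjPair.symm (graphHom f ⁅a, b⁆)).2 =
      ⁅a, (adjPair.symm (graphHom f b)).2⁆ - ⁅b, (adjPair.symm (graphHom f a)).2⁆
    rw [LieHom.map_lie, ← Equiv.apply_symm_apply adjPair (graphHom f a),
      ← Equiv.apply_symm_apply adjPair (graphHom f b), adjPair_bracket]
    simp [graphHom_fst]

theorem D_x (f : FL) : D f x = 0 := by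
  change (adjPair.symm (graphHom f x)).2 = 0
  simp [graphHom, x]

theorem D_y (f : FL) : D f y = ⁅y, f⁆ := by
  change (adjPair.symm (graphHom f y)).2 = _
  simp [graphHom, y]

theorem D_lie (f a b : FL) : D f ⁅a, b⁆ = ⁅a, D f b⁆ - ⁅b, D f a⁆ :=
  LieDerivation.apply_lie_eq_sub (D f) a b

theorem lieDer_ext (E E' : LieDerivation ℂ FL FL) (hx : E x = E' x) (hy : E y = E' y) :
    E = E' := by
  ext g
  refine FL_induction (p := fun g => E g = E' g) hx hy ?_ ?_ ?_ g
  · intro a b ha hb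
    simp [ha, hb]
  · intro c a ha
    simp [ha]
  · intro a b ha hb
    simp [ha, hb]

theorem D_add (f f' : FL) : D (f + f') = D f + D f' :=
  lieDer_ext _ _ (by simp [D_x]) (by simp [D_y])

theorem D_smul (c : ℂ) (f : FL) : D (c • f) = c • D f :=
  lieDer_ext _ _ (by simp [D_x]) (by simp [D_y])

/-- The bracket `⟨f, g⟩ = [f, g] + D_f g - D_g f`. -/
def ihara : FL →ₗ[ℂ] FL →ₗ[ℂ] FL :=
  LinearMap.mk₂ ℂ (fun f g => ⁅f, g⁆ + D f g - D g f)
    (by intro a b c; simp [D_add]; abel)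
    (by intro t a b; simp [D_smul, smul_add, smul_sub])
    (by intro a b c; simp [D_add]; abel)
    (by intro t a b; simp [D_smul, smul_add, smul_sub])

theorem ihara_apply (f g : FL) : ihara f g = ⁅f, g⁆ + D f g - D g f := rfl

/-! ### The lower central filtration of the commutator ideal -/

/-- The commutator ideal of the free Lie algebra. -/
def Lbar : LieIdeal ℂ FL := ⁅(⊤ : LieIdeal ℂ FL), (⊤ : LieIdeal ℂ FL)⁆

/-- The filtration with `lcs 0 = Lbar` and `lcs (i + 1) = [Lbar, lcs i]`. -/
def lcs : ℕ → LieIdeal ℂ FL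
  | 0 => Lbar
  | i + 1 => ⁅Lbar, lcs i⁆

/-- The underlying vector space of `lcs i`. -/
abbrev lcsS (i : ℕ) : Submodule ℂ FL := (lcs i).toSubmodule

/-- The graded piece `lcs i / lcs (i + 1)`. -/
abbrev grL (i : ℕ) : Type := lcsS i ⧸ (lcsS (i + 1)).submoduleOf (lcsS i)

/-- The class in `lcs i / lcs (i + 1)` of an element of `lcs i`. -/
abbrev grLMk (i : ℕ) : lcsS i →ₗ[ℂ] grL i := ((lcsS (i + 1)).submoduleOf (lcsS i)).mkQ

theorem lcs_le (i : ℕ) : lcs (i + 1) ≤ lcs i := by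
  cases i with
  | zero => exact LieSubmodule.lie_le_left _ _
  | succ i => exact LieSubmodule.lie_le_right _ _

theorem mem_Lbar_lie (f g : FL) : ⁅f, g⁆ ∈ Lbar :=
  LieSubmodule.lie_mem_lie (LieSubmodule.mem_top f) (LieSubmodule.mem_top g)

theorem D_mem (I : LieIdeal ℂ FL) {m : FL} (hm : ⁅y, m⁆ ∈ I) (g : FL) :
    D m g ∈ I := by
  refine FL_induction (p := fun g => D m g ∈ I) ?_ ?_ ?_ ?_ ?_ g
  · simp [D_x]
  · rw [D_y]; exact hm
  · intro a b ha hb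
    rw [map_add]; exact add_mem ha hb
  · intro c a ha
    rw [map_smul]; exact I.smul_mem c ha
  · intro a b ha hb
    rw [D_lie]
    exact sub_mem (I.lie_mem hb) (I.lie_mem ha)

theorem D_mem_of_mem (I : LieIdeal ℂ FL) {m : FL} (hm : m ∈ I) (g : FL) : D m g ∈ I :=
  D_mem I (I.lie_mem hm) g

theorem D_mem_Lbar (f g : FL) : D f g ∈ Lbar :=
  D_mem Lbar (mem_Lbar_lie _ _) g

theorem lie_ideal_induction (I J : LieIdeal ℂ FL) (p : Submodule ℂ FL)
    (h : ∀ a ∈ I, ∀ b ∈ J, ⁅a, b⁆ ∈ p) {z : FL} (hz : z ∈ ⁅I, J⁆) : z ∈ p := by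
  have h1 : z ∈ (⁅I, J⁆ : LieIdeal ℂ FL).toSubmodule := hz
  rw [LieSubmodule.lieIdeal_oper_eq_linear_span'] at h1
  refine (Submodule.span_le.2 ?_) h1
  rintro _ ⟨a, ha, b, hb, rfl⟩
  exact h a ha b hb

theorem ihara_mem_one (f : FL) {m : FL} (hm : m ∈ lcs 1) : ihara f m ∈ lcs 1 := by
  rw [ihara_apply]
  refine sub_mem (add_mem ((lcs 1).lie_mem hm) ?_) (D_mem_of_mem _ hm _)
  refine lie_ideal_induction Lbar Lbar ((lcs 1).toSubmodule.comap (D f : FL →ₗ[ℂ] FL)) ?_ hm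
  intro a ha b hb
  change D f ⁅a, b⁆ ∈ lcs 1
  rw [D_lie]
  exact sub_mem (LieSubmodule.lie_mem_lie ha (D_mem_Lbar _ _))
    (LieSubmodule.lie_mem_lie hb (D_mem_Lbar _ _))

theorem ihara_lcs_one_one {m n : FL} (hm : m ∈ lcs 1) (hn : n ∈ lcs 1) : ihara m n ∈ lcs 2 := by
  have key : ∀ {m n : FL}, m ∈ lcs 1 → n ∈ lcs 1 → D m n ∈ lcs 2 := by
    intro m n hm hn
    refine lie_ideal_induction Lbar Lbar ((lcs 2).toSubmodule.comap (D m : FL →ₗ[ℂ] FL)) ?_ hn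
    intro a ha b hb
    change D m ⁅a, b⁆ ∈ lcs 2
    rw [D_lie]
    exact sub_mem (LieSubmodule.lie_mem_lie ha (D_mem_of_mem _ hm _))
      (LieSubmodule.lie_mem_lie hb (D_mem_of_mem _ hm _))
  rw [ihara_apply]
  exact sub_mem (add_mem (LieSubmodule.lie_mem_lie (lcs_le 0 hm) hn) (key hm hn)) (key hn hm)

theorem ihara_mem_two (f : FL) {m : FL} (hm : m ∈ lcs 2) : ihara f m ∈ lcs 2 := by
  have h1 : ∀ {m : FL}, m ∈ lcs 1 → D f m ∈ lcs 1 := by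
    intro m hm
    refine lie_ideal_induction Lbar Lbar ((lcs 1).toSubmodule.comap (D f : FL →ₗ[ℂ] FL)) ?_ hm
    intro a ha b hb
    change D f ⁅a, b⁆ ∈ lcs 1
    rw [D_lie]
    exact sub_mem (LieSubmodule.lie_mem_lie ha (D_mem_Lbar _ _))
      (LieSubmodule.lie_mem_lie hb (D_mem_Lbar _ _))
  rw [ihara_apply]
  refine sub_mem (add_mem ((lcs 2).lie_mem hm) ?_) (D_mem_of_mem _ hm _)
  refine lie_ideal_induction Lbar (lcs 1) ((lcs 2).toSubmodule.comap (D f : FL →ₗ[ℂ] FL)) ?_ hm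
  intro a ha b hb
  change D f ⁅a, b⁆ ∈ lcs 2
  rw [D_lie]
  refine sub_mem (LieSubmodule.lie_mem_lie ha (h1 hb)) ?_
  rw [← lie_skew]
  exact neg_mem (LieSubmodule.lie_mem_lie (D_mem_Lbar _ _) hb)

/-! ### A representation by triangular matrices, used to compute graded pieces -/

section Rep

set_option linter.unusedSimpArgs false

attribute [local instance 100] LieRing.ofAssociativeRing LieAlgebra.ofAssociativeAlgebra

variable {R : Type*} [CommRing R] [Algebra ℂ R]

/-- A Lie algebra morphism to upper triangular `3 × 3` matrices. -/
def Theta (a b a' b' : R) : FL →ₗ⁅ℂ⁆ Matrix (Fin 3) (Fin 3) R :=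
  FreeLieAlgebra.lift ℂ
    ![!![a, 0, 0; 0, 0, 0; 0, 0, -a'], !![b, b, 0; 0, 0, b'; 0, 0, -b']]

theorem Theta_x (a b a' b' : R) :
    Theta a b a' b' x = !![a, 0, 0; 0, 0, 0; 0, 0, -a'] := by
  simp [Theta, x]

theorem Theta_y (a b a' b' : R) :
    Theta a b a' b' y = !![b, b, 0; 0, 0, b'; 0, 0, -b'] := by
  simp [Theta, y]

theorem Theta_lie (a b a' b' : R) (g h : FL) (i j : Fin 3) :
    Theta a b a' b' ⁅g, h⁆ i j =
      (∑ k, Theta a b a' b' g i k * Theta a b a' b' h k j) -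
      ∑ k, Theta a b a' b' h i k * Theta a b a' b' g k j := by
  rw [LieHom.map_lie, Ring.lie_def, Matrix.sub_apply, Matrix.mul_apply, Matrix.mul_apply]

/-- The weight of the `(0, 0)` entry. -/
def wt (a b : R) (g : FL) : R := Theta a b 0 0 g 0 0

/-- The `(0, 1)` entry. -/
def ent (a b : R) : FL →ₗ[ℂ] R where
  toFun g := Theta a b 0 0 g 0 1
  map_add' g h := by simp
  map_smul' c g := by simp

theorem Theta_shape (a b a' b' : R) (g : FL) :
    (Theta a b a' b' g 1 0 = 0 ∧ Theta a b a' b' g 2 0 = 0 ∧ Theta a b a' b' g 2 1 = 0 ∧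
      Theta a b a' b' g 1 1 = 0) ∧
    Theta a b a' b' g 0 0 = wt a b g ∧ Theta a b a' b' g 0 1 = ent a b g ∧
    Theta a b a' b' g 2 2 = - wt a' b' g ∧ Theta a b a' b' g 1 2 = ent a' b' g := by
  have key : ∀ (a b a' b' : R) (g : FL), Theta a b a' b' g 1 0 = 0 ∧ Theta a b a' b' g 2 0 = 0 ∧
      Theta a b a' b' g 2 1 = 0 ∧ Theta a b a' b' g 1 1 = 0 := by
    intro a b a' b' g
    refine FL_induction (p := fun g => Theta a b a' b' g 1 0 = 0 ∧ Theta a b a' b' g 2 0 = 0 ∧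
      Theta a b a' b' g 2 1 = 0 ∧ Theta a b a' b' g 1 1 = 0) ?_ ?_ ?_ ?_ ?_ g
    · rw [Theta_x]; simp
    · rw [Theta_y]; simp
    · rintro g h ⟨h1, h2, h3, h4⟩ ⟨k1, k2, k3, k4⟩
      simp [h1, h2, h3, h4, k1, k2, k3, k4]
    · rintro c g ⟨h1, h2, h3, h4⟩
      simp [h1, h2, h3, h4]
    · rintro g h ⟨h1, h2, h3, h4⟩ ⟨k1, k2, k3, k4⟩
      simp only [Theta_lie, Fin.sum_univ_three, h1, h2, h3, h4, k1, k2, k3, k4]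
      refine ⟨by ring, by ring, by ring, by ring⟩
  refine ⟨key a b a' b' g, ?_⟩
  refine FL_induction (p := fun g => Theta a b a' b' g 0 0 = wt a b g ∧
      Theta a b a' b' g 0 1 = ent a b g ∧
      Theta a b a' b' g 2 2 = - wt a' b' g ∧ Theta a b a' b' g 1 2 = ent a' b' g)
      ?_ ?_ ?_ ?_ ?_ g
  · simp [wt, ent, Theta_x]
  · simp [wt, ent, Theta_y]
  · rintro g h ⟨h1, h2, h3, h4⟩ ⟨k1, k2, k3, k4⟩
    refine ⟨?_, ?_, ?_, ?_⟩
    · simp [h1, k1]; simp [wt]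
    · simp [h2, k2]
    · simp [h3, k3]; simp [wt]; ring
    · simp [h4, k4]
  · rintro c g ⟨h1, h2, h3, h4⟩
    refine ⟨?_, ?_, ?_, ?_⟩
    · simp [h1]; simp [wt]
    · simp [h2]
    · simp [h3]; simp [wt]
    · simp [h4]
  · rintro g h ⟨h1, h2, h3, h4⟩ ⟨k1, k2, k3, k4⟩
    have e1 : ∀ (a b : R) (g h : FL), wt a b ⁅g, h⁆ = 0 := by
      intro a b g h
      obtain ⟨l1, l2, l3, l4⟩ := key a b 0 0 g
      obtain ⟨m1, m2, m3, m4⟩ := key a b 0 0 h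
      simp only [wt, Theta_lie, Fin.sum_univ_three, l1, l2, l3, l4, m1, m2, m3, m4]
      ring
    have e2 : ∀ (a b : R) (g h : FL),
        ent a b ⁅g, h⁆ = wt a b g * ent a b h - wt a b h * ent a b g := by
      intro a b g h
      obtain ⟨l1, l2, l3, l4⟩ := key a b 0 0 g
      obtain ⟨m1, m2, m3, m4⟩ := key a b 0 0 h
      change Theta a b 0 0 ⁅g, h⁆ 0 1 = Theta a b 0 0 g 0 0 * Theta a b 0 0 h 0 1 -
        Theta a b 0 0 h 0 0 * Theta a b 0 0 g 0 1
      simp only [Theta_lie, Fin.sum_univ_three, l1, l2, l3, l4, m1, m2, m3, m4]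
      ring
    obtain ⟨l1, l2, l3, l4⟩ := key a b a' b' g
    obtain ⟨m1, m2, m3, m4⟩ := key a b a' b' h
    simp only [e1, e2, Theta_lie, Fin.sum_univ_three, l1, l2, l3, l4, m1, m2, m3, m4,
      h1, h2, h3, h4, k1, k2, k3, k4]
    refine ⟨by ring, by ring, by ring, by ring⟩

theorem wt_lie (a b : R) (g h : FL) : wt a b ⁅g, h⁆ = 0 := by
  obtain ⟨⟨l1, l2, l3, l4⟩, -⟩ := Theta_shape a b 0 0 g
  obtain ⟨⟨m1, m2, m3, m4⟩, -⟩ := Theta_shape a b 0 0 h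
  simp only [wt, Theta_lie, Fin.sum_univ_three, l1, l2, l3, l4, m1, m2, m3, m4]
  ring

theorem ent_lie (a b : R) (g h : FL) :
    ent a b ⁅g, h⁆ = wt a b g * ent a b h - wt a b h * ent a b g := by
  obtain ⟨⟨l1, l2, l3, l4⟩, -⟩ := Theta_shape a b 0 0 g
  obtain ⟨⟨m1, m2, m3, m4⟩, -⟩ := Theta_shape a b 0 0 h
  change Theta a b 0 0 ⁅g, h⁆ 0 1 = Theta a b 0 0 g 0 0 * Theta a b 0 0 h 0 1 -
    Theta a b 0 0 h 0 0 * Theta a b 0 0 g 0 1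
  simp only [Theta_lie, Fin.sum_univ_three, l1, l2, l3, l4, m1, m2, m3, m4]
  ring

/-- The `(0, 2)` entry. -/
def corner (a b a' b' : R) : FL →ₗ[ℂ] R where
  toFun g := Theta a b a' b' g 0 2
  map_add' g h := by simp
  map_smul' c g := by simp

theorem corner_lie (a b a' b' : R) (g h : FL) :
    corner a b a' b' ⁅g, h⁆ =
      (wt a b g + wt a' b' g) * corner a b a' b' h - (wt a b h + wt a' b' h) * corner a b a' b' g
      + ent a b g * ent a' b' h - ent a b h * ent a' b' g := by
  obtain ⟨⟨l1, l2, l3, l4⟩, h1, h2, h3, h4⟩ := Theta_shape a b a' b' g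
  obtain ⟨⟨m1, m2, m3, m4⟩, k1, k2, k3, k4⟩ := Theta_shape a b a' b' h
  change Theta a b a' b' ⁅g, h⁆ 0 2 = (wt a b g + wt a' b' g) * Theta a b a' b' h 0 2 -
    (wt a b h + wt a' b' h) * Theta a b a' b' g 0 2 + _ - _
  simp only [Theta_lie, Fin.sum_univ_three, l1, l2, l3, l4, m1, m2, m3, m4,
      h1, h2, h3, h4, k1, k2, k3, k4]
  ring

theorem wt_Lbar (a b : R) {f : FL} (hf : f ∈ Lbar) : wt a b f = 0 := by
  let w : FL →ₗ[ℂ] R :=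
    { toFun := wt a b
      map_add' := fun g h => by simp [wt]
      map_smul' := fun c g => by simp [wt] }
  have : f ∈ LinearMap.ker w := by
    refine lie_ideal_induction ⊤ ⊤ _ ?_ hf
    intro g _ h _
    exact wt_lie a b g h
  exact this

theorem ent_one (a b : R) {m : FL} (hm : m ∈ lcs 1) : ent a b m = 0 := by
  have : m ∈ LinearMap.ker (ent a b) := by
    refine lie_ideal_induction Lbar Lbar _ ?_ hm
    intro g hg h hh
    rw [LinearMap.mem_ker, ent_lie, wt_Lbar a b hg, wt_Lbar a b hh]; ring
  exact this

theorem corner_Lbar_lie (a b a' b' : R) {g h : FL} (hg : g ∈ Lbar) (hh : h ∈ Lbar) :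
    corner a b a' b' ⁅g, h⁆ = ent a b g * ent a' b' h - ent a b h * ent a' b' g := by
  rw [corner_lie, wt_Lbar a b hg, wt_Lbar a b hh, wt_Lbar a' b' hg, wt_Lbar a' b' hh]; ring

theorem corner_two (a b a' b' : R) {m : FL} (hm : m ∈ lcs 2) : corner a b a' b' m = 0 := by
  have : m ∈ LinearMap.ker (corner a b a' b') := by
    refine lie_ideal_induction Lbar (lcs 1) _ ?_ hm
    intro g hg h hh
    rw [LinearMap.mem_ker, corner_Lbar_lie a b a' b' hg (lcs_le 0 hh), ent_one a b hh,
      ent_one a' b' hh]; ring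
  exact this


end Rep

/-! ### The graded pieces `lcs 0 / lcs 1` and `lcs 1 / lcs 2` as polynomials -/

/-- The element `e_{ij} = (ad x)^i (ad y)^j [x, y]` of the commutator ideal. -/
def e (i j : ℕ) : FL := ((LieAlgebra.ad ℂ FL x) ^ i) (((LieAlgebra.ad ℂ FL y) ^ j) ⁅x, y⁆)

theorem ad_pow_mem (g : FL) (i : ℕ) {m : FL} (hm : m ∈ Lbar) :
    ((LieAlgebra.ad ℂ FL g) ^ i) m ∈ Lbar := by
  induction i with
  | zero => simpa using hm
  | succ i ih =>
    rw [pow_succ', Module.End.mul_apply, LieAlgebra.ad_apply]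
    exact mem_Lbar_lie _ _

theorem e_mem (i j : ℕ) : e i j ∈ Lbar := ad_pow_mem _ _ (ad_pow_mem _ _ (mem_Lbar_lie _ _))

theorem ent_ad_pow {R : Type*} [CommRing R] [Algebra ℂ R] (a b : R) (g : FL) (i : ℕ) {m : FL}
    (hm : m ∈ Lbar) :
    ent a b (((LieAlgebra.ad ℂ FL g) ^ i) m) = wt a b g ^ i * ent a b m := by
  induction i with
  | zero => simp
  | succ i ih =>
    rw [pow_succ', Module.End.mul_apply, LieAlgebra.ad_apply, ent_lie, ih,
      wt_Lbar a b (ad_pow_mem g i hm)]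
    ring

/-- The map `ent` sends `e_{ij}` to `a ^ (i + 1) * b ^ (j + 1)`. -/
theorem ent_e {R : Type*} [CommRing R] [Algebra ℂ R] (a b : R) (i j : ℕ) :
    ent a b (e i j) = a ^ (i + 1) * b ^ (j + 1) := by
  have hx : wt a b x = a := by simp [wt, Theta_x]
  have hy : wt a b y = b := by simp [wt, Theta_y]
  have hx2 : ent a b x = 0 := by
    change Theta a b 0 0 x 0 1 = 0
    simp [Theta_x]
  have hy2 : ent a b y = b := by
    change Theta a b 0 0 y 0 1 = b
    simp [Theta_y]
  rw [e, ent_ad_pow a b x i (ad_pow_mem _ _ (mem_Lbar_lie _ _)),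
    ent_ad_pow a b y j (mem_Lbar_lie _ _), ent_lie, hx, hy, hx2, hy2]
  ring

/-- Polynomials in `A, B, A', B'`. -/
abbrev P4 : Type := MvPolynomial (Fin 4) ℂ

def vA : P4 := MvPolynomial.X 0

def vB : P4 := MvPolynomial.X 1

def vA' : P4 := MvPolynomial.X 2

def vB' : P4 := MvPolynomial.X 3

/-- The identification of `lcs 1 / lcs 2` with a space of polynomials in `A, B, A', B'`: the class
of `[e_{ij}, e_{kl}]` goes to `A^(i+1) B^(j+1) A'^(k+1) B'^(l+1) - A'^(i+1) B'^(j+1) A^(k+1) B^(l+1)`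
(see `iota_e`). -/
def iota : grL 1 →ₗ[ℂ] P4 :=
  Submodule.liftQ _ ((corner vA vB vA' vB').comp (lcsS 1).subtype)
    (fun m hm => corner_two vA vB vA' vB' (m := (m : FL)) hm)

theorem lie_e_mem (i j k l : ℕ) : ⁅e i j, e k l⁆ ∈ lcsS 1 :=
  LieSubmodule.lie_mem_lie (e_mem i j) (e_mem k l)

theorem iota_e (i j k l : ℕ) :
    iota (grLMk 1 ⟨⁅e i j, e k l⁆, lie_e_mem i j k l⟩) =
      vA ^ (i + 1) * vB ^ (j + 1) * vA' ^ (k + 1) * vB' ^ (l + 1) -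
      vA' ^ (i + 1) * vB' ^ (j + 1) * vA ^ (k + 1) * vB ^ (l + 1) := by
  change corner vA vB vA' vB' ⁅e i j, e k l⁆ = _
  rw [corner_Lbar_lie vA vB vA' vB' (e_mem i j) (e_mem k l), ent_e, ent_e, ent_e, ent_e]
  ring

/-! ### The classes `σ_k` and their span -/

/-- A lift to the commutator ideal of `σ_k = A^k + B^k + (-A-B)^k` for `k` odd (see
`ent_sigLift`); the class of `e_{ij}` corresponds to `A^(i+1) B^(j+1)`. -/
def sigLift (k : ℕ) : FL :=
  -∑ i ∈ Finset.range (k - 1), (k.choose (i + 1) : ℂ) • e i (k - 2 - i)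

theorem sigLift_mem (k : ℕ) : sigLift k ∈ lcsS 0 :=
  neg_mem (sum_mem fun _ _ => Submodule.smul_mem _ _ (e_mem _ _))

theorem ent_sigLift {R : Type*} [CommRing R] [Algebra ℂ R] (a b : R) {k : ℕ} (hk : Odd k)
    (h3 : 3 ≤ k) : ent a b (sigLift k) = a ^ k + b ^ k + (-a - b) ^ k := by
  obtain ⟨n, rfl⟩ : ∃ n, k = n + 2 := ⟨k - 2, by omega⟩
  have h1 : (-a - b) ^ (n + 2) = -(a + b) ^ (n + 2) := by
    rw [← hk.neg_pow]; ring
  rw [h1, add_pow, Finset.sum_range_succ, Finset.sum_range_succ', sigLift, map_neg, map_sum]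
  have h2 : ∀ i ∈ Finset.range (n + 1),
      ent a b (((n + 2).choose (i + 1) : ℂ) • e i (n + 2 - 2 - i)) =
        a ^ (i + 1) * b ^ (n + 2 - (i + 1)) * ((n + 2).choose (i + 1) : R) := by
    intro i hi
    have : n + 2 - (i + 1) = n + 2 - 2 - i + 1 := by
      have := Finset.mem_range.1 hi
      omega
    rw [map_smul, ent_e, this, Algebra.smul_def, map_natCast]
    ring
  rw [show n + 2 - 1 = n + 1 from rfl, Finset.sum_congr rfl h2]
  simp
  ring

/-- The class `σ_k` in `lcs 0 / lcs 1`. -/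
def sig (k : ℕ) : grL 0 := grLMk 0 ⟨sigLift k, sigLift_mem k⟩

/-- The space `Σ`, spanned by the `σ_k` for `k ≥ 3` odd. -/
def Sig : Submodule ℂ (grL 0) := Submodule.span ℂ {s | ∃ k, Odd k ∧ 3 ≤ k ∧ s = sig k}

/-! ### The action of `lcs 0 / lcs 1` on `lcs 1 / lcs 2` and the filtration by powers of `Σ` -/

def actLift : lcsS 0 →ₗ[ℂ] grL 1 →ₗ[ℂ] grL 1 where
  toFun f := Submodule.mapQ _ _
    ((ihara (f : FL)).restrict (p := lcsS 1) (q := lcsS 1) (fun _ hm => ihara_mem_one _ hm))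
    (fun _ hm => ihara_mem_two _ hm)
  map_add' f g := by
    refine Submodule.linearMap_qext _ (LinearMap.ext fun m => ?_)
    refine congrArg (grLMk 1) (Subtype.ext ?_)
    exact LinearMap.map_add₂ ihara (f : FL) (g : FL) (m : FL)
  map_smul' c f := by
    refine Submodule.linearMap_qext _ (LinearMap.ext fun m => ?_)
    refine congrArg (grLMk 1) (Subtype.ext ?_)
    exact LinearMap.map_smul₂ ihara c (f : FL) (m : FL)

/-- The action of `lcs 0 / lcs 1` on `lcs 1 / lcs 2` induced by `⟨·, ·⟩`. -/
def act : grL 0 →ₗ[ℂ] grL 1 →ₗ[ℂ] grL 1 :=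
  Submodule.liftQ _ actLift fun f hf => by
    refine Submodule.linearMap_qext _ (LinearMap.ext fun m => ?_)
    exact (Submodule.Quotient.mk_eq_zero _).2 (ihara_lcs_one_one hf m.2)

theorem act_mk (f : lcsS 0) (m : lcsS 1) :
    act (grLMk 0 f) (grLMk 1 m) = grLMk 1 ⟨ihara f m, ihara_mem_one _ m.2⟩ := rfl

/-- The filtration `F k = S^k(Σ) · (lcs 1 / lcs 2)`. -/
def F : ℕ → Submodule ℂ (grL 1)
  | 0 => ⊤
  | k + 1 => Submodule.map₂ act Sig (F k)

/-- The graded piece `F k / F (k + 1)`. -/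
abbrev gr (k : ℕ) : Type := F k ⧸ (F (k + 1)).submoduleOf (F k)

/-- The class in `F k / F (k + 1)` of an element of `F k`. -/
abbrev grMk (k : ℕ) : F k →ₗ[ℂ] gr k := ((F (k + 1)).submoduleOf (F k)).mkQ

theorem act_mem (s : Sig) (k : ℕ) {m : grL 1} (hm : m ∈ F k) : act s m ∈ F (k + 1) :=
  Submodule.apply_mem_map₂ act s.2 hm

/-- The action of an element of `Σ` from `F k / F (k + 1)` to `F (k + 1) / F (k + 2)`. -/
def actStep (s : Sig) (k : ℕ) : gr k →ₗ[ℂ] gr (k + 1) :=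
  Submodule.mapQ _ _
    ((act s).restrict (p := F k) (q := F (k + 1)) (fun _ hm => act_mem s k hm))
    (fun _ hm => act_mem s (k + 1) hm)

/-! ### The module `M^min(Σ)` -/

/-- The image of the map from `Λ²(Σ)` to `F 0 / F 1` that is induced by `⟨·, ·⟩`: the span of the
classes of `⟨f, g⟩`, where `f` and `g` are lifts to the commutator ideal of elements of `Σ`. -/
def M0min : Submodule ℂ (gr 0) :=
  Submodule.span ℂ {u | ∃ (f g : lcsS 0) (h : lcsS 1), grLMk 0 f ∈ Sig ∧ grLMk 0 g ∈ Sig ∧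
    (h : FL) = ihara f g ∧ u = grMk 0 ⟨grLMk 1 h, Submodule.mem_top⟩}

/-- The graded pieces `S^k(Σ) · M0min` of `M^min(Σ)`. -/
def Mmin : (k : ℕ) → Submodule ℂ (gr k)
  | 0 => M0min
  | k + 1 => ⨆ s : Sig, (Mmin k).map (actStep s k)

/-- The module `M^min(Σ)`. -/
abbrev MMin : Type := DirectSum ℕ fun k => Mmin k

theorem actStep_mem (s : Sig) (k : ℕ) {u : gr k} (hu : u ∈ Mmin k) :
    actStep s k u ∈ Mmin (k + 1) :=
  Submodule.mem_iSup_of_mem s (Submodule.mem_map_of_mem hu)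

/-- The action of an element of `Σ` on `M^min(Σ)`, which raises the degree by one. -/
def sigAct (s : Sig) : MMin →ₗ[ℂ] MMin :=
  DirectSum.toModule ℂ ℕ MMin fun k =>
    (DirectSum.lof ℂ ℕ (fun k => Mmin k) (k + 1)).comp
      ((actStep s k).restrict (p := Mmin k) (q := Mmin (k + 1)) (fun _ hu => actStep_mem s k hu))

/-! ### The isomorphism with polynomials -/

/-- The polynomial
`A^k + B^k + (-A-B)^k + A'^k + B'^k + (-A'-B')^k + (-A-A')^k + (-B-B')^k + (A+B+A'+B')^k`. -/
def sigTilde (k : ℕ) : P4 :=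
  vA ^ k + vB ^ k + (-vA - vB) ^ k + vA' ^ k + vB' ^ k + (-vA' - vB') ^ k +
    (-vA - vA') ^ k + (-vB - vB') ^ k + (vA + vB + vA' + vB') ^ k

/-- The polynomials `λ_k` that enter the generator `τ₃₅`. -/
def lam (k : ℕ) : P4 :=
  (vA + vB + vA') ^ k - (vA + vA' + vB') ^ k - (vA + vB + vB') ^ k + (vB + vA' + vB') ^ k +
    (vA + vB') ^ k - (vA' + vB) ^ k

/-- The generator `τ₃₅ = σ̃₃ λ₅ - σ̃₅ λ₃`. -/
def tau35 : P4 := sigTilde 3 * lam 5 - sigTilde 5 * lam 3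

/-- Here `lcs 1 / lcs 2` is seen, through `iota`, as the space of the multiples of `A B A' B'` that
are antisymmetric under `(A, B) ↔ (A', B')`, on which the algebra of the polynomials with the
symmetries of `sigTilde` acts by multiplication. The relation says that `v`, of degree `k + r`, is
the product of `u`, of degree `k`, by the class of `a` in degree `r`. -/
def IsProd (r : ℕ) (a : P4) {k : ℕ} (u : gr k) (v : gr (k + r)) : Prop :=
  ∃ (z : F k) (w : F (k + r)), u = grMk k z ∧ v = grMk (k + r) w ∧ iota w = a * iota z

/-- The variables `x₂, x₆, x₃, x₅`. -/
inductive Var : Type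
  | x2 | x6 | x3 | x5

/-- The ring `ℂ[x₂, x₆, x₃, x₅]`. -/
abbrev PV : Type := MvPolynomial Var ℂ

/-- The weights of the variables. -/
def wgt : Var → ℕ
  | .x2 => 2
  | .x6 => 6
  | .x3 => 3
  | .x5 => 5

/-- The `Σ`-degrees of the variables. -/
def sdeg : Var → ℕ
  | .x2 => 0
  | .x6 => 0
  | .x3 => 1
  | .x5 => 1

/-- The component of degree `k` of an element of `M^min(Σ)`. -/
def comp (m : MMin) (k : ℕ) : gr k := (m k : gr k)

/-- The linear isomorphism `φ` from `ℂ[x₂, x₆, x₃, x₅]` to `M^min(Σ)` is compatible with the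
bigradings, up to the shift of weight by `8`, sends `1` to the class of `τ₃₅`, and intertwines the
multiplications by `x₂, x₆, x₃, x₅` with the actions of the classes of `σ̃₂, σ̃₆` (in degree `0`)
and `σ̃₃, σ̃₅` (in degree `1`). -/
structure IsPhi (φ : PV ≃ₗ[ℂ] MMin) : Prop where
  bigraded : ∀ (w s : ℕ) (p : PV), MvPolynomial.IsWeightedHomogeneous wgt p w →
    MvPolynomial.IsWeightedHomogeneous sdeg p s →
    (∀ k, k ≠ s → comp (φ p) k = 0) ∧
    ∃ z : F s, comp (φ p) s = grMk s z ∧ (iota z).IsHomogeneous (w + 8)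
  one : ∃ z : F 0, comp (φ 1) 0 = grMk 0 z ∧ iota z = tau35
  x2 : ∀ p k, IsProd 0 (sigTilde 2) (comp (φ p) k) (comp (φ (MvPolynomial.X .x2 * p)) k)
  x6 : ∀ p k, IsProd 0 (sigTilde 6) (comp (φ p) k) (comp (φ (MvPolynomial.X .x6 * p)) k)
  x3 : ∀ p k, IsProd 1 (sigTilde 3) (comp (φ p) k) (comp (φ (MvPolynomial.X .x3 * p)) (k + 1))
  x5 : ∀ p k, IsProd 1 (sigTilde 5) (comp (φ p) k) (comp (φ (MvPolynomial.X .x5 * p)) (k + 1))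

/-! ### The generating series -/

section Series

open MvPolynomial

/-- The polynomial `d = (1 - x₂ t² / 4)² + (- x₆ / 6 + x₂³ / 96) t⁶`. -/
def dSer : PowerSeries PV :=
  (1 - PowerSeries.C (C (1 / 4) * X Var.x2) * PowerSeries.X ^ 2) ^ 2 +
    PowerSeries.C (-(C (1 / 6) * X Var.x6) + C (1 / 96) * X Var.x2 ^ 3) * PowerSeries.X ^ 6

/-- The series `ξₙ = t d/dt (tⁿ / (n d))`. -/
def xi (n : ℕ) : PowerSeries PV :=
  PowerSeries.X * PowerSeries.derivative PV
    (PowerSeries.C (C (1 / (n : ℂ))) * PowerSeries.X ^ n * PowerSeries.invOfUnit dSer 1)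

end Series

/-- The coefficient of `t^k` in the generating series `σ(t) = ∑ σ_k t^k` over odd `k ≥ 3`. -/
def sigCoeff (k : ℕ) : Sig :=
  if h : Odd k ∧ 3 ≤ k then ⟨sig k, Submodule.subset_span ⟨k, h.1, h.2, rfl⟩⟩ else 0

end

end LcsGrt

namespace LcsGrt
noncomputable section

/-! ### Twisted derivations and the action of `D_f` on the matrix entries -/

section Entries

variable {R : Type*} [CommRing R] [Algebra ℂ R]

/-! Everything is transported to polynomials in A, B, A', B' by `iota`, which is injective with
image the antisymmetric multiples of A B A' B' (`iota_injective`, `iota_exists`). There an element f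
of degree 0 acts as multiplication by its additivity defect f(A,B) + f(A',B') - f(A+A',B+B')
(`iota_act`), which for σ_k is σ̃_k. So the whole question concerns the ideals I = `sigIdeal` =
(σ̃₃, σ̃₅) and J = `crossIdeal` = (AB', A'B).

The polynomial σ̃_k is the k-th power sum of the entries of a 3 × 3 array of linear forms with zero
row and column sums. Let E(t) be the product of the factors 1 - ut over the nine entries u. On each
of the four planes cut out by J the entries become three zeros and ± three forms of sum zero, so
modulo J the even part of E is d. The odd coefficients of E lie in I, those of degrees 7 and 9 even
in IJ. Expanding -log E to first order in its odd part gives ∑ σ̃_k t^k / k ≡ (e₃ t³ + e₅ t⁵) / d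
modulo IJ, over odd k (`sigTilde_odd_sub_mem`). Since e₃ = σ̃₃/3 and e₅ = (σ̃₅ - (5/6) σ̃₂ σ̃₃)/5,
this is the stated series. It also shows that every σ̃_k with k ≥ 3 odd lies in I, hence that F^k is
the antisymmetric part of A B A' B' I^k (`mem_F_iff`).

Working modulo IJ is enough because λ_k agrees with σ̃_k modulo AB' and with -σ̃_k modulo A'B, which
forces J τ₃₅ into A B A' B' I (`cross_mul_tau`). For the same reason σ̃_k λ_l - σ̃_l λ_k is, up to A
B A' B' I, the multiple of τ₃₅ by the determinant that expresses σ̃_k, σ̃_l in terms of σ̃₃, σ̃₅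
(`tau_sub_mem`). The bracket of lifts of σ_k and σ_l is -1/2 times this polynomial
(`corner_ihara_sigLift`), and the determinants are nonzero multiples of two-row determinants in the
coefficients of 1/d. These span ℂ[x₂, x₆] (`mon_mem_span_twoRow`), so M₀ is ℂ[x₂, x₆] τ₃₅; acting by
σ₃ and σ₅ fills the higher degrees (`range_le_Mmin`).

Freeness (`eq_zero_of_ev_mul_tau_mem_succ`) holds because σ̃₃, σ̃₅ is a regular sequence
(`dvd_of_sigTilde_five`), which reduces it to Σ-degree 0; there, a relation restricted to A = A' = 0
dies because σ̃₂ and σ̃₆ take arbitrary pairs of values on that plane. Uniqueness of φ is an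
induction over monomials, since the products by σ̃₂, σ̃₆, σ̃₃, σ̃₅ are well defined on classes. -/

theorem wt_x (a b : R) : wt a b x = a := by simp [wt, Theta_x]

theorem wt_y (a b : R) : wt a b y = b := by simp [wt, Theta_y]

theorem wt_add (a b : R) (p q : FL) : wt a b (p + q) = wt a b p + wt a b q := by simp [wt]

theorem wt_smul (a b : R) (c : ℂ) (p : FL) : wt a b (c • p) = c • wt a b p := by simp [wt]

theorem ent_x (a b : R) : ent a b x = 0 := by
  change Theta a b 0 0 x 0 1 = 0
  simp [Theta_x]

theorem ent_y (a b : R) : ent a b y = b := by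
  change Theta a b 0 0 y 0 1 = b
  simp [Theta_y]

theorem corner_x (a b a' b' : R) : corner a b a' b' x = 0 := by
  change Theta a b a' b' x 0 2 = 0
  simp [Theta_x]

theorem corner_y (a b a' b' : R) : corner a b a' b' y = 0 := by
  change Theta a b a' b' y 0 2 = 0
  simp [Theta_y]

theorem wt_add_add (a b a' b' : R) (p : FL) :
    wt (a + a') (b + b') p = wt a b p + wt a' b' p := by
  refine FL_induction (p := fun p => wt (a + a') (b + b') p = wt a b p + wt a' b' p)
    ?_ ?_ ?_ ?_ ?_ p
  · simp [wt_x]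
  · simp [wt_y]
  · intro p q hp hq
    rw [wt_add, wt_add, wt_add, hp, hq]; ring
  · intro c p hp
    rw [wt_smul, wt_smul, wt_smul, hp, smul_add]
  · intro p q _ _
    rw [wt_lie, wt_lie, wt_lie, add_zero]

/-- A derivation twisted by the character `wt a b` that vanishes at `x` is proportional to
`ent a b`. -/
theorem mul_twisted (a b : R) (d : FL →ₗ[ℂ] R)
    (hd : ∀ p q, d ⁅p, q⁆ = wt a b p * d q - wt a b q * d p) (hx : d x = 0) (p : FL) :
    b * d p = d y * ent a b p := by
  refine FL_induction (p := fun p => b * d p = d y * ent a b p) ?_ ?_ ?_ ?_ ?_ p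
  · rw [hx, ent_x, mul_zero, mul_zero]
  · rw [ent_y, mul_comm]
  · intro p q hp hq
    rw [map_add, map_add, mul_add, mul_add, hp, hq]
  · intro c p hp
    rw [map_smul, map_smul, mul_smul_comm, mul_smul_comm, hp]
  · intro p q hp hq
    rw [hd, ent_lie]
    linear_combination wt a b p * hq - wt a b q * hp

theorem twisted_eq_zero (a b : R) (d : FL →ₗ[ℂ] R)
    (hd : ∀ p q, d ⁅p, q⁆ = wt a b p * d q - wt a b q * d p) (hx : d x = 0) (hy : d y = 0)
    (p : FL) : d p = 0 := by
  refine FL_induction (p := fun p => d p = 0) hx hy ?_ ?_ ?_ p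
  · intro p q hp hq
    rw [map_add, hp, hq, add_zero]
  · intro c p hp
    rw [map_smul, hp, smul_zero]
  · intro p q hp hq
    rw [hd, hp, hq]; ring

theorem wt_D (a b : R) (f p : FL) : wt a b (D f p) = 0 := wt_Lbar a b (D_mem_Lbar f p)

/-- `wt` kills the image of `D f`, so both sides are derivations twisted by the same character; such
maps on a free Lie algebra are determined by their values at the generators, and at `y` the bracket
with `f` contributes `b * ent a b f`. -/
theorem ent_D (a b : R) {f : FL} (hf : f ∈ Lbar) (p : FL) :
    ent a b (D f p) = ent a b f * ent a b p := by
  refine FL_induction (p := fun p => ent a b (D f p) = ent a b f * ent a b p) ?_ ?_ ?_ ?_ ?_ p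
  · rw [D_x, ent_x, map_zero, mul_zero]
  · rw [D_y, ent_lie, wt_y, wt_Lbar a b hf, ent_y]; ring
  · intro p q hp hq
    rw [map_add, map_add, map_add, mul_add, hp, hq]
  · intro c p hp
    rw [map_smul, map_smul, map_smul, mul_smul_comm, hp]
  · intro p q hp hq
    rw [D_lie, map_sub, ent_lie, ent_lie, ent_lie, hp, hq, wt_D, wt_D]; ring

/-- The quadratic cross terms of `corner_lie` drop out because `ent` vanishes on the image of `D m`.
What remains is a derivation twisted by the sum of the two characters, hence a multiple of `ent (a +
a') (b + b')`. -/
theorem corner_D_of_mem_one (a b a' b' : R) {m : FL} (hm : m ∈ lcs 1) (p : FL) :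
    corner a b a' b' (D m p) = corner a b a' b' m * ent (a + a') (b + b') p := by
  refine FL_induction (p := fun p => corner a b a' b' (D m p) =
    corner a b a' b' m * ent (a + a') (b + b') p) ?_ ?_ ?_ ?_ ?_ p
  · rw [D_x, ent_x, map_zero, mul_zero]
  · rw [D_y, corner_lie, ent_y (a + a'), wt_y, wt_y, ent_one a b hm, ent_one a' b' hm,
      wt_Lbar a b (lcs_le 0 hm), wt_Lbar a' b' (lcs_le 0 hm)]
    ring
  · intro p q hp hq
    rw [map_add, map_add, map_add, mul_add, hp, hq]
  · intro c p hp
    rw [map_smul, map_smul, map_smul, mul_smul_comm, hp]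
  · intro p q hp hq
    have h (r s : R) (q : FL) : ent r s (D m q) = 0 := by
      rw [ent_D r s (lcs_le 0 hm), ent_one r s hm, zero_mul]
    rw [D_lie, map_sub, corner_lie, corner_lie, ent_lie, hp, hq, wt_D, wt_D, wt_D, wt_D,
      wt_add_add, wt_add_add, h, h, h, h]
    ring

theorem corner_D_mem_one (a b a' b' : R) {f m : FL} (hf : f ∈ Lbar) (hm : m ∈ lcs 1) :
    corner a b a' b' (D f m) = (ent a b f + ent a' b' f) * corner a b a' b' m := by
  have : m ∈ LinearMap.ker ((corner a b a' b').comp (D f : FL →ₗ[ℂ] FL) -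
      (ent a b f + ent a' b' f) • corner a b a' b') := by
    refine lie_ideal_induction Lbar Lbar _ ?_ hm
    intro p hp q hq
    rw [LinearMap.mem_ker, LinearMap.sub_apply, LinearMap.smul_apply]
    change corner a b a' b' (D f ⁅p, q⁆) - _ = 0
    rw [D_lie, map_sub, corner_Lbar_lie _ _ _ _ hp (D_mem_Lbar f q),
      corner_Lbar_lie _ _ _ _ hq (D_mem_Lbar f p), corner_Lbar_lie _ _ _ _ hp hq,
      ent_D a b hf, ent_D a b hf, ent_D a' b' hf, ent_D a' b' hf, smul_eq_mul]
    ring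
  rw [LinearMap.mem_ker, LinearMap.sub_apply, sub_eq_zero] at this
  exact this

/-- The defect of additivity `f(a, b) + f(a', b') - f(a + a', b + b')`. -/
def defect (a b a' b' : R) (f : FL) : R :=
  ent a b f + ent a' b' f - ent (a + a') (b + b') f

/-- The three terms of `defect` have two sources: `D f m` gives the two separate values of `f`, and
`D m f` gives the value at the sum. The Lie bracket itself contributes nothing. -/
theorem corner_ihara_mem_one (a b a' b' : R) {f m : FL} (hf : f ∈ Lbar) (hm : m ∈ lcs 1) :
    corner a b a' b' (ihara f m) = defect a b a' b' f * corner a b a' b' m := by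
  rw [ihara_apply, map_sub, map_add, corner_Lbar_lie _ _ _ _ hf (lcs_le 0 hm), ent_one a b hm,
    ent_one a' b' hm, corner_D_mem_one _ _ _ _ hf hm, corner_D_of_mem_one _ _ _ _ hm, defect]
  ring

/-- `corner` is not a twisted derivation, but `p ↦ corner (D f p)` and `(ent a b f + ent a' b' f) *
corner p` have the same cross terms. Their difference is a twisted derivation vanishing at `x`, to
which `mul_twisted` applies; the factor `b + b'` replaces a division. -/
theorem mul_corner_D (a b a' b' : R) {f : FL} (hf : f ∈ Lbar) (p : FL) :
    (b + b') * corner a b a' b' (D f p) =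
      (b + b') * ((ent a b f + ent a' b' f) * corner a b a' b' p) +
      corner a b a' b' ⁅y, f⁆ * ent (a + a') (b + b') p := by
  have h := mul_twisted (a + a') (b + b') ((corner a b a' b').comp (D f : FL →ₗ[ℂ] FL) -
      (ent a b f + ent a' b' f) • corner a b a' b') (by
    intro p q
    simp only [LinearMap.sub_apply, LinearMap.smul_apply, smul_eq_mul]
    change corner a b a' b' (D f ⁅p, q⁆) - _ = _ * (corner a b a' b' (D f q) - _) -
      _ * (corner a b a' b' (D f p) - _)
    rw [D_lie, map_sub, corner_lie, corner_lie, corner_lie, wt_D, wt_D, wt_D, wt_D,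
      ent_D a b hf, ent_D a b hf, ent_D a' b' hf, ent_D a' b' hf, wt_add_add, wt_add_add]
    ring) (by
    change corner a b a' b' (D f x) - _ * corner a b a' b' x = 0
    rw [D_x, corner_x, map_zero]; ring) p
  change (b + b') * (corner a b a' b' (D f p) - _ * corner a b a' b' p) =
    (corner a b a' b' (D f y) - _ * corner a b a' b' y) * _ at h
  rw [D_y, corner_y] at h
  linear_combination h

theorem corner_y_lie (a b a' b' : R) {f : FL} (hf : f ∈ Lbar) :
    corner a b a' b' ⁅y, f⁆ =
      (b + b') * corner a b a' b' f + b * ent a' b' f - b' * ent a b f := by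
  rw [corner_lie, wt_y, wt_y, wt_Lbar a b hf, wt_Lbar a' b' hf, ent_y, ent_y]; ring

theorem mul_corner_ihara (a b a' b' : R) {f g : FL} (hf : f ∈ Lbar) (hg : g ∈ Lbar) :
    (b + b') * corner a b a' b' (ihara f g) =
      defect a b a' b' f * corner a b a' b' ⁅y, g⁆ -
      defect a b a' b' g * corner a b a' b' ⁅y, f⁆ := by
  have h1 := mul_corner_D a b a' b' hf g
  have h2 := mul_corner_D a b a' b' hg f
  rw [ihara_apply, map_sub, map_add, corner_Lbar_lie _ _ _ _ hf hg, defect, defect]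
  rw [corner_y_lie _ _ _ _ hf] at h1 ⊢
  rw [corner_y_lie _ _ _ _ hg] at h2 ⊢
  linear_combination h1 - h2

theorem corner_swap (a b a' b' : R) (p : FL) :
    corner a' b' a b p = -corner a b a' b' p := by
  have := twisted_eq_zero (a + a') (b + b') (corner a' b' a b + corner a b a' b') (by
    intro p q
    simp only [LinearMap.add_apply, corner_lie, wt_add_add]
    ring) (by simp [corner_x]) (by simp [corner_y]) p
  exact eq_neg_of_add_eq_zero_left this

theorem ent_zero_right (a : R) (p : FL) : ent a 0 p = 0 :=
  twisted_eq_zero a 0 _ (ent_lie a 0) (ent_x a 0) (ent_y a 0) p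

theorem ent_zero_left (b : R) (p : FL) : ent 0 b p = wt 0 b p := by
  refine FL_induction (p := fun p => ent 0 b p = wt 0 b p) ?_ ?_ ?_ ?_ ?_ p
  · rw [ent_x, wt_x]
  · rw [ent_y, wt_y]
  · intro p q hp hq
    rw [map_add, wt_add, hp, hq]
  · intro c p hp
    rw [map_smul, wt_smul, hp]
  · intro p q hp hq
    rw [ent_lie, wt_lie, hp, hq]; ring

/-- At `a = 0` the map `ent` degenerates to the character `wt`, and the cross terms of `corner`
become those of a coboundary: adding suitable values of `ent` turns `corner` into a twisted
derivation. This lemma and the next four give the values on the hyperplanes where a divisibility has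
to be checked in `corner_ihara_sigLift`. -/
theorem corner_y_lie_zero₀ (b a' b' : R) {f : FL} (hf : f ∈ Lbar) :
    corner 0 b a' b' ⁅y, f⁆ = -b' * defect 0 b a' b' f := by
  have h := mul_twisted (0 + a') (b + b')
    (corner 0 b a' b' - ent (0 + a') (b + b') + ent a' b') (by
      intro p q
      simp only [LinearMap.sub_apply, LinearMap.add_apply, corner_lie, ent_lie, wt_add_add,
        ent_zero_left]
      ring) (by simp [corner_x, ent_x]) f
  simp only [LinearMap.sub_apply, LinearMap.add_apply, corner_y, ent_y] at h
  rw [corner_y_lie _ _ _ _ hf, defect, ent_zero_left, wt_Lbar 0 b hf]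
  linear_combination h

theorem corner_y_lie_zero₁ (a a' b' : R) {f : FL} (hf : f ∈ Lbar) :
    corner a 0 a' b' ⁅y, f⁆ = 0 := by
  have h : corner a 0 a' b' f = 0 := by
    refine twisted_eq_zero (a + a') (0 + b') _ ?_ (corner_x _ _ _ _) (corner_y _ _ _ _) f
    intro p q
    rw [corner_lie, ent_zero_right, ent_zero_right, wt_add_add, wt_add_add]; ring
  rw [corner_y_lie _ _ _ _ hf, h, ent_zero_right]; ring

theorem corner_y_lie_zero₂ (a b b' : R) {f : FL} (hf : f ∈ Lbar) :
    corner a b 0 b' ⁅y, f⁆ = b * defect a b 0 b' f := by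
  rw [corner_swap, corner_y_lie_zero₀ _ _ _ hf, defect, defect, add_comm 0 a, add_comm b' b]
  ring

theorem corner_y_lie_zero₃ (a b a' : R) {f : FL} (hf : f ∈ Lbar) :
    corner a b a' 0 ⁅y, f⁆ = 0 := by
  rw [corner_swap, corner_y_lie_zero₁ _ _ _ hf, neg_zero]

/-- On `b + b' = 0` the unknown value of `corner` at `f` is multiplied by zero. -/
theorem corner_y_lie_neg (a b a' : R) {f : FL} (hf : f ∈ Lbar) :
    corner a b a' (-b) ⁅y, f⁆ = b * defect a b a' (-b) f := by
  rw [corner_y_lie _ _ _ _ hf, defect, add_neg_cancel, ent_zero_right]; ring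

/-! ### Compatibility of the matrix entries with algebra morphisms. -/

variable {R' : Type*} [CommRing R'] [Algebra ℂ R']

theorem map_wt (φ : R →ₐ[ℂ] R') (a b : R) (p : FL) : φ (wt a b p) = wt (φ a) (φ b) p := by
  refine FL_induction (p := fun p => φ (wt a b p) = wt (φ a) (φ b) p) ?_ ?_ ?_ ?_ ?_ p
  · rw [wt_x, wt_x]
  · rw [wt_y, wt_y]
  · intro p q hp hq
    rw [wt_add, wt_add, map_add, hp, hq]
  · intro c p hp
    rw [wt_smul, wt_smul, map_smul, hp]
  · intro p q _ _
    rw [wt_lie, wt_lie, map_zero]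

theorem map_ent (φ : R →ₐ[ℂ] R') (a b : R) (p : FL) : φ (ent a b p) = ent (φ a) (φ b) p := by
  refine FL_induction (p := fun p => φ (ent a b p) = ent (φ a) (φ b) p) ?_ ?_ ?_ ?_ ?_ p
  · rw [ent_x, ent_x, map_zero]
  · rw [ent_y, ent_y]
  · intro p q hp hq
    rw [map_add, map_add, map_add, hp, hq]
  · intro c p hp
    rw [map_smul, map_smul, map_smul, hp]
  · intro p q hp hq
    rw [ent_lie, ent_lie, map_sub, map_mul, map_mul, hp, hq, map_wt, map_wt]

theorem map_corner (φ : R →ₐ[ℂ] R') (a b a' b' : R) (p : FL) :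
    φ (corner a b a' b' p) = corner (φ a) (φ b) (φ a') (φ b') p := by
  refine FL_induction (p := fun p => φ (corner a b a' b' p) =
    corner (φ a) (φ b) (φ a') (φ b') p) ?_ ?_ ?_ ?_ ?_ p
  · rw [corner_x, corner_x, map_zero]
  · rw [corner_y, corner_y, map_zero]
  · intro p q hp hq
    rw [map_add, map_add, map_add, hp, hq]
  · intro c p hp
    rw [map_smul, map_smul, map_smul, hp]
  · intro p q hp hq
    rw [corner_lie, corner_lie]
    simp only [map_sub, map_mul, map_add, hp, hq, map_wt, map_ent]

theorem map_defect (φ : R →ₐ[ℂ] R') (a b a' b' : R) (p : FL) :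
    φ (defect a b a' b' p) = defect (φ a) (φ b) (φ a') (φ b') p := by
  simp only [defect, map_sub, map_add, map_ent]

end Entries

/-! ### The image and the kernel of `iota` -/

theorem x_lie_e (i j : ℕ) : ⁅x, e i j⁆ = e (i + 1) j := by
  rw [e, e, pow_succ', Module.End.mul_apply, LieAlgebra.ad_apply]

/-- On `Lbar` the operators ad x and ad y commute modulo `lcs 1`, since their commutator is the
bracket with an element of `Lbar`. -/
theorem y_lie_ad_x_pow (i : ℕ) {m : FL} (hm : m ∈ Lbar) :
    ⁅y, ((LieAlgebra.ad ℂ FL x) ^ i) m⁆ - ((LieAlgebra.ad ℂ FL x) ^ i) ⁅y, m⁆ ∈ lcs 1 := by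
  induction i with
  | zero => simp
  | succ i ih =>
    have h : ⁅y, ((LieAlgebra.ad ℂ FL x) ^ (i + 1)) m⁆ -
        ((LieAlgebra.ad ℂ FL x) ^ (i + 1)) ⁅y, m⁆ =
        ⁅⁅y, x⁆, ((LieAlgebra.ad ℂ FL x) ^ i) m⁆ +
        ⁅x, ⁅y, ((LieAlgebra.ad ℂ FL x) ^ i) m⁆ - ((LieAlgebra.ad ℂ FL x) ^ i) ⁅y, m⁆⁆ := by
      rw [pow_succ', Module.End.mul_apply, Module.End.mul_apply, LieAlgebra.ad_apply,
        LieAlgebra.ad_apply, leibniz_lie, lie_sub]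
      abel
    rw [h]
    exact add_mem (LieSubmodule.lie_mem_lie (mem_Lbar_lie _ _) (ad_pow_mem _ _ hm))
      ((lcs 1).lie_mem ih)

/-- The span of the `e i j` modulo `lcs 1`. -/
def eSpan : Submodule ℂ FL := Submodule.span ℂ (Set.range fun p : ℕ × ℕ => e p.1 p.2) ⊔ lcsS 1

theorem e_mem_eSpan (i j : ℕ) : e i j ∈ eSpan :=
  Submodule.mem_sup_left (Submodule.subset_span ⟨(i, j), rfl⟩)

theorem lie_mem_eSpan (g : FL) : ∀ s ∈ eSpan, ⁅g, s⁆ ∈ eSpan := by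
  have key (g : FL) (h : ∀ i j, ⁅g, e i j⁆ ∈ eSpan) : ∀ s ∈ eSpan, ⁅g, s⁆ ∈ eSpan := by
    have : eSpan ≤ eSpan.comap (LieAlgebra.ad ℂ FL g : FL →ₗ[ℂ] FL) := by
      refine sup_le (Submodule.span_le.2 ?_) ?_
      · rintro _ ⟨p, rfl⟩
        exact h p.1 p.2
      · intro s hs
        exact Submodule.mem_sup_right ((lcs 1).lie_mem hs)
    exact this
  refine FL_induction (p := fun g => ∀ s ∈ eSpan, ⁅g, s⁆ ∈ eSpan) ?_ ?_ ?_ ?_ ?_ g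
  · refine key x fun i j => ?_
    rw [x_lie_e]
    exact e_mem_eSpan _ _
  · refine key y fun i j => ?_
    have h := y_lie_ad_x_pow i (ad_pow_mem y j (mem_Lbar_lie x y))
    have h2 : ⁅y, ((LieAlgebra.ad ℂ FL y) ^ j) ⁅x, y⁆⁆ =
        ((LieAlgebra.ad ℂ FL y) ^ (j + 1)) ⁅x, y⁆ := by
      rw [pow_succ', Module.End.mul_apply, LieAlgebra.ad_apply]
    rw [h2] at h
    have h3 := add_mem (show _ ∈ eSpan from Submodule.mem_sup_right h) (e_mem_eSpan i (j + 1))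
    have h4 := sub_add_cancel ⁅y, e i j⁆ (e i (j + 1))
    rw [← h4]
    exact h3
  · intro a b ha hb s hs
    rw [add_lie]
    exact add_mem (ha s hs) (hb s hs)
  · intro c a ha s hs
    rw [smul_lie]
    exact eSpan.smul_mem c (ha s hs)
  · intro a b ha hb s hs
    rw [lie_lie]
    exact sub_mem (ha _ (hb s hs)) (hb _ (ha s hs))

/-- `eSpan` is stable under the adjoint action and contains `⁅x, y⁆`, so by the Jacobi identity it
contains all brackets. -/
theorem Lbar_le_eSpan : Lbar.toSubmodule ≤ eSpan := by
  intro z hz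
  refine lie_ideal_induction ⊤ ⊤ eSpan ?_ hz
  intro g _ h _
  have hxy : ⁅x, y⁆ ∈ eSpan := by simpa [e] using e_mem_eSpan 0 0
  refine FL_induction (p := fun g => ∀ h, ⁅g, h⁆ ∈ eSpan) ?_ ?_ ?_ ?_ ?_ g h
  · intro h
    refine FL_induction (p := fun h => ⁅x, h⁆ ∈ eSpan) ?_ hxy ?_ ?_ ?_ h
    · simp
    · intro a b ha hb
      rw [lie_add]
      exact add_mem ha hb
    · intro c a ha
      rw [lie_smul]
      exact eSpan.smul_mem c ha
    · intro a b ha hb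
      rw [leibniz_lie, ← lie_skew _ b]
      exact add_mem (neg_mem (lie_mem_eSpan _ _ ha)) (lie_mem_eSpan _ _ hb)
  · intro h
    refine FL_induction (p := fun h => ⁅y, h⁆ ∈ eSpan) ?_ ?_ ?_ ?_ ?_ h
    · rw [← lie_skew]
      exact neg_mem hxy
    · simp
    · intro a b ha hb
      rw [lie_add]
      exact add_mem ha hb
    · intro c a ha
      rw [lie_smul]
      exact eSpan.smul_mem c ha
    · intro a b ha hb
      rw [leibniz_lie, ← lie_skew _ b]
      exact add_mem (neg_mem (lie_mem_eSpan _ _ ha)) (lie_mem_eSpan _ _ hb)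
  · intro a b ha hb h
    rw [add_lie]
    exact add_mem (ha h) (hb h)
  · intro c a ha h
    rw [smul_lie]
    exact eSpan.smul_mem c (ha h)
  · intro a b ha hb h
    rw [lie_lie]
    exact sub_mem (ha _) (hb _)

theorem lcs_one_le_span : lcsS 1 ≤
    Submodule.span ℂ (Set.range fun p : (ℕ × ℕ) × ℕ × ℕ => ⁅e p.1.1 p.1.2, e p.2.1 p.2.2⁆) ⊔
      lcsS 2 := by
  intro z hz
  refine lie_ideal_induction Lbar Lbar _ ?_ hz
  intro a ha b hb
  obtain ⟨s, hs, m, hm, rfl⟩ := Submodule.mem_sup.1 (Lbar_le_eSpan ha)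
  obtain ⟨t, ht, n, hn, rfl⟩ := Submodule.mem_sup.1 (Lbar_le_eSpan hb)
  have ht' : t ∈ Lbar := by
    have := sub_mem hb (lcs_le 0 hn)
    rwa [add_sub_cancel_right] at this
  rw [add_lie, lie_add]
  refine add_mem (add_mem ?_ ?_) ?_
  · refine Submodule.mem_sup_left ?_
    refine Submodule.span_induction ?_ ?_ ?_ ?_ hs
    · rintro _ ⟨p, rfl⟩
      refine Submodule.span_induction ?_ ?_ ?_ ?_ ht
      · rintro _ ⟨q, rfl⟩
        exact Submodule.subset_span ⟨(p, q), rfl⟩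
      · simp
      · intro u v _ _ hu hv
        rw [lie_add]
        exact add_mem hu hv
      · intro c u _ hu
        rw [lie_smul]
        exact Submodule.smul_mem _ c hu
    · simp
    · intro u v _ _ hu hv
      rw [add_lie]
      exact add_mem hu hv
    · intro c u _ hu
      rw [smul_lie]
      exact Submodule.smul_mem _ c hu
  · refine Submodule.mem_sup_right (LieSubmodule.lie_mem_lie ?_ hn)
    have := sub_mem ha (lcs_le 0 hm)
    rwa [add_sub_cancel_right] at this
  · rw [← lie_skew]
    exact Submodule.mem_sup_right (neg_mem (LieSubmodule.lie_mem_lie hb hm))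

/-- The exchange `(A, B) ↔ (A', B')`. -/
def swap : P4 →ₐ[ℂ] P4 := MvPolynomial.aeval ![vA', vB', vA, vB]

theorem swap_vA : swap vA = vA' := by simp [swap, vA]

theorem swap_vB : swap vB = vB' := by simp [swap, vB]

theorem swap_vA' : swap vA' = vA := by simp [swap, vA']

theorem swap_vB' : swap vB' = vB := by simp [swap, vB']

theorem P4_algHom_ext {S : Type*} [CommRing S] [Algebra ℂ S] {φ ψ : P4 →ₐ[ℂ] S}
    (hA : φ vA = ψ vA) (hB : φ vB = ψ vB) (hA' : φ vA' = ψ vA') (hB' : φ vB' = ψ vB') :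
    φ = ψ := by
  refine MvPolynomial.algHom_ext fun i => ?_
  fin_cases i
  exacts [hA, hB, hA', hB']

theorem swap_swap (f : P4) : swap (swap f) = f := by
  have : swap.comp swap = AlgHom.id ℂ P4 := by
    refine P4_algHom_ext ?_ ?_ ?_ ?_ <;>
      simp [swap_vA, swap_vB, swap_vA', swap_vB']
  exact DFunLike.congr_fun this f

/-- The product `A B A' B'`. -/
def varProd : P4 := vA * vB * vA' * vB'

theorem swap_varProd : swap varProd = varProd := by
  simp only [varProd, map_mul, swap_vA, swap_vB, swap_vA', swap_vB']; ring

theorem varProd_ne_zero : varProd ≠ 0 := by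
  simp [varProd, vA, vB, vA', vB', MvPolynomial.X_ne_zero]

/-- The class of `[e_{ij}, e_{kl}]` as a function of the monomial `A^i B^j A'^k B'^l`. -/
def rho : P4 →ₗ[ℂ] grL 1 :=
  (MvPolynomial.basisMonomials (Fin 4) ℂ).constr ℂ
    fun d => grLMk 1 ⟨⁅e (d 0) (d 1), e (d 2) (d 3)⁆, lie_e_mem _ _ _ _⟩

theorem rho_monomial (i j k l : ℕ) :
    rho (vA ^ i * vB ^ j * vA' ^ k * vB' ^ l) =
      grLMk 1 ⟨⁅e i j, e k l⁆, lie_e_mem i j k l⟩ := by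
  have h : vA ^ i * vB ^ j * vA' ^ k * vB' ^ l = MvPolynomial.basisMonomials (Fin 4) ℂ
      (Finsupp.single 0 i + Finsupp.single 1 j + Finsupp.single 2 k + Finsupp.single 3 l) := by
    simp [vA, vB, vA', vB', MvPolynomial.X_pow_eq_monomial, MvPolynomial.monomial_mul]
  rw [h, rho, Module.Basis.constr_basis]
  simp

theorem P4_induction {p : P4 → Prop}
    (h : ∀ i j k l, p (vA ^ i * vB ^ j * vA' ^ k * vB' ^ l))
    (hadd : ∀ f g, p f → p g → p (f + g)) (hsmul : ∀ (c : ℂ) f, p f → p (c • f)) (f : P4) :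
    p f := by
  refine MvPolynomial.induction_on' f ?_ hadd
  intro d c
  have h1 : MvPolynomial.monomial d c =
      c • (vA ^ d 0 * vB ^ d 1 * vA' ^ d 2 * vB' ^ d 3) := by
    rw [MvPolynomial.monomial_eq, Finsupp.prod_fintype _ _ (fun _ => pow_zero _),
      Fin.prod_univ_four, MvPolynomial.smul_eq_C_mul]
    rfl
  rw [h1]
  exact hsmul _ _ (h _ _ _ _)

theorem rho_swap (f : P4) : rho (swap f) = -rho f := by
  refine P4_induction (p := fun f => rho (swap f) = -rho f) ?_ ?_ ?_ f
  · intro i j k l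
    simp only [map_mul, map_pow, swap_vA, swap_vB, swap_vA', swap_vB']
    rw [show vA' ^ i * vB' ^ j * vA ^ k * vB ^ l = vA ^ k * vB ^ l * vA' ^ i * vB' ^ j by ring,
      rho_monomial, rho_monomial, ← map_neg]
    exact congrArg (grLMk 1) (Subtype.ext (lie_skew _ _).symm)
  · intro f g hf hg
    rw [map_add, map_add, map_add, hf, hg, neg_add]
  · intro c f hf
    rw [map_smul, map_smul, map_smul, hf, smul_neg]

theorem iota_rho (f : P4) : iota (rho f) = varProd * (f - swap f) := by
  refine P4_induction (p := fun f => iota (rho f) = varProd * (f - swap f)) ?_ ?_ ?_ f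
  · intro i j k l
    rw [rho_monomial, iota_e]
    simp only [map_mul, map_pow, swap_vA, swap_vB, swap_vA', swap_vB', varProd]
    ring
  · intro f g hf hg
    rw [map_add, map_add, map_add, hf, hg]; ring
  · intro c f hf
    rw [map_smul, map_smul, map_smul, hf, ← smul_sub, mul_smul_comm]

theorem rho_surjective : Function.Surjective rho := by
  rw [← LinearMap.range_eq_top, eq_top_iff]
  rintro z -
  obtain ⟨⟨z, hz⟩, rfl⟩ := Submodule.mkQ_surjective _ z
  obtain ⟨s, hs, m, hm, rfl⟩ := Submodule.mem_sup.1 (lcs_one_le_span hz)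
  have hs1 : s ∈ lcsS 1 := by
    have := sub_mem hz (lcs_le 1 hm)
    rwa [add_sub_cancel_right] at this
  have h1 : grLMk 1 ⟨s + m, hz⟩ = grLMk 1 ⟨s, hs1⟩ := by
    refine (Submodule.Quotient.eq _).2 ?_
    change s + m - s ∈ lcsS 2
    rwa [add_sub_cancel_left]
  change grLMk 1 ⟨s + m, hz⟩ ∈ _
  rw [h1]
  have h2 : Submodule.span ℂ (Set.range fun p : (ℕ × ℕ) × ℕ × ℕ => ⁅e p.1.1 p.1.2, e p.2.1 p.2.2⁆)
      ≤ ((LinearMap.range rho).comap (grLMk 1)).map (lcsS 1).subtype := by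
    refine Submodule.span_le.2 ?_
    rintro _ ⟨p, rfl⟩
    exact ⟨⟨_, lie_e_mem _ _ _ _⟩, ⟨_, rho_monomial p.1.1 p.1.2 p.2.1 p.2.2⟩, rfl⟩
  obtain ⟨t, ht, hts⟩ := h2 hs
  have : t = ⟨s, hs1⟩ := Subtype.ext hts
  rw [← this]
  exact ht

/-- `rho` is onto, and `iota ∘ rho` is antisymmetrization up to the factor `varProd`. A class killed
by `iota` therefore comes from a symmetric polynomial, on which `rho` is its own negative. -/
theorem iota_injective : Function.Injective iota := by
  rw [← LinearMap.ker_eq_bot, LinearMap.ker_eq_bot']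
  intro z hz
  obtain ⟨f, rfl⟩ := rho_surjective z
  rw [iota_rho] at hz
  have h1 : f = swap f := sub_eq_zero.1 ((mul_eq_zero.1 hz).resolve_left varProd_ne_zero)
  have h2 : rho f = -rho f := by
    conv_lhs => rw [h1]
    exact rho_swap f
  have h3 : (2 : ℂ) • rho f = 0 := by
    rw [two_smul]
    nth_rw 2 [h2]
    exact add_neg_cancel _
  exact (smul_eq_zero.1 h3).resolve_left two_ne_zero

theorem iota_exists {f : P4} (hf : swap f = -f) : ∃ z, iota z = varProd * f := by
  refine ⟨rho ((1 / 2 : ℂ) • f), ?_⟩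
  rw [iota_rho, map_smul, hf, smul_neg, sub_neg_eq_add, ← add_smul]
  norm_num

theorem swap_iota (z : grL 1) : swap (iota z) = -iota z := by
  obtain ⟨f, rfl⟩ := rho_surjective z
  rw [iota_rho, map_mul, map_sub, swap_swap, swap_varProd]; ring

theorem varProd_dvd_iota (z : grL 1) : varProd ∣ iota z := by
  obtain ⟨f, rfl⟩ := rho_surjective z
  exact ⟨_, iota_rho f⟩

theorem iota_grLMk (m : lcsS 1) : iota (grLMk 1 m) = corner vA vB vA' vB' (m : FL) := rfl

theorem iota_act (f : lcsS 0) (z : grL 1) :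
    iota (act (grLMk 0 f) z) = defect vA vB vA' vB' (f : FL) * iota z := by
  obtain ⟨m, rfl⟩ := Submodule.mkQ_surjective _ z
  change iota (act (grLMk 0 f) (grLMk 1 m)) = _ * iota (grLMk 1 m)
  rw [act_mk, iota_grLMk, iota_grLMk]
  exact corner_ihara_mem_one _ _ _ _ f.2 m.2

/-- For odd `k` the subtracted value at `(A + A', B + B')` is the power sum of the three opposite
forms, the last row of the array of nine forms. -/
theorem defect_sigLift {k : ℕ} (hk : Odd k) (h3 : 3 ≤ k) :
    defect vA vB vA' vB' (sigLift k) = sigTilde k := by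
  have h1 : (-vA - vA') ^ k = -(vA + vA') ^ k := by rw [← hk.neg_pow]; ring
  have h2 : (-vB - vB') ^ k = -(vB + vB') ^ k := by rw [← hk.neg_pow]; ring
  have h4 : (-(vA + vA') - (vB + vB')) ^ k = -(vA + vB + vA' + vB') ^ k := by
    rw [← hk.neg_pow]; ring
  rw [defect, ent_sigLift _ _ hk h3, ent_sigLift _ _ hk h3, ent_sigLift _ _ hk h3, sigTilde, h1,
    h2, h4]
  ring

theorem iota_act_sig {k : ℕ} (hk : Odd k) (h3 : 3 ≤ k) (z : grL 1) :
    iota (act (sig k) z) = sigTilde k * iota z := by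
  rw [sig, iota_act, defect_sigLift hk h3]

/-! ### Divisibility by the variables and the ideal `(A B', A' B)` -/

section Subst

variable {S : Type*} [CommRing S] [Algebra ℂ S]

/-- The evaluation of a polynomial in `A, B, A', B'`. -/
def evalAt (a b a' b' : S) : P4 →ₐ[ℂ] S := MvPolynomial.aeval ![a, b, a', b']

variable (a b a' b' : S)

@[simp] theorem evalAt_vA : evalAt a b a' b' vA = a := by simp [evalAt, vA]

@[simp] theorem evalAt_vB : evalAt a b a' b' vB = b := by simp [evalAt, vB]

@[simp] theorem evalAt_vA' : evalAt a b a' b' vA' = a' := by simp [evalAt, vA']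

@[simp] theorem evalAt_vB' : evalAt a b a' b' vB' = b' := by simp [evalAt, vB']

theorem evalAt_sigTilde (k : ℕ) : evalAt a b a' b' (sigTilde k) =
    a ^ k + b ^ k + (-a - b) ^ k + a' ^ k + b' ^ k + (-a' - b') ^ k +
    (-a - a') ^ k + (-b - b') ^ k + (a + b + a' + b') ^ k := by
  simp [sigTilde]

theorem evalAt_sigTilde_odd {k : ℕ} (hk : Odd k) : evalAt a b a' b' (sigTilde k) =
    a ^ k + b ^ k - (a + b) ^ k + a' ^ k + b' ^ k - (a' + b') ^ k -
    (a + a') ^ k - (b + b') ^ k + (a + b + a' + b') ^ k := by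
  have h (c d : S) : (-c - d) ^ k = -(c + d) ^ k := by rw [← hk.neg_pow]; ring
  rw [evalAt_sigTilde, h, h, h, h]; ring

theorem evalAt_lam (k : ℕ) : evalAt a b a' b' (lam k) =
    (a + b + a') ^ k - (a + a' + b') ^ k - (a + b + b') ^ k + (b + a' + b') ^ k +
    (a + b') ^ k - (a' + b) ^ k := by
  simp [lam]

end Subst

/-- Substituting for each variable something congruent to it does not change a polynomial modulo
`J`. Specialised to principal ideals, this turns vanishing on a hyperplane into divisibility by its
equation. -/
theorem sub_evalAt_mem (J : Ideal P4) {a b a' b' : P4} (hA : vA - a ∈ J) (hB : vB - b ∈ J)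
    (hA' : vA' - a' ∈ J) (hB' : vB' - b' ∈ J) (f : P4) : f - evalAt a b a' b' f ∈ J := by
  have h : (Ideal.Quotient.mkₐ ℂ J).comp (evalAt a b a' b') = Ideal.Quotient.mkₐ ℂ J := by
    refine P4_algHom_ext ?_ ?_ ?_ ?_
    · simpa using (Ideal.Quotient.eq.2 hA).symm
    · simpa using (Ideal.Quotient.eq.2 hB).symm
    · simpa using (Ideal.Quotient.eq.2 hA').symm
    · simpa using (Ideal.Quotient.eq.2 hB').symm
  exact Ideal.Quotient.eq.1 (DFunLike.congr_fun h f).symm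

theorem vA_dvd_sub (f : P4) : vA ∣ f - evalAt 0 vB vA' vB' f := by
  rw [← Ideal.mem_span_singleton]
  exact sub_evalAt_mem _ (by simp) (by simp) (by simp) (by simp) f

theorem vB_dvd_sub (f : P4) : vB ∣ f - evalAt vA 0 vA' vB' f := by
  rw [← Ideal.mem_span_singleton]
  exact sub_evalAt_mem _ (by simp) (by simp) (by simp) (by simp) f

theorem vA'_dvd_sub (f : P4) : vA' ∣ f - evalAt vA vB 0 vB' f := by
  rw [← Ideal.mem_span_singleton]
  exact sub_evalAt_mem _ (by simp) (by simp) (by simp) (by simp) f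

theorem vB'_dvd_sub (f : P4) : vB' ∣ f - evalAt vA vB vA' 0 f := by
  rw [← Ideal.mem_span_singleton]
  exact sub_evalAt_mem _ (by simp) (by simp) (by simp) (by simp) f

theorem vB_add_vB'_dvd_sub (f : P4) : vB + vB' ∣ f - evalAt vA vB vA' (-vB) f := by
  rw [← Ideal.mem_span_singleton]
  exact sub_evalAt_mem _ (by simp) (by simp) (by simp)
    (by simp [add_comm]) f

theorem vA_dvd {f : P4} (h : evalAt 0 vB vA' vB' f = 0) : vA ∣ f := by
  simpa [h] using vA_dvd_sub f

theorem vB_dvd {f : P4} (h : evalAt vA 0 vA' vB' f = 0) : vB ∣ f := by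
  simpa [h] using vB_dvd_sub f

theorem vA'_dvd {f : P4} (h : evalAt vA vB 0 vB' f = 0) : vA' ∣ f := by
  simpa [h] using vA'_dvd_sub f

theorem vB'_dvd {f : P4} (h : evalAt vA vB vA' 0 f = 0) : vB' ∣ f := by
  simpa [h] using vB'_dvd_sub f

theorem vB_add_vB'_dvd {f : P4} (h : evalAt vA vB vA' (-vB) f = 0) : vB + vB' ∣ f := by
  simpa [h] using vB_add_vB'_dvd_sub f

theorem evalAt_comp {S T : Type*} [CommRing S] [Algebra ℂ S] [CommRing T] [Algebra ℂ T]
    (φ : S →ₐ[ℂ] T) (a b a' b' : S) (f : P4) :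
    φ (evalAt a b a' b' f) = evalAt (φ a) (φ b) (φ a') (φ b') f := by
  have : φ.comp (evalAt a b a' b') = evalAt (φ a) (φ b) (φ a') (φ b') := by
    refine P4_algHom_ext ?_ ?_ ?_ ?_ <;> simp
  exact DFunLike.congr_fun this f

theorem isRelPrime_X {i : Fin 4} {f : P4} (φ : P4 →ₐ[ℂ] P4) (h : φ (MvPolynomial.X i) = 0)
    (hf : φ f ≠ 0) : IsRelPrime (MvPolynomial.X i) f := by
  refine ((MvPolynomial.X_prime (R := ℂ) (i := i)).irreducible.isRelPrime_iff_not_dvd).2 ?_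
  rintro ⟨g, rfl⟩
  exact hf (by rw [map_mul, h, zero_mul])

theorem vB_ne_zero : vB ≠ 0 := MvPolynomial.X_ne_zero _

theorem vA'_ne_zero : vA' ≠ 0 := MvPolynomial.X_ne_zero _

theorem vB'_ne_zero : vB' ≠ 0 := MvPolynomial.X_ne_zero _

theorem isRelPrime_vA_vB : IsRelPrime vA vB :=
  isRelPrime_X (evalAt 0 vB vA' vB') (evalAt_vA _ _ _ _) (by simpa using vB_ne_zero)

theorem isRelPrime_vA_vA' : IsRelPrime vA vA' :=
  isRelPrime_X (evalAt 0 vB vA' vB') (evalAt_vA _ _ _ _) (by simpa using vA'_ne_zero)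

theorem isRelPrime_vA_vB' : IsRelPrime vA vB' :=
  isRelPrime_X (evalAt 0 vB vA' vB') (evalAt_vA _ _ _ _) (by simpa using vB'_ne_zero)

theorem isRelPrime_vB_vA' : IsRelPrime vB vA' :=
  isRelPrime_X (evalAt vA 0 vA' vB') (evalAt_vB _ _ _ _) (by simpa using vA'_ne_zero)

theorem isRelPrime_vB_vB' : IsRelPrime vB vB' :=
  isRelPrime_X (evalAt vA 0 vA' vB') (evalAt_vB _ _ _ _) (by simpa using vB'_ne_zero)

theorem isRelPrime_vA'_vB' : IsRelPrime vA' vB' :=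
  isRelPrime_X (evalAt vA vB 0 vB') (evalAt_vA' _ _ _ _) (by simpa using vB'_ne_zero)

theorem varProd_dvd {f : P4} (hA : vA ∣ f) (hB : vB ∣ f) (hA' : vA' ∣ f) (hB' : vB' ∣ f) :
    varProd ∣ f := by
  have h1 := isRelPrime_vA_vB.mul_dvd hA hB
  have h2 := (isRelPrime_vA_vA'.mul_left isRelPrime_vB_vA').mul_dvd h1 hA'
  exact ((isRelPrime_vA_vB'.mul_left isRelPrime_vB_vB').mul_left isRelPrime_vA'_vB').mul_dvd
    h2 hB'

theorem isRelPrime_varProd_vB_add_vB' : IsRelPrime varProd (vB + vB') := by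
  refine (((?_ : IsRelPrime vA _).mul_left (?_ : IsRelPrime vB _)).mul_left
    (?_ : IsRelPrime vA' _)).mul_left (?_ : IsRelPrime vB' _)
  · refine isRelPrime_X (evalAt 0 0 vA' vB') (evalAt_vA _ _ _ _) ?_
    simpa using vB'_ne_zero
  · refine isRelPrime_X (evalAt vA 0 vA' vB') (evalAt_vB _ _ _ _) ?_
    simpa using vB'_ne_zero
  · refine isRelPrime_X (evalAt vA 0 0 vB') (evalAt_vA' _ _ _ _) ?_
    simpa using vB'_ne_zero
  · refine isRelPrime_X (evalAt vA vB vA' 0) (evalAt_vB' _ _ _ _) ?_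
    simpa using vB_ne_zero

/-- The ideal `(A B', A' B)`. -/
def crossIdeal : Ideal P4 := Ideal.span {vA * vB', vA' * vB}

theorem vA_vB'_mem : vA * vB' ∈ crossIdeal := Ideal.subset_span (by simp)

theorem vA'_vB_mem : vA' * vB ∈ crossIdeal := Ideal.subset_span (by simp)

theorem vA'_mul_vB_dvd {f : P4} (h1 : evalAt vA 0 vA' vB' f = 0) (h2 : evalAt vA vB 0 vB' f = 0) :
    vA' * vB ∣ f :=
  isRelPrime_vB_vA'.symm.mul_dvd (vA'_dvd h2) (vB_dvd h1)

theorem vA_mul_vB'_dvd {f : P4} (h1 : evalAt 0 vB vA' vB' f = 0) (h2 : evalAt vA vB vA' 0 f = 0) :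
    vA * vB' ∣ f :=
  isRelPrime_vA_vB'.mul_dvd (vA_dvd h1) (vB'_dvd h2)

/-- A polynomial that vanishes on the four planes `A = A' = 0`, `A = B = 0`, `B' = A' = 0`,
`B' = B = 0` lies in the ideal `(A B', A' B)`. -/
theorem mem_crossIdeal {f : P4} (h1 : evalAt 0 vB 0 vB' f = 0) (h2 : evalAt 0 0 vA' vB' f = 0)
    (h3 : evalAt vA vB 0 0 f = 0) (h4 : evalAt vA 0 vA' 0 f = 0) : f ∈ crossIdeal := by
  have e0 : evalAt 0 vB vA' vB' f ∈ crossIdeal := by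
    refine Ideal.mem_of_dvd _ (vA'_mul_vB_dvd ?_ ?_) vA'_vB_mem
    · rw [evalAt_comp]; simpa using h2
    · rw [evalAt_comp]; simpa using h1
  -- Inclusion and exclusion over the hyperplanes A = 0 and B' = 0: the two restrictions, corrected
  -- on their overlap, are multiples of A' B, and the remainder in `e2` vanishes on both, so it is a
  -- multiple of A B'.
  have e1 : evalAt vA vB vA' 0 f - evalAt 0 vB vA' 0 f ∈ crossIdeal := by
    refine Ideal.mem_of_dvd _ (vA'_mul_vB_dvd ?_ ?_) vA'_vB_mem
    · rw [map_sub, evalAt_comp, evalAt_comp]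
      have := congrArg (evalAt 0 vB vA' vB') h4
      rw [evalAt_comp] at this
      simp only [evalAt_vA, evalAt_vB, evalAt_vA', map_zero] at this ⊢
      rw [h4, this, sub_zero]
    · rw [map_sub, evalAt_comp, evalAt_comp]
      have := congrArg (evalAt 0 vB vA' vB') h3
      rw [evalAt_comp] at this
      simp only [evalAt_vA, evalAt_vB, evalAt_vA', map_zero] at this ⊢
      rw [h3, this, sub_zero]
  have e2 : f - evalAt 0 vB vA' vB' f - (evalAt vA vB vA' 0 f - evalAt 0 vB vA' 0 f) ∈
      crossIdeal := by
    refine Ideal.mem_of_dvd _ (vA_mul_vB'_dvd ?_ ?_) vA_vB'_mem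
    · simp only [map_sub, evalAt_comp, evalAt_vA, evalAt_vB, evalAt_vA', evalAt_vB', map_zero]
      ring
    · simp only [map_sub, evalAt_comp, evalAt_vA, evalAt_vB, evalAt_vA', evalAt_vB', map_zero]
      ring
  have := add_mem (add_mem e2 e1) e0
  rwa [sub_add_cancel, sub_add_cancel] at this

/-! ### The polynomials `λ_k` and `τ` -/

/-- This and the three lemmas that follow are the defining feature of λ_k: it equals σ̃_k on A = 0
and B' = 0, and -σ̃_k on A' = 0 and B = 0. Besides these boundary values only its antisymmetry and
homogeneity are used. -/
theorem vA_dvd_lam_sub {k : ℕ} (hk : Odd k) : vA ∣ lam k - sigTilde k := by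
  refine vA_dvd ?_
  rw [map_sub, evalAt_lam, evalAt_sigTilde_odd _ _ _ _ hk, zero_pow hk.pos.ne']
  ring

theorem vB'_dvd_lam_sub {k : ℕ} (hk : Odd k) : vB' ∣ lam k - sigTilde k := by
  refine vB'_dvd ?_
  rw [map_sub, evalAt_lam, evalAt_sigTilde_odd _ _ _ _ hk, zero_pow hk.pos.ne']
  ring

theorem vA'_dvd_lam_add {k : ℕ} (hk : Odd k) : vA' ∣ lam k + sigTilde k := by
  refine vA'_dvd ?_
  rw [map_add, evalAt_lam, evalAt_sigTilde_odd _ _ _ _ hk, zero_pow hk.pos.ne']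
  ring

theorem vB_dvd_lam_add {k : ℕ} (hk : Odd k) : vB ∣ lam k + sigTilde k := by
  refine vB_dvd ?_
  rw [map_add, evalAt_lam, evalAt_sigTilde_odd _ _ _ _ hk, zero_pow hk.pos.ne']
  ring

theorem cross_dvd_lam_sub {k : ℕ} (hk : Odd k) : vA * vB' ∣ lam k - sigTilde k :=
  isRelPrime_vA_vB'.mul_dvd (vA_dvd_lam_sub hk) (vB'_dvd_lam_sub hk)

theorem cross_dvd_lam_add {k : ℕ} (hk : Odd k) : vA' * vB ∣ lam k + sigTilde k :=
  isRelPrime_vB_vA'.symm.mul_dvd (vA'_dvd_lam_add hk) (vB_dvd_lam_add hk)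

theorem swap_sigTilde (k : ℕ) : swap (sigTilde k) = sigTilde k := by
  simp only [sigTilde, map_add, map_sub, map_neg, map_pow, swap_vA, swap_vB, swap_vA', swap_vB']
  ring

theorem swap_lam (k : ℕ) : swap (lam k) = -lam k := by
  simp only [lam, map_add, map_sub, map_pow, swap_vA, swap_vB, swap_vA', swap_vB']
  ring

/-- The polynomial `σ̃_k λ_l - σ̃_l λ_k`. -/
def tau (k l : ℕ) : P4 := sigTilde k * lam l - sigTilde l * lam k

theorem swap_tau (k l : ℕ) : swap (tau k l) = -tau k l := by
  simp only [tau, map_sub, map_mul, swap_sigTilde, swap_lam]; ring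

/-- A two-by-two determinant does not change when `lam` is replaced by `lam - sigTilde`, divisible
by A B', or by `lam + sigTilde`, divisible by A' B. -/
theorem varProd_dvd_tau {k l : ℕ} (hk : Odd k) (hl : Odd l) : varProd ∣ tau k l := by
  have h1 : vA * vB' ∣ tau k l := by
    have : tau k l = sigTilde k * (lam l - sigTilde l) - sigTilde l * (lam k - sigTilde k) := by
      rw [tau]; ring
    rw [this]
    exact dvd_sub ((cross_dvd_lam_sub hl).mul_left _) ((cross_dvd_lam_sub hk).mul_left _)
  have h2 : vA' * vB ∣ tau k l := by
    have : tau k l = sigTilde k * (lam l + sigTilde l) - sigTilde l * (lam k + sigTilde k) := by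
      rw [tau]; ring
    rw [this]
    exact dvd_sub ((cross_dvd_lam_add hl).mul_left _) ((cross_dvd_lam_add hk).mul_left _)
  exact varProd_dvd ((dvd_mul_right _ _).trans h1) ((dvd_mul_left _ _).trans h2)
    ((dvd_mul_right _ _).trans h2) ((dvd_mul_left _ _).trans h1)

/-- The ideal generated by `σ̃₃` and `σ̃₅`. -/
def sigIdeal : Ideal P4 := Ideal.span {sigTilde 3, sigTilde 5}

theorem sigTilde_three_mem : sigTilde 3 ∈ sigIdeal := Ideal.subset_span (by simp)

theorem sigTilde_five_mem : sigTilde 5 ∈ sigIdeal := Ideal.subset_span (by simp)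

/-- The multiples of `A B A' B'` by the elements of the `n`-th power of `sigIdeal`. -/
def powIdeal (n : ℕ) : Ideal P4 := Ideal.span {varProd} * sigIdeal ^ n

theorem mem_powIdeal {n : ℕ} {f : P4} : f ∈ powIdeal n ↔ ∃ g ∈ sigIdeal ^ n, f = varProd * g := by
  rw [powIdeal, Ideal.mem_span_singleton_mul]
  simp only [eq_comm]

theorem mul_mem_powIdeal {n r : ℕ} {f g : P4} (hf : f ∈ sigIdeal ^ r) (hg : g ∈ powIdeal n) :
    f * g ∈ powIdeal (n + r) := by
  rw [powIdeal, pow_add, ← mul_assoc, mul_comm f g]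
  exact Ideal.mul_mem_mul hg hf

theorem varProd_mul_mem_powIdeal {f : P4} (hf : f ∈ sigIdeal) : varProd * f ∈ powIdeal 1 :=
  mem_powIdeal.2 ⟨f, by rwa [pow_one], rfl⟩

/-- The elements of `(A B', A' B)` annihilate the class of `τ₃₅`. -/
theorem cross_mul_tau {f : P4} (hf : f ∈ crossIdeal) : f * tau35 ∈ powIdeal 1 := by
  obtain ⟨g, h, rfl⟩ := Ideal.mem_span_pair.1 hf
  have o3 : Odd 3 := ⟨1, rfl⟩
  have o5 : Odd 5 := ⟨2, rfl⟩
  obtain ⟨m3, h3⟩ := cross_dvd_lam_sub o3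
  obtain ⟨m5, h5⟩ := cross_dvd_lam_sub o5
  obtain ⟨n3, k3⟩ := cross_dvd_lam_add o3
  obtain ⟨n5, k5⟩ := cross_dvd_lam_add o5
  -- The coefficient A B' is paired with the form of τ₃₅ in which `lam + sigTilde` supplies the
  -- factor A' B, and A' B with the form in which `lam - sigTilde` supplies A B'.
  have : (g * (vA * vB') + h * (vA' * vB)) * tau35 =
      varProd * ((g * n5 + h * m5) * sigTilde 3 - (g * n3 + h * m3) * sigTilde 5) := by
    rw [tau35, varProd]
    linear_combination sigTilde 3 * g * (vA * vB') * k5 + sigTilde 3 * h * (vA' * vB) * h5 -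
      sigTilde 5 * g * (vA * vB') * k3 - sigTilde 5 * h * (vA' * vB) * h3
  rw [this]
  exact varProd_mul_mem_powIdeal (sub_mem (Ideal.mul_mem_left _ _ sigTilde_three_mem)
    (Ideal.mul_mem_left _ _ sigTilde_five_mem))

theorem sig_cross_mul_tau {f : P4} (hf : f ∈ sigIdeal * crossIdeal) : f * tau35 ∈ powIdeal 2 := by
  refine Submodule.mul_induction_on hf ?_ ?_
  · intro a ha b hb
    rw [mul_assoc]
    exact mul_mem_powIdeal (n := 1) (r := 1) (by rwa [pow_one]) (cross_mul_tau hb)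
  · intro a b ha hb
    rw [add_mul]
    exact add_mem ha hb

/-- The combination of σ̃₃, σ̃₅ that gives σ̃_k also gives λ_k from λ₃, λ₅ modulo `varProd`, because
the difference vanishes on all four coordinate hyperplanes. Then `tau k l` transforms by the
determinant of the two combinations. -/
theorem tau_sub_mem {k l : ℕ} (hk : Odd k) (hl : Odd l) {α β γ δ : P4}
    (h1 : sigTilde k = α * sigTilde 3 + β * sigTilde 5)
    (h2 : sigTilde l = γ * sigTilde 3 + δ * sigTilde 5) :
    tau k l - (α * δ - γ * β) * tau35 ∈ powIdeal 1 := by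
  have o3 : Odd 3 := ⟨1, rfl⟩
  have o5 : Odd 5 := ⟨2, rfl⟩
  have key {k : ℕ} (hk : Odd k) {α β : P4} (h : sigTilde k = α * sigTilde 3 + β * sigTilde 5) :
      varProd ∣ lam k - (α * lam 3 + β * lam 5) := by
    have e1 : lam k - (α * lam 3 + β * lam 5) = (lam k - sigTilde k) -
        (α * (lam 3 - sigTilde 3) + β * (lam 5 - sigTilde 5)) := by
      linear_combination h
    have e2 : lam k - (α * lam 3 + β * lam 5) = (lam k + sigTilde k) -
        (α * (lam 3 + sigTilde 3) + β * (lam 5 + sigTilde 5)) := by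
      linear_combination -h
    have d1 : vA * vB' ∣ lam k - (α * lam 3 + β * lam 5) := by
      rw [e1]
      exact dvd_sub (cross_dvd_lam_sub hk) (dvd_add ((cross_dvd_lam_sub o3).mul_left _)
        ((cross_dvd_lam_sub o5).mul_left _))
    have d2 : vA' * vB ∣ lam k - (α * lam 3 + β * lam 5) := by
      rw [e2]
      exact dvd_sub (cross_dvd_lam_add hk) (dvd_add ((cross_dvd_lam_add o3).mul_left _)
        ((cross_dvd_lam_add o5).mul_left _))
    exact varProd_dvd ((dvd_mul_right _ _).trans d1) ((dvd_mul_left _ _).trans d2)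
      ((dvd_mul_right _ _).trans d2) ((dvd_mul_left _ _).trans d1)
  obtain ⟨m, hm⟩ := key hk h1
  obtain ⟨n, hn⟩ := key hl h2
  have : tau k l - (α * δ - γ * β) * tau35 = varProd * (sigTilde k * n - sigTilde l * m) := by
    rw [tau, tau35]
    linear_combination sigTilde k * hn - sigTilde l * hm +
      (γ * lam 3 + δ * lam 5) * h1 - (α * lam 3 + β * lam 5) * h2
  rw [this]
  refine varProd_mul_mem_powIdeal (sub_mem (Ideal.mul_mem_right _ _ ?_)
    (Ideal.mul_mem_right _ _ ?_))
  · rw [h1]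
    exact add_mem (Ideal.mul_mem_left _ _ sigTilde_three_mem)
      (Ideal.mul_mem_left _ _ sigTilde_five_mem)
  · rw [h2]
    exact add_mem (Ideal.mul_mem_left _ _ sigTilde_three_mem)
      (Ideal.mul_mem_left _ _ sigTilde_five_mem)

/-- The class of `⟨σ_k, σ_l⟩` modulo the action of `σ̃_k` and `σ̃_l`. -/
theorem corner_ihara_sigLift {k l : ℕ} (hk : Odd k) (hk3 : 3 ≤ k) (hl : Odd l) (hl3 : 3 ≤ l) :
    ∃ m n : P4, tau k l + 2 * corner vA vB vA' vB' (ihara (sigLift k) (sigLift l)) =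
      varProd * (sigTilde k * n - sigTilde l * m) := by
  -- Checked on five hyperplanes, the last being B + B' = 0. The summand with B - B' is chosen to
  -- match the boundary values; it disappears from the final identity because its contributions,
  -- both multiples of σ̃_k σ̃_l, cancel.
  have key {k : ℕ} (hk : Odd k) (h3 : 3 ≤ k) : varProd * (vB + vB') ∣
      (vB + vB') * lam k + 2 * corner vA vB vA' vB' ⁅y, sigLift k⁆ -
        (vB - vB') * sigTilde k := by
    have hL : sigLift k ∈ Lbar := sigLift_mem k
    have hd (φ : P4 →ₐ[ℂ] P4) : defect (φ vA) (φ vB) (φ vA') (φ vB') (sigLift k) =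
        φ (sigTilde k) := by
      rw [← map_defect, defect_sigLift hk h3]
    refine isRelPrime_varProd_vB_add_vB'.mul_dvd (varProd_dvd ?_ ?_ ?_ ?_) ?_
    · refine vA_dvd ?_
      obtain ⟨c, hc⟩ := vA_dvd_lam_sub hk
      have h := congrArg (evalAt 0 vB vA' vB') hc
      have h' := hd (evalAt 0 vB vA' vB')
      simp only [map_sub, map_add, map_mul, map_corner, evalAt_vA, evalAt_vB, evalAt_vA',
        evalAt_vB', map_ofNat, corner_y_lie_zero₀ _ _ _ hL] at h h' ⊢
      rw [h']
      linear_combination (vB + vB') * h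
    · refine vB_dvd ?_
      obtain ⟨c, hc⟩ := vB_dvd_lam_add hk
      have h := congrArg (evalAt vA 0 vA' vB') hc
      simp only [map_sub, map_add, map_mul, map_corner, evalAt_vA, evalAt_vB, evalAt_vA',
        evalAt_vB', map_ofNat, corner_y_lie_zero₁ _ _ _ hL] at h ⊢
      linear_combination vB' * h
    · refine vA'_dvd ?_
      obtain ⟨c, hc⟩ := vA'_dvd_lam_add hk
      have h := congrArg (evalAt vA vB 0 vB') hc
      have h' := hd (evalAt vA vB 0 vB')
      simp only [map_sub, map_add, map_mul, map_corner, evalAt_vA, evalAt_vB, evalAt_vA',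
        evalAt_vB', map_ofNat, corner_y_lie_zero₂ _ _ _ hL] at h h' ⊢
      rw [h']
      linear_combination (vB + vB') * h
    · refine vB'_dvd ?_
      obtain ⟨c, hc⟩ := vB'_dvd_lam_sub hk
      have h := congrArg (evalAt vA vB vA' 0) hc
      simp only [map_sub, map_add, map_mul, map_corner, evalAt_vA, evalAt_vB, evalAt_vA',
        evalAt_vB', map_ofNat, corner_y_lie_zero₃ _ _ _ hL] at h ⊢
      linear_combination vB * h
    · refine vB_add_vB'_dvd ?_
      have h' := hd (evalAt vA vB vA' (-vB))
      simp only [map_sub, map_add, map_mul, map_corner, evalAt_vA, evalAt_vB, evalAt_vA',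
        evalAt_vB', map_ofNat, corner_y_lie_neg _ _ _ hL] at h' ⊢
      rw [h']
      ring
  obtain ⟨m, hm⟩ := key hk hk3
  obtain ⟨n, hn⟩ := key hl hl3
  have hS : vB + vB' ≠ 0 := by
    intro h
    have := congrArg (evalAt vA 0 vA' vB') h
    simp only [map_add, evalAt_vB, evalAt_vB', map_zero, zero_add] at this
    exact vB'_ne_zero this
  refine ⟨m, n, mul_left_cancel₀ hS ?_⟩
  have h := mul_corner_ihara vA vB vA' vB' (sigLift_mem k) (sigLift_mem l)
  rw [defect_sigLift hk hk3, defect_sigLift hl hl3] at h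
  rw [tau]
  linear_combination 2 * h + sigTilde k * hn - sigTilde l * hm

/-! ### Newton's identities for the nine linear forms of `sigTilde` -/

section Rows

variable {R : Type*} [CommRing R]

/-- The power sums of `r, s, -r-s`. -/
def rowSum (r s : R) (k : ℕ) : R := r ^ k + s ^ k + (-r - s) ^ k

def rowP (r s : R) : R := r ^ 2 + r * s + s ^ 2

def rowQ (r s : R) : R := -(r * s * (r + s))

theorem rowSum_zero (r s : R) : rowSum r s 0 = 3 := by
  simp only [rowSum, pow_zero]; norm_num

theorem rowSum_one (r s : R) : rowSum r s 1 = 0 := by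
  simp only [rowSum]; ring

theorem rowSum_two (r s : R) : rowSum r s 2 = 2 * rowP r s := by
  simp only [rowSum, rowP]; ring

/-- The three forms r, s, -r-s are the roots of T³ - pT - q with p = `rowP r s` and q = `rowQ r s`.
-/
theorem rowSum_add_three (r s : R) (k : ℕ) :
    rowSum r s (k + 3) = rowP r s * rowSum r s (k + 1) + rowQ r s * rowSum r s k := by
  simp only [rowSum, rowP, rowQ]; ring

/-- A sequence annihilated by one cubic T³ - pT - q is annihilated by the product of three such
cubics. The coefficients are symmetric in the three pairs, so the relations for the three rows can
be added. -/
theorem recurrence_nine {u : ℕ → R} {p q : R} (hu : ∀ k, u (k + 3) = p * u (k + 1) + q * u k)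
    (p' q' p'' q'' : R) (n : ℕ) :
    u (n + 9) - (p + p' + p'') * u (n + 7) - (q + q' + q'') * u (n + 6) +
      (p * p' + p * p'' + p' * p'') * u (n + 5) +
      (p * q' + p * q'' + p' * q + p' * q'' + p'' * q + p'' * q') * u (n + 4) +
      (q * q' + q * q'' + q' * q'' - p * p' * p'') * u (n + 3) -
      (p * p' * q'' + p * q' * p'' + q * p' * p'') * u (n + 2) -
      (p * q' * q'' + q * p' * q'' + q * q' * p'') * u (n + 1) - q * q' * q'' * u n = 0 := by
  linear_combination hu (n + 6) - (p' + p'') * hu (n + 4) - (q' + q'') * hu (n + 3) +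
    p' * p'' * hu (n + 2) + (p' * q'' + p'' * q') * hu (n + 1) + q' * q'' * hu n

end Rows

def p₁ : P4 := rowP vA vB
def p₂ : P4 := rowP vA' vB'
def p₃ : P4 := rowP (-vA - vA') (-vB - vB')
def q₁ : P4 := rowQ vA vB
def q₂ : P4 := rowQ vA' vB'
def q₃ : P4 := rowQ (-vA - vA') (-vB - vB')

/-- The elementary symmetric functions of the nine linear forms. -/
def el2 : P4 := -(p₁ + p₂ + p₃)
def el3 : P4 := q₁ + q₂ + q₃
def el4 : P4 := p₁ * p₂ + p₁ * p₃ + p₂ * p₃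
def el5 : P4 := -(p₁ * q₂ + p₁ * q₃ + p₂ * q₁ + p₂ * q₃ + p₃ * q₁ + p₃ * q₂)
def el6 : P4 := q₁ * q₂ + q₁ * q₃ + q₂ * q₃ - p₁ * p₂ * p₃
def el7 : P4 := p₁ * p₂ * q₃ + p₁ * q₂ * p₃ + q₁ * p₂ * p₃
def el8 : P4 := -(p₁ * q₂ * q₃ + q₁ * p₂ * q₃ + q₁ * q₂ * p₃)
def el9 : P4 := q₁ * q₂ * q₃

theorem sigTilde_eq_rowSum (k : ℕ) : sigTilde k = rowSum vA vB k + rowSum vA' vB' k +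
    rowSum (-vA - vA') (-vB - vB') k := by
  rw [sigTilde, rowSum, rowSum, rowSum,
    show -(-vA - vA') - (-vB - vB') = vA + vB + vA' + vB' by ring]
  ring

theorem newton_nine (n : ℕ) :
    sigTilde (n + 9) + el2 * sigTilde (n + 7) - el3 * sigTilde (n + 6) + el4 * sigTilde (n + 5) -
      el5 * sigTilde (n + 4) + el6 * sigTilde (n + 3) - el7 * sigTilde (n + 2) +
      el8 * sigTilde (n + 1) - el9 * sigTilde n = 0 := by
  have h1 := recurrence_nine (rowSum_add_three vA vB) p₂ q₂ p₃ q₃ n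
  have h2 := recurrence_nine (rowSum_add_three vA' vB') p₁ q₁ p₃ q₃ n
  have h3 := recurrence_nine (rowSum_add_three (-vA - vA') (-vB - vB')) p₁ q₁ p₂ q₂ n
  rw [← p₁, ← q₁] at h1
  rw [← p₂, ← q₂] at h2
  rw [← p₃, ← q₃] at h3
  simp only [sigTilde_eq_rowSum, el2, el3, el4, el5, el6, el7, el8, el9]
  linear_combination h1 + h2 + h3

theorem sigTilde_one : sigTilde 1 = 0 := by
  simp only [sigTilde_eq_rowSum, rowSum_one, add_zero]

theorem sigTilde_two : sigTilde 2 = -(2 * el2) := by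
  simp only [sigTilde_eq_rowSum, rowSum_two, el2, p₁, p₂, p₃]; ring

theorem sigTilde_three : sigTilde 3 = 3 * el3 := by
  simp only [sigTilde_eq_rowSum, rowSum_add_three _ _ 0, zero_add, rowSum_one, rowSum_zero, el3,
    q₁, q₂, q₃]
  ring

theorem sigTilde_four : sigTilde 4 = -(el2 * sigTilde 2) - 4 * el4 := by
  simp only [sigTilde_eq_rowSum, rowSum_add_three _ _ 1, Nat.reduceAdd, rowSum_one, rowSum_two,
    el2, el4, p₁, p₂, p₃]
  ring

theorem sigTilde_five : sigTilde 5 = -(el2 * sigTilde 3) + el3 * sigTilde 2 + 5 * el5 := by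
  simp only [sigTilde_eq_rowSum, rowSum_add_three _ _ 2, rowSum_add_three _ _ 0, Nat.reduceAdd,
    zero_add, rowSum_zero, rowSum_one, rowSum_two, el2, el3, el5, p₁, p₂, p₃, q₁, q₂, q₃]
  ring

theorem sigTilde_six : sigTilde 6 =
    -(el2 * sigTilde 4) + el3 * sigTilde 3 - el4 * sigTilde 2 - 6 * el6 := by
  simp only [sigTilde_eq_rowSum, rowSum_add_three _ _ 3, rowSum_add_three _ _ 1,
    rowSum_add_three _ _ 0, Nat.reduceAdd,
    zero_add, rowSum_zero, rowSum_one, rowSum_two, el2, el3, el4, el6, p₁, p₂, p₃, q₁, q₂, q₃]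
  ring

theorem sigTilde_seven : sigTilde 7 =
    -(el2 * sigTilde 5) + el3 * sigTilde 4 - el4 * sigTilde 3 + el5 * sigTilde 2 + 7 * el7 := by
  simp only [sigTilde_eq_rowSum, rowSum_add_three _ _ 4, rowSum_add_three _ _ 2,
    rowSum_add_three _ _ 1, rowSum_add_three _ _ 0, Nat.reduceAdd, zero_add, rowSum_zero,
    rowSum_one, rowSum_two, el2, el3, el4, el5, el7, p₁, p₂, p₃, q₁, q₂, q₃]
  ring

theorem sigTilde_eight : sigTilde 8 =
    -(el2 * sigTilde 6) + el3 * sigTilde 5 - el4 * sigTilde 4 + el5 * sigTilde 3 -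
      el6 * sigTilde 2 - 8 * el8 := by
  simp only [sigTilde_eq_rowSum, rowSum_add_three _ _ 5, rowSum_add_three _ _ 3,
    rowSum_add_three _ _ 2, rowSum_add_three _ _ 1, rowSum_add_three _ _ 0, Nat.reduceAdd,
    zero_add, rowSum_zero, rowSum_one, rowSum_two, el2, el3, el4, el5, el6, el8, p₁, p₂, p₃, q₁,
    q₂, q₃]
  ring

/-- Unlike the Newton identities, this and `el9_eq` use that the third row is minus the sum of the
other two. They place both functions in `sigIdeal * crossIdeal`, which is why only the elementary
functions of degrees 3 and 5 survive in the odd part. -/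
theorem el7_eq : 36 * el7 = sigTilde 3 * (sigTilde 2 ^ 2 - 4 * sigTilde 4) := by
  simp only [sigTilde, el7, p₁, p₂, p₃, q₁, q₂, q₃, rowP, rowQ]
  ring

theorem el9_eq : 29160 * el9 =
    sigTilde 3 * (15 * sigTilde 2 * (sigTilde 2 ^ 2 - 4 * sigTilde 4) + 40 * sigTilde 3 ^ 2) -
      54 * sigTilde 5 * (sigTilde 2 ^ 2 - 4 * sigTilde 4) := by
  simp only [sigTilde, el9, q₁, q₂, q₃, rowQ]
  ring

/-! ### Congruences modulo `crossIdeal` -/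

theorem mem_of_natCast_mul_mem {J : Ideal P4} (n : ℕ) [NeZero n] {f : P4} (h : (n : P4) * f ∈ J) :
    f ∈ J := by
  have h1 : MvPolynomial.C (1 / (n : ℂ)) * ((n : P4) * f) = f := by
    rw [← mul_assoc, ← map_natCast (MvPolynomial.C : ℂ →+* P4) n, ← map_mul,
      one_div_mul_cancel (NeZero.ne _), map_one, one_mul]
  rw [← h1]
  exact J.mul_mem_left _ h

/-- On each of the four planes of `mem_crossIdeal` the nine forms are three zeros and ±u, ±v, ±w
with u + v + w = 0, so odd power sums cancel. -/
theorem sigTilde_odd_mem_crossIdeal {k : ℕ} (hk : Odd k) : sigTilde k ∈ crossIdeal := by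
  have h0 := hk.pos.ne'
  refine mem_crossIdeal ?_ ?_ ?_ ?_ <;> 
    simp only [evalAt_sigTilde_odd _ _ _ _ hk, add_zero, zero_add, zero_pow h0] <;> ring

theorem sigIdeal_le_crossIdeal : sigIdeal ≤ crossIdeal := by
  refine Ideal.span_le.2 ?_
  rintro _ (rfl | rfl)
  · exact sigTilde_odd_mem_crossIdeal ⟨1, rfl⟩
  · exact sigTilde_odd_mem_crossIdeal ⟨2, rfl⟩

theorem discr_mem : sigTilde 2 ^ 2 - 4 * sigTilde 4 ∈ crossIdeal := by
  refine mem_crossIdeal ?_ ?_ ?_ ?_ <;>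
    simp only [map_sub, map_mul, map_pow, evalAt_sigTilde, map_ofNat] <;> ring

/-- On the four planes, the product of the factors 1 - ut is (1 - p t²)² - q² t⁶, with p and q the
coefficients of one row's cubic. There σ̃₂ = 4p and σ̃₆ = 4p³ + 6q², which explains the constants
here and in the next two lemmas, and those of d. -/
theorem el4_sub_mem : 16 * el4 - sigTilde 2 ^ 2 ∈ crossIdeal := by
  refine mem_crossIdeal ?_ ?_ ?_ ?_ <;>
    simp only [map_sub, map_mul, map_add, map_neg, map_pow, evalAt_sigTilde, map_ofNat, el4, p₁,
      p₂, p₃, rowP, evalAt_vA, evalAt_vB, evalAt_vA', evalAt_vB'] <;> ring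

theorem el6_sub_mem : 96 * el6 + 16 * sigTilde 6 - sigTilde 2 ^ 3 ∈ crossIdeal := by
  refine mem_crossIdeal ?_ ?_ ?_ ?_ <;>
    simp only [map_sub, map_mul, map_add, map_neg, map_pow, evalAt_sigTilde, map_ofNat, el6, p₁,
      p₂, p₃, q₁, q₂, q₃, rowP, rowQ, evalAt_vA, evalAt_vB, evalAt_vA', evalAt_vB'] <;> ring

theorem el8_mem : el8 ∈ crossIdeal := by
  refine mem_crossIdeal ?_ ?_ ?_ ?_ <;>
    simp only [map_sub, map_mul, map_add, map_neg, map_pow, el8, p₁,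
      p₂, p₃, q₁, q₂, q₃, rowP, rowQ, evalAt_vA, evalAt_vB, evalAt_vA', evalAt_vB'] <;> ring

theorem el3_mem : el3 ∈ sigIdeal := by
  refine mem_of_natCast_mul_mem 3 ?_
  rw [Nat.cast_ofNat, ← sigTilde_three]
  exact sigTilde_three_mem

theorem el5_mem : el5 ∈ sigIdeal := by
  refine mem_of_natCast_mul_mem 5 ?_
  have : ((5 : ℕ) : P4) * el5 = sigTilde 5 + el2 * sigTilde 3 - sigTilde 2 * el3 := by
    rw [Nat.cast_ofNat]
    linear_combination -sigTilde_five
  rw [this]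
  exact sub_mem (add_mem sigTilde_five_mem (Ideal.mul_mem_left _ _ sigTilde_three_mem))
    (Ideal.mul_mem_left _ _ el3_mem)

theorem el7_mem : el7 ∈ sigIdeal * crossIdeal := by
  refine mem_of_natCast_mul_mem 36 ?_
  rw [Nat.cast_ofNat, el7_eq]
  exact Ideal.mul_mem_mul sigTilde_three_mem discr_mem

theorem el9_mem : el9 ∈ sigIdeal * crossIdeal := by
  refine mem_of_natCast_mul_mem 29160 ?_
  rw [Nat.cast_ofNat, el9_eq]
  refine sub_mem (Ideal.mul_mem_mul sigTilde_three_mem (add_mem ?_ ?_)) (Ideal.mul_mem_mul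
    (Ideal.mul_mem_left _ _ sigTilde_five_mem) discr_mem)
  · exact Ideal.mul_mem_left _ _ discr_mem
  · rw [pow_two]
    exact Ideal.mul_mem_left _ _ (Ideal.mul_mem_left _ _
      (sigIdeal_le_crossIdeal sigTilde_three_mem))

/-! ### The power sums as polynomials in `σ̃₂, σ̃₆, σ̃₃, σ̃₅` -/

/-- The coefficients of `dSer` in degrees `2, 4, 6`. -/
def d2 : PV := -(MvPolynomial.C (1 / 2) * MvPolynomial.X Var.x2)
def d4 : PV := MvPolynomial.C (1 / 16) * MvPolynomial.X Var.x2 ^ 2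
def d6 : PV := -(MvPolynomial.C (1 / 6) * MvPolynomial.X Var.x6) +
  MvPolynomial.C (1 / 96) * MvPolynomial.X Var.x2 ^ 3

/-- The coefficient of `t ^ (2 n)` in `t ^ 4 / dSer`. -/
def invCoeff : ℕ → PV
  | 0 => 0
  | 1 => 0
  | 2 => 1
  | n + 3 => -(d2 * invCoeff (n + 2)) - d4 * invCoeff (n + 1) - d6 * invCoeff n

theorem invCoeff_add_three (n : ℕ) : invCoeff (n + 3) =
    -(d2 * invCoeff (n + 2)) - d4 * invCoeff (n + 1) - d6 * invCoeff n := by rw [invCoeff]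

/-- The evaluation of `x₂, x₆, x₃, x₅` at `σ̃₂, σ̃₆, σ̃₃, σ̃₅`. -/
def ev : PV →ₐ[ℂ] P4 := MvPolynomial.aeval fun
  | .x2 => sigTilde 2
  | .x6 => sigTilde 6
  | .x3 => sigTilde 3
  | .x5 => sigTilde 5

theorem ev_x2 : ev (MvPolynomial.X .x2) = sigTilde 2 := by simp [ev]

theorem ev_x6 : ev (MvPolynomial.X .x6) = sigTilde 6 := by simp [ev]

theorem ev_x3 : ev (MvPolynomial.X .x3) = sigTilde 3 := by simp [ev]

theorem ev_x5 : ev (MvPolynomial.X .x5) = sigTilde 5 := by simp [ev]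

theorem ofNat_mul_C_inv {σ : Type*} (n : ℕ) [n.AtLeastTwo] :
    (OfNat.ofNat n : MvPolynomial σ ℂ) * MvPolynomial.C (1 / (OfNat.ofNat n : ℂ)) = 1 := by
  rw [← map_ofNat (MvPolynomial.C : ℂ →+* MvPolynomial σ ℂ) n, ← map_mul, mul_one_div_cancel,
    map_one]
  exact OfNat.ofNat_ne_zero n

theorem two_mul_d2 : 2 * d2 = -MvPolynomial.X Var.x2 := by
  rw [d2]
  linear_combination (-MvPolynomial.X Var.x2) * ofNat_mul_C_inv (σ := Var) 2

theorem d4_eq : 16 * d4 = MvPolynomial.X Var.x2 ^ 2 := by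
  rw [d4]
  linear_combination (MvPolynomial.X Var.x2 ^ 2) * ofNat_mul_C_inv (σ := Var) 16

theorem d6_eq : 96 * d6 = -(16 * MvPolynomial.X Var.x6) + MvPolynomial.X Var.x2 ^ 3 := by
  rw [d6]
  linear_combination (MvPolynomial.X Var.x2 ^ 3) * ofNat_mul_C_inv (σ := Var) 96 -
    16 * MvPolynomial.X Var.x6 * ofNat_mul_C_inv (σ := Var) 6

theorem ev_d2 : ev d2 = el2 := by
  have h := congrArg ev two_mul_d2
  rw [map_mul, map_neg, ev_x2, map_ofNat, sigTilde_two, neg_neg] at h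
  exact mul_left_cancel₀ two_ne_zero h

theorem el4_sub_ev_mem : el4 - ev d4 ∈ crossIdeal := by
  refine mem_of_natCast_mul_mem 16 ?_
  have h := congrArg ev d4_eq
  rw [map_mul, map_pow, ev_x2, map_ofNat] at h
  rw [Nat.cast_ofNat, mul_sub, h]
  exact el4_sub_mem

theorem el6_sub_ev_mem : el6 - ev d6 ∈ crossIdeal := by
  refine mem_of_natCast_mul_mem 96 ?_
  have h := congrArg ev d6_eq
  rw [map_mul, map_add, map_neg, map_mul, map_pow, ev_x2, ev_x6, map_ofNat, map_ofNat] at h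
  have : ((96 : ℕ) : P4) * (el6 - ev d6) = 96 * el6 + 16 * sigTilde 6 - sigTilde 2 ^ 3 := by
    rw [Nat.cast_ofNat]
    linear_combination -h
  rw [this]
  exact el6_sub_mem

theorem ev_invCoeff_add_three (n : ℕ) : ev (invCoeff (n + 3)) =
    -(el2 * ev (invCoeff (n + 2))) - ev d4 * ev (invCoeff (n + 1)) - ev d6 * ev (invCoeff n) := by
  rw [invCoeff_add_three, map_sub, map_sub, map_neg, map_mul, map_mul, map_mul, ev_d2]

theorem ev_invCoeff_zero : ev (invCoeff 0) = 0 := by rw [invCoeff, map_zero]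

theorem ev_invCoeff_one : ev (invCoeff 1) = 0 := by rw [invCoeff, map_zero]

theorem ev_invCoeff_two : ev (invCoeff 2) = 1 := by rw [invCoeff, map_one]

theorem sigIdeal_mul_crossIdeal_le : sigIdeal * crossIdeal ≤ crossIdeal := Ideal.mul_le_right

/-- The main terms of the even and the odd power sums. -/
def evenMain (n : ℕ) : P4 := -(2 * el2 * ev (invCoeff (n + 2)) + 4 * ev d4 * ev (invCoeff (n + 1)) +
  6 * ev d6 * ev (invCoeff n))

def oddMain (n : ℕ) : P4 :=
  (2 * n + 3) * (ev (invCoeff (n + 2)) * el3 + ev (invCoeff (n + 1)) * el5)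

/-- Power sums are the coefficients of -t E'/E, and modulo `crossIdeal` the polynomial E reduces to
d; `evenMain` is the corresponding coefficient of -t d'/d. -/
theorem sigTilde_even_sub_mem (n : ℕ) : sigTilde (2 * n + 2) - evenMain n ∈ crossIdeal := by
  have m3 := sigIdeal_le_crossIdeal el3_mem
  have m5 := sigIdeal_le_crossIdeal el5_mem
  have m7 := sigIdeal_mul_crossIdeal_le el7_mem
  have m9 := sigIdeal_mul_crossIdeal_le el9_mem
  have m4 := el4_sub_ev_mem
  have m6 := el6_sub_ev_mem
  have m8 := el8_mem
  have k3 := ev_invCoeff_add_three 0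
  have k4 := ev_invCoeff_add_three 1
  have k5 := ev_invCoeff_add_three 2
  simp only [zero_add, Nat.reduceAdd, ev_invCoeff_zero, ev_invCoeff_one, ev_invCoeff_two]
    at k3 k4 k5
  -- The recurrence `newton_nine` yields even exponents from 10 on, so exponents 2, 4, 6, 8 need the
  -- initial Newton identities.
  have key : ∀ n, sigTilde (2 * n + 2) - evenMain n ∈ crossIdeal ∧
      sigTilde (2 * (n + 1) + 2) - evenMain (n + 1) ∈ crossIdeal ∧
      sigTilde (2 * (n + 2) + 2) - evenMain (n + 2) ∈ crossIdeal ∧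
      sigTilde (2 * (n + 3) + 2) - evenMain (n + 3) ∈ crossIdeal := by
    intro n
    induction n with
    | zero =>
      have b1 : sigTilde 2 - evenMain 0 ∈ crossIdeal := by
        have : sigTilde 2 - evenMain 0 = 0 := by
          rw [evenMain, sigTilde_two]
          simp only [zero_add, ev_invCoeff_zero, ev_invCoeff_one, ev_invCoeff_two]
          ring
        rw [this]
        exact zero_mem _
      have b2 : sigTilde 4 - evenMain 1 ∈ crossIdeal := by
        have : sigTilde 4 - evenMain 1 = -el2 * (sigTilde 2 - evenMain 0) -
            4 * (el4 - ev d4) := by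
          rw [evenMain, evenMain, sigTilde_four]
          simp only [zero_add, Nat.reduceAdd, k3, ev_invCoeff_zero, ev_invCoeff_one,
            ev_invCoeff_two]
          ring
        rw [this]
        exact sub_mem (Ideal.mul_mem_left _ _ b1) (Ideal.mul_mem_left _ _ m4)
      have b3 : sigTilde 6 - evenMain 2 ∈ crossIdeal := by
        have : sigTilde 6 - evenMain 2 = -el2 * (sigTilde 4 - evenMain 1) -
            el4 * (sigTilde 2 - evenMain 0) + sigTilde 3 * el3 - 6 * (el6 - ev d6) +
            2 * el2 * (el4 - ev d4) := by
          rw [evenMain, evenMain, evenMain, sigTilde_six]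
          simp only [zero_add, Nat.reduceAdd, k3, k4, ev_invCoeff_zero, ev_invCoeff_one,
            ev_invCoeff_two]
          ring
        rw [this]
        exact add_mem (sub_mem (add_mem (sub_mem (Ideal.mul_mem_left _ _ b2)
          (Ideal.mul_mem_left _ _ b1)) (Ideal.mul_mem_left _ _ m3)) (Ideal.mul_mem_left _ _ m6))
          (Ideal.mul_mem_left _ _ m4)
      have b4 : sigTilde 8 - evenMain 3 ∈ crossIdeal := by
        have : sigTilde 8 - evenMain 3 = -el2 * (sigTilde 6 - evenMain 2) -
            el4 * (sigTilde 4 - evenMain 1) - el6 * (sigTilde 2 - evenMain 0) +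
            sigTilde 5 * el3 + sigTilde 3 * el5 - 8 * el8 - evenMain 1 * (el4 - ev d4) -
            evenMain 0 * (el6 - ev d6) := by
          rw [evenMain, evenMain, evenMain, evenMain, sigTilde_eight]
          simp only [zero_add, Nat.reduceAdd, k3, k4, k5, ev_invCoeff_zero, ev_invCoeff_one,
            ev_invCoeff_two]
          ring
        rw [this]
        exact sub_mem (sub_mem (sub_mem (add_mem (add_mem (sub_mem (sub_mem
          (Ideal.mul_mem_left _ _ b3) (Ideal.mul_mem_left _ _ b2)) (Ideal.mul_mem_left _ _ b1))
          (Ideal.mul_mem_left _ _ m3)) (Ideal.mul_mem_left _ _ m5)) (Ideal.mul_mem_left _ _ m8))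
          (Ideal.mul_mem_left _ _ m4)) (Ideal.mul_mem_left _ _ m6)
      exact ⟨b1, b2, b3, b4⟩
    | succ n ih =>
      obtain ⟨-, i1, i2, i3⟩ := ih
      refine ⟨i1, i2, i3, ?_⟩
      have hN := newton_nine (2 * n + 1)
      have e1 := ev_invCoeff_add_three (n + 3)
      have e2 := ev_invCoeff_add_three (n + 2)
      have e3 := ev_invCoeff_add_three (n + 1)
      have : sigTilde (2 * (n + 1 + 3) + 2) - evenMain (n + 1 + 3) =
          -el2 * (sigTilde (2 * (n + 3) + 2) - evenMain (n + 3)) -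
          el4 * (sigTilde (2 * (n + 2) + 2) - evenMain (n + 2)) -
          el6 * (sigTilde (2 * (n + 1) + 2) - evenMain (n + 1)) -
          evenMain (n + 2) * (el4 - ev d4) - evenMain (n + 1) * (el6 - ev d6) -
          sigTilde (2 * n + 2) * el8 + sigTilde (2 * n + 7) * el3 + sigTilde (2 * n + 5) * el5 +
          sigTilde (2 * n + 3) * el7 + sigTilde (2 * n + 1) * el9 := by
        simp only [evenMain]
        ring_nf at hN e1 e2 e3 ⊢
        linear_combination hN + 2 * el2 * e1 + 4 * ev d4 * e2 + 6 * ev d6 * e3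
      rw [this]
      exact add_mem (add_mem (add_mem (add_mem (sub_mem (sub_mem (sub_mem (sub_mem (sub_mem
        (Ideal.mul_mem_left _ _ i3) (Ideal.mul_mem_left _ _ i2)) (Ideal.mul_mem_left _ _ i1))
        (Ideal.mul_mem_left _ _ m4)) (Ideal.mul_mem_left _ _ m6)) (Ideal.mul_mem_left _ _ m8))
        (Ideal.mul_mem_left _ _ m3)) (Ideal.mul_mem_left _ _ m5)) (Ideal.mul_mem_left _ _ m7))
        (Ideal.mul_mem_left _ _ m9)
  exact (key n).1

theorem oddMain_mem (n : ℕ) : oddMain n ∈ sigIdeal :=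
  Ideal.mul_mem_left _ _ (add_mem (Ideal.mul_mem_left _ _ el3_mem) (Ideal.mul_mem_left _ _ el5_mem))

/-- With E = E₀ - E₁ split into even and odd parts, the odd part of -log E is E₁/E₀ up to terms
cubic in E₁, which are negligible since `sigIdeal ≤ crossIdeal`. As E₁ already has coefficients in
`sigIdeal`, it suffices to know E₀ modulo `crossIdeal`. The proof runs this through Newton's
recurrence, where `el3` and `el5` multiply the even power sums. -/
theorem sigTilde_odd_sub_mem (n : ℕ) :
    sigTilde (2 * n + 3) - oddMain n ∈ sigIdeal * crossIdeal := by
  have m4 {f : P4} (hf : f ∈ sigIdeal) := Ideal.mul_mem_mul hf el4_sub_ev_mem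
  have m6 {f : P4} (hf : f ∈ sigIdeal) := Ideal.mul_mem_mul hf el6_sub_ev_mem
  have m8 {f : P4} (hf : f ∈ sigIdeal) := Ideal.mul_mem_mul hf el8_mem
  have m3 (n : ℕ) := Ideal.mul_mem_mul el3_mem (sigTilde_even_sub_mem n)
  have m5 (n : ℕ) := Ideal.mul_mem_mul el5_mem (sigTilde_even_sub_mem n)
  have k3 := ev_invCoeff_add_three 0
  have k4 := ev_invCoeff_add_three 1
  simp only [zero_add, Nat.reduceAdd, ev_invCoeff_zero, ev_invCoeff_one, ev_invCoeff_two]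
    at k3 k4
  -- The first component is carried for the `el8` term of the recurrence: `el8` is only in
  -- `crossIdeal`, so its cofactor must be in `sigIdeal`.
  have key : ∀ n, sigTilde (2 * n + 1) ∈ sigIdeal ∧
      sigTilde (2 * n + 3) - oddMain n ∈ sigIdeal * crossIdeal ∧
      sigTilde (2 * (n + 1) + 3) - oddMain (n + 1) ∈ sigIdeal * crossIdeal ∧
      sigTilde (2 * (n + 2) + 3) - oddMain (n + 2) ∈ sigIdeal * crossIdeal := by
    intro n
    induction n with
    | zero =>
      have b1 : sigTilde 3 - oddMain 0 = 0 := by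
        rw [oddMain, sigTilde_three]
        simp only [zero_add, ev_invCoeff_one, ev_invCoeff_two, Nat.cast_zero]
        ring
      have b2 : sigTilde 5 - oddMain 1 = 0 := by
        rw [oddMain, sigTilde_five, sigTilde_three, sigTilde_two]
        simp only [Nat.reduceAdd, k3, ev_invCoeff_two, Nat.cast_one]
        ring
      have b3 : sigTilde 7 - oddMain 2 ∈ sigIdeal * crossIdeal := by
        have : sigTilde 7 - oddMain 2 = 7 * el7 - 7 * (el3 * (el4 - ev d4)) := by
          rw [oddMain, sigTilde_seven, sigTilde_five, sigTilde_three, sigTilde_four, sigTilde_two]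
          simp only [Nat.reduceAdd, k3, k4, Nat.cast_ofNat]
          ring
        rw [this]
        exact sub_mem (Ideal.mul_mem_left _ _ el7_mem) (Ideal.mul_mem_left _ _ (m4 el3_mem))
      refine ⟨?_, ?_, ?_, b3⟩
      · change sigTilde 1 ∈ _
        rw [sigTilde_one]
        exact zero_mem _
      · change sigTilde 3 - oddMain 0 ∈ _
        rw [b1]
        exact zero_mem _
      · change sigTilde 5 - oddMain 1 ∈ _
        rw [b2]
        exact zero_mem _
    | succ n ih =>
      obtain ⟨i0, i1, i2, i3⟩ := ih
      refine ⟨?_, i2, i3, ?_⟩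
      · have := add_mem (Ideal.mul_le_left i1) (oddMain_mem n)
        rwa [sub_add_cancel] at this
      have hN := newton_nine (2 * n)
      have e1 := ev_invCoeff_add_three (n + 2)
      have e2 := ev_invCoeff_add_three (n + 1)
      have : sigTilde (2 * (n + 1 + 2) + 3) - oddMain (n + 1 + 2) =
          -el2 * (sigTilde (2 * (n + 2) + 3) - oddMain (n + 2)) -
          el4 * (sigTilde (2 * (n + 1) + 3) - oddMain (n + 1)) -
          el6 * (sigTilde (2 * n + 3) - oddMain n) -
          oddMain (n + 1) * (el4 - ev d4) - oddMain n * (el6 - ev d6) -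
          sigTilde (2 * n + 1) * el8 +
          el3 * (sigTilde (2 * (n + 2) + 2) - evenMain (n + 2)) +
          el5 * (sigTilde (2 * (n + 1) + 2) - evenMain (n + 1)) +
          sigTilde (2 * n + 2) * el7 + sigTilde (2 * n) * el9 := by
        simp only [evenMain, oddMain]
        push_cast
        ring_nf at hN e1 e2 ⊢
        linear_combination hN - (2 * n + 9) * el3 * e1 - (2 * n + 9) * el5 * e2
      rw [this]
      exact add_mem (add_mem (add_mem (add_mem (sub_mem (sub_mem (sub_mem (sub_mem (sub_mem
        (Ideal.mul_mem_left _ _ i3) (Ideal.mul_mem_left _ _ i2)) (Ideal.mul_mem_left _ _ i1))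
        (m4 (oddMain_mem _))) (m6 (oddMain_mem _))) (m8 i0))
        (m3 _)) (m5 _)) (Ideal.mul_mem_left _ _ el7_mem)) (Ideal.mul_mem_left _ _ el9_mem)
  exact (key n).2.1

/-! ### The span of the determinants `h_p h_q - h_{p+1} h_{q-1}` -/

section Determinants

variable {R : Type*} [CommRing R]

/-- A sequence with `∑ u n T ^ n = T ^ 2 / ((1 - a T) ^ 2 - X T ^ 3)`. -/
structure IsDoubleRootSeq (a X : R) (u : ℕ → R) : Prop where
  zero : u 0 = 0
  one : u 1 = 0
  two : u 2 = 1
  step : ∀ n, u (n + 3) = 2 * a * u (n + 2) - a ^ 2 * u (n + 1) + X * u n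

/-- The two-row determinants of a sequence. -/
def twoRow (u : ℕ → R) (p q : ℕ) : R := u (p + 2) * u (q + 2) - u (p + 3) * u (q + 1)

theorem twoRow_comm (u : ℕ → R) (p q : ℕ) : twoRow u p (q + 1) = -twoRow u q (p + 1) := by
  simp only [twoRow, add_assoc, Nat.reduceAdd]; ring

variable {a X : R} {u : ℕ → R} (hu : IsDoubleRootSeq a X u)

include hu

theorem IsDoubleRootSeq.three : u 3 = 2 * a := by
  have := hu.step 0
  simp only [zero_add, hu.zero, hu.one, hu.two] at this
  linear_combination this

theorem IsDoubleRootSeq.four : u 4 = 3 * a ^ 2 := by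
  have := hu.step 1
  simp only [Nat.reduceAdd, hu.three, hu.one, hu.two] at this
  linear_combination this

theorem IsDoubleRootSeq.five : u 5 = 4 * a ^ 3 + X := by
  have := hu.step 2
  simp only [Nat.reduceAdd, hu.three, hu.four, hu.two] at this
  linear_combination this

/-- This is `relation` continued to negative second indices: extending the recurrence backwards
gives X u₋₁ = 1, so the last term becomes -X times the determinant on the left and changes the
factor 2 into 3. -/
theorem IsDoubleRootSeq.relation_zero (p : ℕ) : 3 * (X * twoRow u p 0) =
    twoRow u (p + 3) 0 - 2 * twoRow u (p + 2) 1 + twoRow u (p + 1) 2 := by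
  simp only [twoRow, add_assoc, Nat.reduceAdd, zero_add, hu.one, hu.two, hu.three, hu.four,
    hu.step (p + 3), hu.step (p + 2), hu.step (p + 1)]
  ring

theorem IsDoubleRootSeq.relation_one (p : ℕ) : 2 * (X * twoRow u p 1) =
    twoRow u (p + 3) 1 - 2 * twoRow u (p + 2) 2 + twoRow u (p + 1) 3 -
      2 * (X * twoRow u (p + 1) 0) := by
  simp only [twoRow, add_assoc, Nat.reduceAdd, zero_add, hu.one, hu.two, hu.three, hu.four,
    hu.five, hu.step (p + 3), hu.step (p + 2), hu.step (p + 1)]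
  ring

theorem IsDoubleRootSeq.relation (p q : ℕ) : 2 * (X * twoRow u (p + 1) (q + 2)) =
    twoRow u (p + 4) (q + 2) - 2 * twoRow u (p + 3) (q + 3) + twoRow u (p + 2) (q + 4) -
      2 * (X * twoRow u (p + 2) (q + 1)) + X * (X * twoRow u p q) := by
  simp only [twoRow, add_assoc, Nat.reduceAdd,
    hu.step (p + 4), hu.step (p + 3), hu.step (p + 2), hu.step (p + 1),
    hu.step (q + 3), hu.step (q + 2), hu.step (q + 1)]
  ring

variable [Algebra ℂ R]

/-- The span of the two-row determinants of given total degree and bounded second index. -/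
def twoRowSpan (u : ℕ → R) (N q : ℕ) : Submodule ℂ R :=
  Submodule.span ℂ {z | ∃ p' q', p' + q' = N ∧ q' ≤ q ∧ z = twoRow u p' q'}

omit hu in
theorem twoRow_mem (u : ℕ → R) {N q p' q' : ℕ} (h : p' + q' = N) (h' : q' ≤ q) :
    twoRow u p' q' ∈ twoRowSpan u N q := Submodule.subset_span ⟨p', q', h, h', rfl⟩

omit hu in
theorem twoRowSpan_mono (u : ℕ → R) (N : ℕ) {q r : ℕ} (h : q ≤ r) :
    twoRowSpan u N q ≤ twoRowSpan u N r :=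
  Submodule.span_mono fun _ ⟨p', q', h1, h2, h3⟩ => ⟨p', q', h1, h2.trans h, h3⟩

/-- The exact leading coefficient c_q is needed to close the induction. Substituting the statement
for q into `relation` leaves (2 - c_q) times the product by X for q + 2, so c_{q+2} = 1 / (2 - c_q).
With c₀ = 1/3 and c₁ = 1/2 the solution is (q+1)/(q+3), and 2 - c_q never vanishes. -/
theorem IsDoubleRootSeq.mul_twoRow_sub_mem (q : ℕ) : ∀ p, q ≤ p + 1 →
    X * twoRow u p q - ((q + 1 : ℂ) / (q + 3)) • twoRow u (p + 1) (q + 2) ∈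
      twoRowSpan u (p + q + 3) (q + 1) := by
  induction q using Nat.strong_induction_on with
  | _ q ih =>
    -- The bound on `N` guarantees that every generator of this span satisfies the restriction on
    -- its two indices required by the induction hypothesis.
    have hmul (N r : ℕ) (hr : r < q) (hN : 2 * r ≤ N + 1) {v : R} (hv : v ∈ twoRowSpan u N r) :
        X * v ∈ twoRowSpan u (N + 3) (r + 2) := by
      refine Submodule.span_induction ?_ ?_ ?_ ?_ hv
      · rintro _ ⟨p', q', h1, h2, rfl⟩
        have := ih q' (by omega) p' (by omega)
        have h3 := add_mem (twoRowSpan_mono u _ (show q' + 1 ≤ r + 2 by omega) this)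
          (Submodule.smul_mem _ ((q' + 1 : ℂ) / (q' + 3))
            (twoRow_mem u (N := p' + q' + 3) (q := r + 2) (p' := p' + 1) (q' := q' + 2)
              (by omega) (by omega)))
        rw [sub_add_cancel] at h3
        rwa [← h1]
      · rw [mul_zero]
        exact zero_mem _
      · intro v w _ _ hv hw
        rw [mul_add]
        exact add_mem hv hw
      · intro c v _ hv
        rw [mul_smul_comm]
        exact Submodule.smul_mem _ c hv
    intro p hp
    match q with
    | 0 =>
      have h : X * twoRow u p 0 - (((0 : ℕ) + 1 : ℂ) / ((0 : ℕ) + 3)) • twoRow u (p + 1) 2 =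
          (1 / 3 : ℂ) • (twoRow u (p + 3) 0 - (2 : ℂ) • twoRow u (p + 2) 1) := by
        have := hu.relation_zero p
        have h3 : (3 : ℂ) • (X * twoRow u p 0) = 3 * (X * twoRow u p 0) := by
          rw [Algebra.smul_def, map_ofNat]
        have h2 : (2 : ℂ) • twoRow u (p + 2) 1 = 2 * twoRow u (p + 2) 1 := by
          rw [Algebra.smul_def, map_ofNat]
        rw [← h3, ← h2] at this
        have h4 := congrArg (fun z => (1 / 3 : ℂ) • z) this
        simp only [smul_smul] at h4
        rw [show (1 / 3 : ℂ) * 3 = 1 by norm_num, one_smul] at h4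
        rw [h4]
        push_cast
        module
      rw [h]
      exact Submodule.smul_mem _ _ (sub_mem (twoRow_mem u (by omega) (by omega))
        (Submodule.smul_mem _ _ (twoRow_mem u (by omega) (by omega))))
    | 1 =>
      have h : X * twoRow u p 1 - (((1 : ℕ) + 1 : ℂ) / ((1 : ℕ) + 3)) • twoRow u (p + 1) 3 =
          (1 / 2 : ℂ) • (twoRow u (p + 3) 1 - (2 : ℂ) • twoRow u (p + 2) 2 -
            (2 : ℂ) • (X * twoRow u (p + 1) 0)) := by
        have := hu.relation_one p
        have hs (z : R) : 2 * z = (2 : ℂ) • z := by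
          rw [Algebra.smul_def, map_ofNat]
        rw [hs, hs, hs] at this
        have h4 := congrArg (fun z => (1 / 2 : ℂ) • z) this
        simp only [smul_smul] at h4
        rw [show (1 / 2 : ℂ) * 2 = 1 by norm_num, one_smul] at h4
        rw [h4]
        push_cast
        module
      rw [h]
      refine Submodule.smul_mem _ _ (sub_mem (sub_mem (twoRow_mem u (by omega) (by omega))
        (Submodule.smul_mem _ _ (twoRow_mem u (by omega) (by omega))))
        (Submodule.smul_mem _ _ ?_))
      exact hmul (p + 1) 0 (by omega) (by omega) (twoRow_mem u (by omega) (by omega))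
    | q + 2 =>
      obtain ⟨p, rfl⟩ : ∃ r, p = r + 1 := ⟨p - 1, by omega⟩
      have hv := ih q (by omega) p (by omega)
      obtain ⟨v, hv', hvv⟩ : ∃ v ∈ twoRowSpan u (p + q + 3) (q + 1),
          X * twoRow u p q = ((q + 1 : ℂ) / (q + 3)) • twoRow u (p + 1) (q + 2) + v :=
        ⟨_, hv, by abel⟩
      have h : X * twoRow u (p + 1) (q + 2) -
          (((q + 2 : ℕ) + 1 : ℂ) / ((q + 2 : ℕ) + 3)) • twoRow u (p + 1 + 1) (q + 2 + 2) =
          ((q + 3 : ℂ) / (q + 5)) • (twoRow u (p + 4) (q + 2) - (2 : ℂ) • twoRow u (p + 3) (q + 3) -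
            (2 : ℂ) • (X * twoRow u (p + 2) (q + 1)) + X * v) := by
        have := hu.relation p q
        have hs (z : R) : 2 * z = (2 : ℂ) • z := by
          rw [Algebra.smul_def, map_ofNat]
        rw [hs, hs, hs, hvv, mul_add, mul_smul_comm] at this
        have h5 : (q + 5 : ℂ) ≠ 0 := by exact_mod_cast (Nat.succ_ne_zero (q + 4))
        have h3 : (q + 3 : ℂ) ≠ 0 := by exact_mod_cast (Nat.succ_ne_zero (q + 2))
        have h6 : ((q + 5 : ℂ) / (q + 3)) • (X * twoRow u (p + 1) (q + 2)) =
            twoRow u (p + 4) (q + 2) - (2 : ℂ) • twoRow u (p + 3) (q + 3) +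
            twoRow u (p + 2) (q + 4) - (2 : ℂ) • (X * twoRow u (p + 2) (q + 1)) + X * v := by
          have e : ((q + 5 : ℂ) / (q + 3)) = 2 - (q + 1) / (q + 3) := by
            field_simp
            ring
          rw [e, sub_smul, this]
          abel
        have h7 := congrArg (fun z => ((q + 3 : ℂ) / (q + 5)) • z) h6
        simp only [smul_smul] at h7
        rw [show ((q + 3 : ℂ) / (q + 5)) * ((q + 5) / (q + 3)) = 1 by field_simp, one_smul] at h7
        rw [h7]
        push_cast
        rw [show (q + 2 + 1 : ℂ) = q + 3 by ring, show (q + 2 + 3 : ℂ) = q + 5 by ring]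
        module
      rw [h]
      refine Submodule.smul_mem _ _ (add_mem (sub_mem (sub_mem (twoRow_mem u (by omega) (by omega))
        (Submodule.smul_mem _ _ (twoRow_mem u (by omega) (by omega))))
        (Submodule.smul_mem _ _ ?_)) ?_)
      · rw [show p + 1 + (q + 2) + 3 = (p + q + 3) + 3 by omega]
        exact hmul (p + q + 3) (q + 1) (by omega) (by omega) (twoRow_mem u (by omega) (by omega))
      · rw [show p + 1 + (q + 2) + 3 = (p + q + 3) + 3 by omega]
        exact hmul (p + q + 3) (q + 1) (by omega) (by omega) hv'

/-- The antisymmetry `twoRow_comm` brings every determinant into the range of indices covered by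
`mul_twoRow_sub_mem`. -/
theorem IsDoubleRootSeq.mul_mem_span {z : R}
    (hz : z ∈ Submodule.span ℂ (Set.range fun p : ℕ × ℕ => twoRow u p.1 p.2)) :
    X * z ∈ Submodule.span ℂ (Set.range fun p : ℕ × ℕ => twoRow u p.1 p.2) := by
  have key (p q : ℕ) (h : q ≤ p + 1) : X * twoRow u p q ∈
      Submodule.span ℂ (Set.range fun p : ℕ × ℕ => twoRow u p.1 p.2) := by
    have h1 := hu.mul_twoRow_sub_mem q p h
    have h2 : twoRowSpan u (p + q + 3) (q + 1) ≤
        Submodule.span ℂ (Set.range fun p : ℕ × ℕ => twoRow u p.1 p.2) := by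
      refine Submodule.span_mono ?_
      rintro _ ⟨p', q', -, -, rfl⟩
      exact ⟨(p', q'), rfl⟩
    have h3 := add_mem (h2 h1) (Submodule.smul_mem _ ((q + 1 : ℂ) / (q + 3))
      (Submodule.subset_span ⟨(p + 1, q + 2), rfl⟩))
    rwa [sub_add_cancel] at h3
  refine Submodule.span_induction ?_ ?_ ?_ ?_ hz
  · rintro _ ⟨⟨p, q⟩, rfl⟩
    by_cases h : q ≤ p + 1
    · exact key p q h
    · obtain ⟨q, rfl⟩ : ∃ r, q = r + 1 := ⟨q - 1, by omega⟩
      change X * twoRow u p (q + 1) ∈ _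
      rw [twoRow_comm, mul_neg]
      exact neg_mem (key q (p + 1) (by omega))
  · rw [mul_zero]
    exact zero_mem _
  · intro v w _ _ hv hw
    rw [mul_add]
    exact add_mem hv hw
  · intro c v _ hv
    rw [mul_smul_comm]
    exact Submodule.smul_mem _ c hv

omit hu in
theorem mul_mem_span_of {s t : Set R} (z : R)
    (h : ∀ v ∈ s, z * v ∈ Submodule.span ℂ t) {v : R} (hv : v ∈ Submodule.span ℂ s) :
    z * v ∈ Submodule.span ℂ t := by
  have : Submodule.span ℂ s ≤ (Submodule.span ℂ t).comap (LinearMap.mulLeft ℂ z) :=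
    Submodule.span_le.2 h
  exact this hv

/-- At X = 0 the generating series is T² / (1 - aT)², which gives the leading term; every occurrence
of X lowers the exponent of a. -/
theorem IsDoubleRootSeq.sub_mem_span (n : ℕ) : u (n + 2) - (n + 1 : ℂ) • a ^ n ∈
    Submodule.span ℂ {z | ∃ M j, M < n ∧ z = a ^ M * X ^ j} := by
  have hmono {m n : ℕ} (h : m ≤ n) : Submodule.span ℂ {z | ∃ M j, M < m ∧ z = a ^ M * X ^ j} ≤
      Submodule.span ℂ {z | ∃ M j, M < n ∧ z = a ^ M * X ^ j} :=
    Submodule.span_mono fun _ ⟨M, j, h1, h2⟩ => ⟨M, j, h1.trans_le h, h2⟩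
  have hmul (i : ℕ) {n : ℕ} {v : R}
      (hv : v ∈ Submodule.span ℂ {z | ∃ M j, M < n ∧ z = a ^ M * X ^ j}) :
      a ^ i * v ∈ Submodule.span ℂ {z | ∃ M j, M < n + i ∧ z = a ^ M * X ^ j} := by
    refine mul_mem_span_of _ ?_ hv
    rintro _ ⟨M, j, h, rfl⟩
    exact Submodule.subset_span ⟨M + i, j, by omega, by ring⟩
  have hX {n : ℕ} {v : R}
      (hv : v ∈ Submodule.span ℂ {z | ∃ M j, M < n ∧ z = a ^ M * X ^ j}) :
      X * v ∈ Submodule.span ℂ {z | ∃ M j, M < n ∧ z = a ^ M * X ^ j} := by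
    refine mul_mem_span_of _ ?_ hv
    rintro _ ⟨M, j, h, rfl⟩
    exact Submodule.subset_span ⟨M, j + 1, h, by ring⟩
  have key : ∀ n, (u (n + 2) - (n + 1 : ℂ) • a ^ n ∈
      Submodule.span ℂ {z | ∃ M j, M < n ∧ z = a ^ M * X ^ j}) ∧
      (u (n + 3) - (n + 2 : ℂ) • a ^ (n + 1) ∈
      Submodule.span ℂ {z | ∃ M j, M < n + 1 ∧ z = a ^ M * X ^ j}) ∧
      (u (n + 4) - (n + 3 : ℂ) • a ^ (n + 2) ∈
      Submodule.span ℂ {z | ∃ M j, M < n + 2 ∧ z = a ^ M * X ^ j}) := by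
    intro n
    induction n with
    | zero =>
      refine ⟨?_, ?_, ?_⟩
      · simp [hu.two]
      · simp [hu.three, Algebra.smul_def, map_ofNat]
      · simp [hu.four, Algebra.smul_def, map_ofNat]
    | succ n ih =>
      obtain ⟨i1, i2, i3⟩ := ih
      refine ⟨?_, ?_, ?_⟩
      · convert i2 using 2
        push_cast
        congr 1
        ring
      · convert i3 using 2
        push_cast
        congr 1
        ring
      · have : u (n + 1 + 4) - (((n + 1 : ℕ) : ℂ) + 3) • a ^ (n + 1 + 2) =
            (2 : ℂ) • (a ^ 1 * (u (n + 4) - (n + 3 : ℂ) • a ^ (n + 2))) -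
            a ^ 2 * (u (n + 3) - (n + 2 : ℂ) • a ^ (n + 1)) +
            X * (u (n + 2) - (n + 1 : ℂ) • a ^ n) + (n + 1 : ℂ) • (a ^ n * X ^ 1) := by
          have := hu.step (n + 2)
          simp only [add_assoc, Nat.reduceAdd] at this ⊢
          rw [this]
          simp only [Algebra.smul_def]
          push_cast
          simp only [map_ofNat]
          ring
        rw [this]
        refine add_mem (add_mem (sub_mem (Submodule.smul_mem _ _ (hmul 1 i3)) (hmul 2 i2))
          (hmono (by omega) (hX i1))) (Submodule.smul_mem _ _ (Submodule.subset_span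
            ⟨n, 1, by omega, rfl⟩))
  exact (key n).1

/-- For j = 0, the determinant with second index 0 is `u (n + 2)`, whose leading coefficient n + 1
is invertible; the lower terms are known by induction on n for every power of X. Larger j follow by
stability under X. -/
theorem IsDoubleRootSeq.mem_span (n j : ℕ) : a ^ n * X ^ j ∈
    Submodule.span ℂ (Set.range fun p : ℕ × ℕ => twoRow u p.1 p.2) := by
  induction n using Nat.strong_induction_on generalizing j with
  | _ n ih =>
    induction j with
    | zero =>
      have h1 : u (n + 2) ∈ Submodule.span ℂ (Set.range fun p : ℕ × ℕ => twoRow u p.1 p.2) := by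
        refine Submodule.subset_span ⟨(n, 0), ?_⟩
        simp [twoRow, hu.one, hu.two]
      have h2 : Submodule.span ℂ {z | ∃ M j, M < n ∧ z = a ^ M * X ^ j} ≤
          Submodule.span ℂ (Set.range fun p : ℕ × ℕ => twoRow u p.1 p.2) := by
        refine Submodule.span_le.2 ?_
        rintro _ ⟨M, j, h, rfl⟩
        exact ih M h j
      have h3 := sub_mem h1 (h2 (hu.sub_mem_span n))
      rw [sub_sub_cancel] at h3
      have h4 := Submodule.smul_mem _ ((n + 1 : ℂ)⁻¹) h3
      rw [inv_smul_smul₀ (by exact_mod_cast Nat.succ_ne_zero n)] at h4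
      rwa [pow_zero, mul_one]
    | succ j ihj =>
      have := hu.mul_mem_span ihj
      rwa [show X * (a ^ n * X ^ j) = a ^ n * X ^ (j + 1) by ring] at this

end Determinants

/-! ### Polynomials in `x₂, x₆, x₃, x₅` -/

instance : Fintype Var where
  elems := ⟨{Var.x2, Var.x6, Var.x3, Var.x5}, by simp⟩
  complete v := by cases v <;> simp

theorem prod_var {M : Type*} [CommMonoid M] (f : Var → M) :
    ∏ v, f v = f .x2 * f .x6 * f .x3 * f .x5 := by
  change Multiset.prod (Multiset.map f {Var.x2, Var.x6, Var.x3, Var.x5}) = _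
  simp [mul_assoc]

theorem sum_var {M : Type*} [AddCommMonoid M] (f : Var → M) :
    ∑ v, f v = f .x2 + f .x6 + f .x3 + f .x5 := by
  change Multiset.sum (Multiset.map f {Var.x2, Var.x6, Var.x3, Var.x5}) = _
  simp [add_assoc]

/-- The monomials of `PV`. -/
def mon (i j k l : ℕ) : PV := MvPolynomial.X .x2 ^ i * MvPolynomial.X .x6 ^ j *
  MvPolynomial.X .x3 ^ k * MvPolynomial.X .x5 ^ l

theorem monomial_eq_smul_mon (d : Var →₀ ℕ) (c : ℂ) : MvPolynomial.monomial d c =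
    c • mon (d .x2) (d .x6) (d .x3) (d .x5) := by
  rw [MvPolynomial.monomial_eq, Finsupp.prod_fintype _ _ (fun _ => pow_zero _), prod_var,
    MvPolynomial.smul_eq_C_mul, mon]

theorem weight_sdeg (d : Var →₀ ℕ) : Finsupp.weight sdeg d = d .x3 + d .x5 := by
  rw [Finsupp.weight_apply, Finsupp.sum_fintype _ _ (by simp), sum_var]
  simp [sdeg]

theorem sdeg_induction {k : ℕ} {P : PV → Prop} (h0 : P 0)
    (hmon : ∀ i j a b, a + b = k → P (mon i j a b))
    (hadd : ∀ f g, P f → P g → P (f + g)) (hsmul : ∀ (c : ℂ) f, P f → P (c • f))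
    {f : PV} (hf : MvPolynomial.IsWeightedHomogeneous sdeg f k) : P f := by
  rw [f.as_sum]
  refine Finset.sum_induction _ P hadd h0 ?_
  intro d hd
  rw [monomial_eq_smul_mon]
  refine hsmul _ _ (hmon _ _ _ _ ?_)
  rw [← weight_sdeg]
  exact hf (MvPolynomial.mem_support_iff.1 hd)

theorem PV_induction {P : PV → Prop} (h0 : P 0)
    (hmon : ∀ i j a b, P (mon i j a b))
    (hadd : ∀ f g, P f → P g → P (f + g)) (hsmul : ∀ (c : ℂ) f, P f → P (c • f))
    (f : PV) : P f := by
  rw [f.as_sum]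
  refine Finset.sum_induction _ P hadd h0 ?_
  intro d hd
  rw [monomial_eq_smul_mon]
  exact hsmul _ _ (hmon _ _ _ _)

theorem isDoubleRootSeq_invCoeff : IsDoubleRootSeq
    (MvPolynomial.C (1 / 4) * MvPolynomial.X Var.x2) (-d6) invCoeff where
  zero := by rw [invCoeff]
  one := by rw [invCoeff]
  two := by rw [invCoeff]
  step n := by
    have h4 := ofNat_mul_C_inv (σ := Var) 4
    have h2 : 2 * (MvPolynomial.C (1 / 4) * MvPolynomial.X Var.x2) = -d2 := by
      refine mul_left_cancel₀ (two_ne_zero (α := PV)) ?_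
      linear_combination MvPolynomial.X Var.x2 * h4 + two_mul_d2
    have h16 : (MvPolynomial.C (1 / 4) * MvPolynomial.X Var.x2) ^ 2 = d4 := by
      refine mul_left_cancel₀ (OfNat.ofNat_ne_zero 16 : (16 : PV) ≠ 0) ?_
      linear_combination MvPolynomial.X Var.x2 ^ 2 * (4 * MvPolynomial.C (1 / 4) + 1) * h4 - d4_eq
    rw [invCoeff_add_three, h2, h16]; ring

/-- With a = x₂/4, one has x₆ = 6(-d₆) + 4a³, so a and -d₆ generate the same algebra as x₂ and x₆.
-/
theorem mon_mem_span_twoRow (i j : ℕ) : mon i j 0 0 ∈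
    Submodule.span ℂ (Set.range fun p : ℕ × ℕ => twoRow invCoeff p.1 p.2) := by
  have h1 : Submodule.span ℂ {z : PV | ∃ M j, z =
      (MvPolynomial.C (1 / 4) * MvPolynomial.X Var.x2) ^ M * (-d6) ^ j} ≤
      Submodule.span ℂ (Set.range fun p : ℕ × ℕ => twoRow invCoeff p.1 p.2) := by
    refine Submodule.span_le.2 ?_
    rintro _ ⟨M, j, rfl⟩
    exact isDoubleRootSeq_invCoeff.mem_span M j
  refine h1 ?_
  have h4 := ofNat_mul_C_inv (σ := Var) 4
  set a : PV := MvPolynomial.C (1 / 4) * MvPolynomial.X Var.x2 with ha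
  have e2 : MvPolynomial.X Var.x2 = (4 : ℂ) • a := by
    rw [Algebra.smul_def, map_ofNat, ha]
    linear_combination -(MvPolynomial.X Var.x2) * h4
  have e6 : MvPolynomial.X Var.x6 = (6 : ℂ) • (-d6) + (4 : ℂ) • a ^ 3 := by
    refine mul_left_cancel₀ (OfNat.ofNat_ne_zero 16 : (16 : PV) ≠ 0) ?_
    have h := d6_eq
    rw [e2] at h
    simp only [Algebra.smul_def, map_ofNat] at h ⊢
    linear_combination h
  have s2 {z : PV} (hz : z ∈ Submodule.span ℂ {z : PV | ∃ M j, z = a ^ M * (-d6) ^ j}) :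
      MvPolynomial.X Var.x2 * z ∈ Submodule.span ℂ {z : PV | ∃ M j, z = a ^ M * (-d6) ^ j} := by
    refine mul_mem_span_of _ ?_ hz
    rintro _ ⟨M, j, rfl⟩
    rw [e2, smul_mul_assoc]
    exact Submodule.smul_mem _ _ (Submodule.subset_span ⟨M + 1, j, by ring⟩)
  have s6 {z : PV} (hz : z ∈ Submodule.span ℂ {z : PV | ∃ M j, z = a ^ M * (-d6) ^ j}) :
      MvPolynomial.X Var.x6 * z ∈ Submodule.span ℂ {z : PV | ∃ M j, z = a ^ M * (-d6) ^ j} := by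
    refine mul_mem_span_of _ ?_ hz
    rintro _ ⟨M, j, rfl⟩
    rw [e6, add_mul, smul_mul_assoc, smul_mul_assoc]
    exact add_mem (Submodule.smul_mem _ _ (Submodule.subset_span ⟨M, j + 1, by ring⟩))
      (Submodule.smul_mem _ _ (Submodule.subset_span ⟨M + 3, j, by ring⟩))
  have key (j : ℕ) : (MvPolynomial.X Var.x6 ^ j : PV) ∈
      Submodule.span ℂ {z : PV | ∃ M j, z = a ^ M * (-d6) ^ j} := by
    induction j with
    | zero => exact Submodule.subset_span ⟨0, 0, by simp⟩
    | succ j ih =>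
      rw [pow_succ']
      exact s6 ih
  rw [mon, pow_zero, pow_zero, mul_one, mul_one]
  induction i with
  | zero => simpa using key j
  | succ i ih =>
    rw [pow_succ', mul_assoc]
    exact s2 ih

/-! ### `σ̃₃, σ̃₅` is a regular sequence -/

theorem Polynomial_dvd_of_dvd_C_mul {R : Type*} [CommRing R] [IsDomain R] {f g : Polynomial R}
    (hf : f.Monic) {r : R} (hr : r ≠ 0) (h : f ∣ Polynomial.C r * g) : f ∣ g := by
  rw [← Polynomial.modByMonic_eq_zero_iff_dvd hf] at h ⊢
  rw [← Polynomial.smul_eq_C_mul, Polynomial.smul_modByMonic] at h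
  exact (smul_eq_zero.1 h).resolve_left hr

section Chart

variable {S : Type*} [CommRing S] [Algebra ℂ S]

/-- Coordinates in which the nine linear forms are the sums `u i + v j` for
`u = (m + n, m - n, -2m)` and `v = (m' + n', m' - n', -2m')`. -/
def chart (m n m' n' : S) : P4 →ₐ[ℂ] S :=
  evalAt (m + n + m' + n') (m - n - 2 * m') (-(2 * m) - 2 * m') (m + n + m' - n')

theorem chart_sigTilde_three (m n m' n' : S) : chart m n m' n' (sigTilde 3) =
    -(18 * (m ^ 3 - m * n ^ 2 + m' ^ 3 - m' * n' ^ 2)) := by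
  rw [chart, evalAt_sigTilde]; ring

theorem chart_sigTilde_five (m n m' n' : S) : chart m n m' n' (sigTilde 5) =
    90 * ((m ^ 3 - m * n ^ 2) * (3 * m ^ 2 + n ^ 2 - 3 * m' ^ 2 - n' ^ 2)) -
    30 * ((m ^ 3 - m * n ^ 2 + m' ^ 3 - m' * n' ^ 2) *
      (4 * (3 * m ^ 2 + n ^ 2) + (3 * m' ^ 2 + n' ^ 2))) := by
  rw [chart, evalAt_sigTilde]; ring

end Chart

def cm : P4 := MvPolynomial.C (1 / 6) * (vA + 2 * vB - vA' + vB')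
def cn : P4 := MvPolynomial.C (1 / 6) * (3 * vA + 3 * vA' + 3 * vB')
def cm' : P4 := MvPolynomial.C (1 / 6) * (-vA - 2 * vB - 2 * vA' - vB')
def cn' : P4 := MvPolynomial.C (1 / 6) * (3 * vA - 3 * vB')

theorem chart_self (f : P4) : chart cm cn cm' cn' f = f := by
  have h := ofNat_mul_C_inv (σ := Fin 4) 6
  have : chart cm cn cm' cn' = AlgHom.id ℂ P4 := by
    refine P4_algHom_ext ?_ ?_ ?_ ?_ <;>
      simp only [chart, evalAt_vA, evalAt_vB, evalAt_vA', evalAt_vB', AlgHom.id_apply, cm, cn,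
        cm', cn']
    · linear_combination vA * h
    · linear_combination vB * h
    · linear_combination vA' * h
    · linear_combination vB' * h
  exact DFunLike.congr_fun this f

section ChartCoord

variable {S : Type*} [CommRing S] [Algebra ℂ S] (m n m' n' : S)

theorem C_mul_six (z : S) (g : P4) (h : chart m n m' n' g = 6 * z) :
    chart m n m' n' (MvPolynomial.C (1 / 6) * g) = z := by
  have h6 := congrArg (chart m n m' n') (ofNat_mul_C_inv (σ := Fin 4) 6)
  rw [map_mul, map_one, map_ofNat] at h6
  rw [map_mul, h]
  linear_combination z * h6

theorem chart_cm : chart m n m' n' cm = m := by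
  refine C_mul_six _ _ _ _ _ _ ?_
  simp only [chart, map_add, map_sub, map_mul, map_ofNat, evalAt_vA, evalAt_vB, evalAt_vA',
    evalAt_vB']
  ring

theorem chart_cn : chart m n m' n' cn = n := by
  refine C_mul_six _ _ _ _ _ _ ?_
  simp only [chart, map_add, map_mul, map_ofNat, evalAt_vA, evalAt_vA', evalAt_vB']
  ring

theorem chart_cm' : chart m n m' n' cm' = m' := by
  refine C_mul_six _ _ _ _ _ _ ?_
  simp only [chart, map_neg, map_sub, map_mul, map_ofNat, evalAt_vA, evalAt_vB, evalAt_vA',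
    evalAt_vB']
  ring

theorem chart_cn' : chart m n m' n' cn' = n' := by
  refine C_mul_six _ _ _ _ _ _ ?_
  simp only [chart, map_sub, map_mul, map_ofNat, evalAt_vA, evalAt_vB']
  ring

end ChartCoord

theorem map_chart {S T : Type*} [CommRing S] [Algebra ℂ S] [CommRing T] [Algebra ℂ T]
    (φ : S →ₐ[ℂ] T) (m n m' n' : S) (f : P4) :
    φ (chart m n m' n' f) = chart (φ m) (φ n) (φ m') (φ n') f := by
  simp only [chart, evalAt_comp, map_add, map_sub, map_neg, map_mul, map_ofNat]

abbrev P3X : Type := Polynomial (MvPolynomial (Fin 3) ℂ)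

/-- The cubic form proportional to `σ̃₃`. -/
def cubic : P4 := cm ^ 3 - cm * cn ^ 2 + cm' ^ 3 - cm' * cn' ^ 2

/-- A quadratic form such that `σ̃₅` is congruent to a multiple of its product by
`cm ^ 3 - cm * cn ^ 2` modulo `σ̃₃`. -/
def quadric : P4 := 3 * cm ^ 2 + cn ^ 2 - 3 * cm' ^ 2 - cn' ^ 2

theorem sigTilde_three_eq_cubic : sigTilde 3 = -(18 * cubic) := by
  rw [cubic, ← chart_sigTilde_three, chart_self]

theorem sigTilde_five_eq_cubic : sigTilde 5 = 90 * ((cm ^ 3 - cm * cn ^ 2) * quadric) -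
    30 * (cubic * (4 * (3 * cm ^ 2 + cn ^ 2) + (3 * cm' ^ 2 + cn' ^ 2))) := by
  rw [cubic, quadric, ← chart_sigTilde_five, chart_self]

/-- In these coordinates `cubic` is monic in `cm'`, while the other factor does not involve `cm'`; a
nonzero constant can be cancelled modulo a monic polynomial. -/
theorem cubic_dvd_of_dvd_mul₁ {f : P4} (h : cubic ∣ (cm ^ 3 - cm * cn ^ 2) * f) : cubic ∣ f := by
  let z (i : Fin 3) : P3X := Polynomial.C (MvPolynomial.X i)
  let φ : P4 →ₐ[ℂ] P3X := chart (z 0) (z 1) Polynomial.X (z 2)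
  let ψ : P3X →ₐ[ℂ] P4 := Polynomial.aevalTower (MvPolynomial.aeval ![cm, cn, cn']) cm'
  have hψ (f : P4) : ψ (φ f) = f := by
    rw [map_chart]
    simp [z, ψ, chart_self]
  have h1 := map_dvd φ h
  have e1 : φ cubic = Polynomial.X ^ 3 + (Polynomial.C (-(MvPolynomial.X 2) ^ 2) * Polynomial.X +
      Polynomial.C (MvPolynomial.X 0 ^ 3 - MvPolynomial.X 0 * MvPolynomial.X 1 ^ 2)) := by
    simp only [φ, cubic, map_add, map_sub, map_mul, map_pow, map_neg, chart_cm, chart_cn,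
      chart_cm', chart_cn', z]
    ring
  have e2 : φ (cm ^ 3 - cm * cn ^ 2) =
      Polynomial.C (MvPolynomial.X 0 ^ 3 - MvPolynomial.X 0 * MvPolynomial.X 1 ^ 2) := by
    simp only [φ, map_sub, map_mul, map_pow, chart_cm, chart_cn, z]
  rw [map_mul, e2] at h1
  have hm : (φ cubic).Monic := by
    rw [e1]
    exact Polynomial.monic_X_pow_add (Polynomial.degree_linear_le.trans_lt (by norm_num))
  have h2 := map_dvd ψ (Polynomial_dvd_of_dvd_C_mul hm (by
    intro h
    have := congrArg (MvPolynomial.eval ![(1 : ℂ), 0, 0]) h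
    simp at this) h1)
  rwa [hψ, hψ] at h2

/-- Here the main variable is `cn'`: `-quadric` is monic in it, and `cm' * quadric - cubic` does not
involve it, so modulo `quadric` the cubic is a nonzero constant. -/
theorem quadric_dvd_of_dvd_mul {f : P4} (h : quadric ∣ cubic * f) : quadric ∣ f := by
  let z (i : Fin 3) : P3X := Polynomial.C (MvPolynomial.X i)
  let φ : P4 →ₐ[ℂ] P3X := chart (z 0) (z 1) (z 2) Polynomial.X
  let ψ : P3X →ₐ[ℂ] P4 := Polynomial.aevalTower (MvPolynomial.aeval ![cm, cn, cm']) cn'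
  have hψ (f : P4) : ψ (φ f) = f := by
    rw [map_chart]
    simp [z, ψ, chart_self]
  have h' : -quadric ∣ (cm' * quadric - cubic) * f := by
    rw [neg_dvd, sub_mul]
    exact dvd_sub ((dvd_mul_left _ _).mul_right _) h
  have h1 := map_dvd φ h'
  have e1 : φ (-quadric) = Polynomial.X ^ 2 + Polynomial.C (-(3 * MvPolynomial.X 0 ^ 2 +
      MvPolynomial.X 1 ^ 2 - 3 * MvPolynomial.X 2 ^ 2)) := by
    simp only [φ, quadric, map_add, map_sub, map_mul, map_pow, map_neg, chart_cm, chart_cn,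
      chart_cm', chart_cn', z, map_ofNat]
    ring
  have e2 : φ (cm' * quadric - cubic) =
      Polynomial.C (-(4 * MvPolynomial.X 2 ^ 3) + 3 * MvPolynomial.X 0 ^ 2 * MvPolynomial.X 2 +
        MvPolynomial.X 1 ^ 2 * MvPolynomial.X 2 - MvPolynomial.X 0 ^ 3 +
        MvPolynomial.X 0 * MvPolynomial.X 1 ^ 2) := by
    simp only [φ, quadric, cubic, map_add, map_sub, map_mul, map_pow, map_neg, chart_cm, chart_cn,
      chart_cm', chart_cn', z, map_ofNat]
    ring
  rw [map_mul, e2] at h1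
  have hm : (φ (-quadric)).Monic := by
    rw [e1]
    exact Polynomial.monic_X_pow_add_C _ two_ne_zero
  have h2 := map_dvd ψ (Polynomial_dvd_of_dvd_C_mul hm (by
    intro h
    have := congrArg (MvPolynomial.eval ![(0 : ℂ), 0, 1]) h
    simp at this) h1)
  rwa [hψ, hψ, neg_dvd] at h2

theorem quadric_ne_zero : quadric ≠ 0 := by
  intro h
  have := congrArg (chart (1 : ℂ) 0 0 0) h
  simp only [quadric, map_add, map_sub, map_mul, map_pow, chart_cm, chart_cn,
      chart_cm', chart_cn', map_ofNat, map_zero] at this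
  norm_num at this

theorem cubic_dvd_of_dvd_mul₂ {f : P4} (h : cubic ∣ quadric * f) : cubic ∣ f := by
  obtain ⟨g, hg⟩ := h
  obtain ⟨k, rfl⟩ := quadric_dvd_of_dvd_mul ⟨f, hg.symm⟩
  refine ⟨k, mul_left_cancel₀ quadric_ne_zero ?_⟩
  rw [hg]; ring

theorem isUnit_natCast (n : ℕ) [NeZero n] : IsUnit (n : P4) := by
  rw [← map_natCast (MvPolynomial.C : ℂ →+* P4)]
  exact (isUnit_iff_ne_zero.2 (NeZero.ne (n : ℂ))).map _

/-- Modulo σ̃₃, which is a unit times `cubic`, σ̃₅ is a unit times the product of two factors, each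
cancellable modulo `cubic`. -/
theorem dvd_of_sigTilde_five {f : P4} (h : sigTilde 3 ∣ sigTilde 5 * f) : sigTilde 3 ∣ f := by
  have h18 : (18 : P4) = ((18 : ℕ) : P4) := by norm_num
  have h90 : (90 : P4) = ((90 : ℕ) : P4) := by norm_num
  rw [sigTilde_three_eq_cubic, neg_dvd, h18, (isUnit_natCast 18).mul_left_dvd] at h ⊢
  rw [sigTilde_five_eq_cubic, sub_mul] at h
  have h1 := (dvd_sub_left (((dvd_mul_right _ _).mul_left _).mul_right _)).1 h
  rw [mul_assoc, h90, (isUnit_natCast 90).dvd_mul_left, mul_assoc] at h1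
  exact cubic_dvd_of_dvd_mul₂ (cubic_dvd_of_dvd_mul₁ h1)

theorem dvd_of_sigTilde_five_pow (k : ℕ) {f : P4} (h : sigTilde 3 ∣ sigTilde 5 ^ k * f) :
    sigTilde 3 ∣ f := by
  induction k with
  | zero => simpa using h
  | succ k ih => exact ih (dvd_of_sigTilde_five (by rwa [← mul_assoc, ← pow_succ']))

theorem sigTilde_three_ne_zero : sigTilde 3 ≠ 0 := by
  intro h
  have := congrArg (evalAt (1 : ℂ) 0 0 1) h
  rw [evalAt_sigTilde, map_zero] at this
  norm_num at this

/-! ### Injectivity -/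

theorem exists_quadratic_sextic (s t : ℂ) : ∃ b c : ℂ,
    4 * (b ^ 2 + b * c + c ^ 2) = s ∧ 2 * (b ^ 6 + c ^ 6 + (b + c) ^ 6) = t := by
  -- With p = b² + bc + c² and q = bc(b + c), one has b⁶ + c⁶ + (b + c)⁶ = 2p³ + 3q². So p = s/4 is
  -- forced, `f` is a choice of q, and b, c are found as roots.
  obtain ⟨f, hf⟩ := IsAlgClosed.exists_pow_nat_eq ((t / 2 - 2 * (s / 4) ^ 3) / 3)
    (n := 2) (by norm_num)
  obtain ⟨b, hb⟩ := IsAlgClosed.exists_root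
    (Polynomial.X ^ 3 + (Polynomial.C (-(s / 4)) * Polynomial.X + Polynomial.C f)) (by
      rw [Polynomial.degree_add_eq_left_of_degree_lt]
      · simp
      · rw [Polynomial.degree_X_pow]
        exact Polynomial.degree_linear_le.trans_lt (by norm_num))
  obtain ⟨c, hc⟩ := IsAlgClosed.exists_root
    (Polynomial.X ^ 2 + (Polynomial.C b * Polynomial.X + Polynomial.C (b ^ 2 - s / 4))) (by
      rw [Polynomial.degree_add_eq_left_of_degree_lt]
      · simp
      · rw [Polynomial.degree_X_pow]
        exact Polynomial.degree_linear_le.trans_lt (by norm_num))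
  simp only [Polynomial.IsRoot, Polynomial.eval_add, Polynomial.eval_mul, Polynomial.eval_pow,
    Polynomial.eval_X, Polynomial.eval_C] at hb hc
  have e : s / 4 = b ^ 2 + b * c + c ^ 2 := by linear_combination -hc
  have hs : s = 4 * (b ^ 2 + b * c + c ^ 2) := by linear_combination 4 * e
  have hf2 : f = b * c * (b + c) := by linear_combination hb + b * e
  refine ⟨b, c, hs.symm, ?_⟩
  rw [hf2, e] at hf
  linear_combination 6 * hf

theorem eval_eq_of_sdeg_zero {p : PV} (hp : MvPolynomial.IsWeightedHomogeneous sdeg p 0)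
    {v w : Var → ℂ} (h2 : v .x2 = w .x2) (h6 : v .x6 = w .x6) :
    MvPolynomial.eval v p = MvPolynomial.eval w p := by
  refine sdeg_induction (P := fun p => MvPolynomial.eval v p = MvPolynomial.eval w p)
    ?_ ?_ ?_ ?_ hp
  · simp
  · intro i j a b h
    obtain ⟨rfl, rfl⟩ : a = 0 ∧ b = 0 := by omega
    simp [mon, h2, h6]
  · intro f g hf hg
    rw [map_add, map_add, hf, hg]
  · intro c f hf
    rw [MvPolynomial.smul_eval, MvPolynomial.smul_eval, hf]

/-- Only x₂ and x₆ occur in Σ-degree 0, and by `exists_quadratic_sextic` the pair (σ̃₂, σ̃₆) takes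
all values in ℂ² on the plane A = A' = 0. -/
theorem eq_zero_of_evalAt_ev {p : PV} (hp : MvPolynomial.IsWeightedHomogeneous sdeg p 0)
    (h : evalAt 0 vB 0 vB' (ev p) = 0) : p = 0 := by
  refine MvPolynomial.funext fun v => ?_
  obtain ⟨b, c, h2, h6⟩ := exists_quadratic_sextic (v .x2) (v .x6)
  have h1 := congrArg (evalAt 0 b 0 c) h
  rw [evalAt_comp, map_zero] at h1
  simp only [evalAt_vB, evalAt_vB'] at h1
  let w : Var → ℂ := fun
    | .x2 => v .x2
    | .x6 => v .x6
    | .x3 => 0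
    | .x5 => 0
  have h3 : (evalAt 0 b 0 c).comp ev = MvPolynomial.aeval w := by
    refine MvPolynomial.algHom_ext fun i => ?_
    rw [AlgHom.comp_apply, MvPolynomial.aeval_X]
    cases i
    · rw [ev_x2, evalAt_sigTilde]
      change _ = v .x2
      rw [← h2]; ring
    · rw [ev_x6, evalAt_sigTilde]
      change _ = v .x6
      rw [← h6]; ring
    · rw [ev_x3, evalAt_sigTilde]
      change _ = (0 : ℂ)
      ring
    · rw [ev_x5, evalAt_sigTilde]
      change _ = (0 : ℂ)
      ring
  have h4 := DFunLike.congr_fun h3 p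
  rw [AlgHom.comp_apply, h1, MvPolynomial.aeval_eq_eval] at h4
  rw [eval_eq_of_sdeg_zero hp (v := v) (w := w) rfl rfl, map_zero]
  exact h4.symm

theorem evalAt_sigTilde_three_ne_zero₀ : evalAt 0 vB vA' vB' (sigTilde 3) ≠ 0 := by
  intro h
  have := congrArg (evalAt (0 : ℂ) 1 1 1) h
  rw [evalAt_comp, map_zero] at this
  simp only [evalAt_vB, evalAt_vA', evalAt_vB'] at this
  rw [evalAt_sigTilde] at this
  norm_num at this

theorem evalAt_sigTilde_three_ne_zero₁ : evalAt vA vB 0 vB' (sigTilde 3) ≠ 0 := by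
  intro h
  have := congrArg (evalAt (1 : ℂ) 1 0 1) h
  rw [evalAt_comp, map_zero] at this
  simp only [evalAt_vA, evalAt_vB, evalAt_vB'] at this
  rw [evalAt_sigTilde] at this
  norm_num at this

/-- Regularity of σ̃₃, σ̃₅ makes `ev p * lam 3` equal to σ̃₃ c modulo `varProd`. Comparing the
boundary values of λ₃, `ev p` equals c on A = 0 and -c on A' = 0, hence vanishes on A = A' = 0. -/
theorem eq_zero_of_ev_mul_tau_mem {p : PV} (hp : MvPolynomial.IsWeightedHomogeneous sdeg p 0)
    (h : ev p * tau35 ∈ powIdeal 1) : p = 0 := by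
  obtain ⟨g, hg, h⟩ := mem_powIdeal.1 h
  rw [pow_one] at hg
  obtain ⟨a, b, rfl⟩ := Ideal.mem_span_pair.1 hg
  have h1 : sigTilde 3 * (ev p * lam 5 - varProd * a) =
      sigTilde 5 * (ev p * lam 3 + varProd * b) := by
    rw [tau35] at h
    linear_combination h
  obtain ⟨c, hc⟩ := dvd_of_sigTilde_five ⟨_, h1.symm⟩
  have o3 : Odd 3 := ⟨1, rfl⟩
  have eA : evalAt 0 vB vA' vB' (ev p) = evalAt 0 vB vA' vB' c := by
    have e := congrArg (evalAt 0 vB vA' vB') hc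
    obtain ⟨d, hd⟩ := vA_dvd_lam_sub o3
    have e' := congrArg (evalAt 0 vB vA' vB') hd
    simp only [map_add, map_mul, map_sub, varProd, evalAt_vA] at e e'
    refine mul_left_cancel₀ evalAt_sigTilde_three_ne_zero₀ ?_
    linear_combination e - evalAt 0 vB vA' vB' (ev p) * e'
  have eA' : evalAt vA vB 0 vB' (ev p) = -evalAt vA vB 0 vB' c := by
    have e := congrArg (evalAt vA vB 0 vB') hc
    obtain ⟨d, hd⟩ := vA'_dvd_lam_add o3
    have e' := congrArg (evalAt vA vB 0 vB') hd
    simp only [map_add, map_mul, varProd, evalAt_vA'] at e e'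
    refine mul_left_cancel₀ evalAt_sigTilde_three_ne_zero₁ ?_
    linear_combination -e + evalAt vA vB 0 vB' (ev p) * e'
  have f1 := congrArg (evalAt vA vB 0 vB') eA
  have f2 := congrArg (evalAt 0 vB vA' vB') eA'
  rw [evalAt_comp, evalAt_comp] at f1
  rw [map_neg, evalAt_comp, evalAt_comp] at f2
  simp only [evalAt_vA, evalAt_vB, evalAt_vA', evalAt_vB', map_zero] at f1 f2
  refine eq_zero_of_evalAt_ev hp ?_
  refine mul_left_cancel₀ (two_ne_zero (α := P4)) ?_
  linear_combination f1 + f2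

theorem isWeightedHomogeneous_mon (i j a b : ℕ) :
    MvPolynomial.IsWeightedHomogeneous sdeg (mon i j a b) (a + b) := by
  have h (v : Var) := MvPolynomial.isWeightedHomogeneous_X ℂ sdeg v
  have := (((h .x2).pow i).mul ((h .x6).pow j)).mul ((h .x3).pow a) |>.mul ((h .x5).pow b)
  simpa [sdeg, mon] using this

theorem exists_decomposition {k : ℕ} {p : PV}
    (hp : MvPolynomial.IsWeightedHomogeneous sdeg p (k + 1)) :
    ∃ q r : PV, MvPolynomial.IsWeightedHomogeneous sdeg q k ∧
      MvPolynomial.IsWeightedHomogeneous sdeg r 0 ∧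
      p = MvPolynomial.X .x3 * q + MvPolynomial.X .x5 ^ (k + 1) * r := by
  refine sdeg_induction (P := fun p => ∃ q r : PV, MvPolynomial.IsWeightedHomogeneous sdeg q k ∧
      MvPolynomial.IsWeightedHomogeneous sdeg r 0 ∧
      p = MvPolynomial.X .x3 * q + MvPolynomial.X .x5 ^ (k + 1) * r) ?_ ?_ ?_ ?_ hp
  · exact ⟨0, 0, MvPolynomial.isWeightedHomogeneous_zero _ _ _,
      MvPolynomial.isWeightedHomogeneous_zero _ _ _, by simp⟩
  · intro i j a b hab
    cases a with
    | zero =>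
      refine ⟨0, mon i j 0 0, MvPolynomial.isWeightedHomogeneous_zero _ _ _,
        isWeightedHomogeneous_mon _ _ _ _, ?_⟩
      obtain rfl : b = k + 1 := by omega
      simp only [mon]
      ring
    | succ a =>
      refine ⟨mon i j a b, 0, ?_, MvPolynomial.isWeightedHomogeneous_zero _ _ _, ?_⟩
      · obtain rfl : k = a + b := by omega
        exact isWeightedHomogeneous_mon _ _ _ _
      · simp only [mon]
        ring
  · rintro f g ⟨q, r, hq, hr, rfl⟩ ⟨q', r', hq', hr', rfl⟩
    exact ⟨q + q', r + r', hq.add hq', hr.add hr', by ring⟩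
  · rintro c f ⟨q, r, hq, hr, rfl⟩
    refine ⟨c • q, c • r, ?_, ?_, ?_⟩
    · exact (MvPolynomial.weightedHomogeneousSubmodule ℂ sdeg k).smul_mem c hq
    · exact (MvPolynomial.weightedHomogeneousSubmodule ℂ sdeg 0).smul_mem c hr
    · rw [smul_add, mul_smul_comm, mul_smul_comm]

theorem mem_sigIdeal_pow_succ {k : ℕ} {f : P4} (hf : f ∈ sigIdeal ^ (k + 1)) :
    ∃ g ∈ sigIdeal ^ k, ∃ h ∈ sigIdeal ^ k, f = sigTilde 3 * g + sigTilde 5 * h := by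
  rw [pow_succ'] at hf
  refine Submodule.mul_induction_on hf ?_ ?_
  · intro a ha b hb
    obtain ⟨c, d, rfl⟩ := Ideal.mem_span_pair.1 ha
    exact ⟨c * b, Ideal.mul_mem_left _ _ hb, d * b, Ideal.mul_mem_left _ _ hb, by ring⟩
  · rintro _ _ ⟨g, hg, h, hh, rfl⟩ ⟨g', hg', h', hh', rfl⟩
    exact ⟨g + g', add_mem hg hg', h + h', add_mem hh hh', by ring⟩

/-- Every generating product other than the pure power of σ̃₅ contains a factor σ̃₃. -/
theorem mem_sigIdeal_pow_succ' {k : ℕ} {f : P4} (hf : f ∈ sigIdeal ^ (k + 1)) :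
    ∃ g ∈ sigIdeal ^ k, ∃ c, f = sigTilde 3 * g + sigTilde 5 ^ (k + 1) * c := by
  induction k generalizing f with
  | zero =>
    obtain ⟨g, hg, h, -, rfl⟩ := mem_sigIdeal_pow_succ hf
    exact ⟨g, hg, h, by rw [zero_add, pow_one]⟩
  | succ k ih =>
    obtain ⟨g, hg, h, hh, rfl⟩ := mem_sigIdeal_pow_succ hf
    obtain ⟨g', hg', c, rfl⟩ := ih hh
    refine ⟨g + sigTilde 5 * g', add_mem hg ?_, c, by ring⟩
    rw [pow_succ']
    exact Ideal.mul_mem_mul sigTilde_five_mem hg'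

theorem ev_mem {k : ℕ} {p : PV} (hp : MvPolynomial.IsWeightedHomogeneous sdeg p k) :
    ev p ∈ sigIdeal ^ k := by
  refine sdeg_induction (P := fun p => ev p ∈ sigIdeal ^ k) ?_ ?_ ?_ ?_ hp
  · rw [map_zero]
    exact zero_mem _
  · rintro i j a b rfl
    simp only [mon, map_mul, map_pow, ev_x3, ev_x5, mul_assoc]
    refine Ideal.mul_mem_left _ _ (Ideal.mul_mem_left _ _ ?_)
    rw [pow_add]
    exact Ideal.mul_mem_mul (Ideal.pow_mem_pow sigTilde_three_mem a)
      (Ideal.pow_mem_pow sigTilde_five_mem b)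
  · intro f g hf hg
    rw [map_add]
    exact add_mem hf hg
  · intro c f hf
    rw [map_smul, MvPolynomial.smul_eq_C_mul]
    exact Ideal.mul_mem_left _ _ hf

/-- Write p = x₃ q + x₅^(k+1) r and θ = τ₃₅ / `varProd`. Reducing modulo σ̃₃ and cancelling powers
of σ̃₅ puts `ev r * θ` in `sigIdeal`, so r = 0 by the degree-zero case; then σ̃₃ can be cancelled
from what is left, and induction gives q = 0. -/
theorem eq_zero_of_ev_mul_tau_mem_succ {k : ℕ} {p : PV}
    (hp : MvPolynomial.IsWeightedHomogeneous sdeg p k)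
    (h : ev p * tau35 ∈ powIdeal (k + 1)) : p = 0 := by
  obtain ⟨θ, hθ⟩ : varProd ∣ tau35 := varProd_dvd_tau ⟨1, rfl⟩ ⟨2, rfl⟩
  induction k generalizing p with
  | zero => exact eq_zero_of_ev_mul_tau_mem hp h
  | succ k ih =>
    obtain ⟨q, r, hq, hr, rfl⟩ := exists_decomposition hp
    obtain ⟨f, hf, h⟩ := mem_powIdeal.1 h
    obtain ⟨g, hg, c, rfl⟩ := mem_sigIdeal_pow_succ' hf
    rw [hθ, mul_left_comm] at h
    have h1 := mul_left_cancel₀ varProd_ne_zero h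
    rw [map_add, map_mul, map_mul, map_pow, ev_x3, ev_x5] at h1
    obtain ⟨e, he⟩ : sigTilde 3 ∣ ev r * θ - sigTilde 5 * c := by
      refine dvd_of_sigTilde_five_pow (k + 1) ⟨g - ev q * θ, ?_⟩
      linear_combination h1
    have hr0 : r = 0 := by
      refine eq_zero_of_ev_mul_tau_mem hr ?_
      rw [hθ, mul_left_comm]
      refine varProd_mul_mem_powIdeal ?_
      rw [sub_eq_iff_eq_add.1 he]
      exact add_mem (Ideal.mul_mem_right _ _ sigTilde_three_mem)
        (Ideal.mul_mem_right _ _ sigTilde_five_mem)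
    subst hr0
    rw [map_zero] at h1
    obtain ⟨c', rfl⟩ : sigTilde 3 ∣ c := by
      refine dvd_of_sigTilde_five_pow (k + 1 + 1) ⟨ev q * θ - g, ?_⟩
      linear_combination -h1
    have hq0 : q = 0 := by
      refine ih hq ?_
      rw [hθ, mul_left_comm]
      refine mem_powIdeal.2 ⟨_, ?_, rfl⟩
      have : ev q * θ = g + sigTilde 5 * (sigTilde 5 ^ (k + 1) * c') := by
        refine mul_left_cancel₀ sigTilde_three_ne_zero ?_
        linear_combination h1
      rw [this]
      exact add_mem hg (Ideal.mul_mem_left _ _ (Ideal.mul_mem_right _ _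
        (Ideal.pow_mem_pow sigTilde_five_mem (k + 1))))
    rw [hq0]
    ring

/-! ### The filtration and its graded pieces as spaces of polynomials -/

theorem sigTilde_odd_mem_sigIdeal {k : ℕ} (hk : Odd k) (h3 : 3 ≤ k) : sigTilde k ∈ sigIdeal := by
  obtain ⟨n, rfl⟩ : ∃ n, k = 2 * n + 3 := by
    obtain ⟨m, rfl⟩ := hk
    exact ⟨m - 1, by omega⟩
  have := add_mem (Ideal.mul_le_left (sigTilde_odd_sub_mem n)) (oddMain_mem n)
  rwa [sub_add_cancel] at this

theorem swap_mem_sigIdeal_pow {k : ℕ} {f : P4} (hf : f ∈ sigIdeal ^ k) : swap f ∈ sigIdeal ^ k := by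
  have h1 : sigIdeal ≤ sigIdeal.comap swap := by
    refine Ideal.span_le.2 ?_
    rintro _ (rfl | rfl)
    · change swap (sigTilde 3) ∈ sigIdeal
      rw [swap_sigTilde]
      exact sigTilde_three_mem
    · change swap (sigTilde 5) ∈ sigIdeal
      rw [swap_sigTilde]
      exact sigTilde_five_mem
  exact Ideal.le_comap_pow swap k (Ideal.pow_right_mono h1 k hf)

theorem sig_mem {k : ℕ} (hk : Odd k) (h3 : 3 ≤ k) : sig k ∈ Sig :=
  Submodule.subset_span ⟨k, hk, h3, rfl⟩

theorem mem_sigIdeal_pow_one {f : P4} (hf : f ∈ sigIdeal) : f ∈ sigIdeal ^ 1 := by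
  rwa [pow_one]

theorem iota_mem_powIdeal {k : ℕ} {z : grL 1} (hz : z ∈ F k) : iota z ∈ powIdeal k := by
  induction k generalizing z with
  | zero =>
    obtain ⟨f, hf⟩ := varProd_dvd_iota z
    exact mem_powIdeal.2 ⟨f, by simp, hf⟩
  | succ k ih =>
    have : Submodule.map₂ act Sig (F k) ≤
        ((powIdeal (k + 1)).restrictScalars ℂ).comap iota := by
      refine Submodule.map₂_le.2 fun s hs m hm => ?_
      refine Submodule.span_induction ?_ ?_ ?_ ?_ hs
      · rintro _ ⟨j, hj, h3, rfl⟩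
        change iota (act (sig j) m) ∈ powIdeal (k + 1)
        rw [iota_act_sig hj h3]
        exact mul_mem_powIdeal (mem_sigIdeal_pow_one (sigTilde_odd_mem_sigIdeal hj h3)) (ih hm)
      · rw [map_zero, LinearMap.zero_apply]
        exact zero_mem _
      · intro s t _ _ hs ht
        rw [map_add, LinearMap.add_apply]
        exact add_mem hs ht
      · intro c s _ hs
        rw [map_smul, LinearMap.smul_apply]
        exact Submodule.smul_mem _ c hs
    exact this hz

/-- Expand along σ̃₃ and σ̃₅. The cofactors need not be antisymmetric, but since σ̃₃ and σ̃₅ are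
symmetric they can be antisymmetrized, which makes them images under `iota`; the factor 1/2 comes
from this. -/
theorem mem_F_of_iota_mem {k : ℕ} {z : grL 1} (hz : iota z ∈ powIdeal k) : z ∈ F k := by
  induction k generalizing z with
  | zero => exact Submodule.mem_top
  | succ k ih =>
    obtain ⟨f, hf, h⟩ := mem_powIdeal.1 hz
    obtain ⟨g, hg, g', hg', rfl⟩ := mem_sigIdeal_pow_succ hf
    have hs := swap_iota z
    rw [h, map_mul, swap_varProd, ← mul_neg, map_add, map_mul, map_mul, swap_sigTilde,
      swap_sigTilde] at hs
    have hs' := mul_left_cancel₀ varProd_ne_zero hs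
    have anti (g : P4) : swap (g - swap g) = -(g - swap g) := by
      rw [map_sub, swap_swap, neg_sub]
    have lift {g : P4} (hg : g ∈ sigIdeal ^ k) : ∃ w ∈ F k, iota w = varProd * (g - swap g) := by
      obtain ⟨w, hw⟩ := iota_exists (anti g)
      refine ⟨w, ih ?_, hw⟩
      rw [hw]
      exact mem_powIdeal.2 ⟨_, sub_mem hg (swap_mem_sigIdeal_pow hg), rfl⟩
    obtain ⟨w, hw, e⟩ := lift hg
    obtain ⟨w', hw', e'⟩ := lift hg'
    have key : z = (1 / 2 : ℂ) • (act (sig 3) w + act (sig 5) w') := by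
      refine iota_injective ?_
      have h2 : (2 : ℂ) • iota z = iota (act (sig 3) w + act (sig 5) w') := by
        rw [map_add, iota_act_sig (k := 3) ⟨1, rfl⟩ le_rfl,
          iota_act_sig (k := 5) ⟨2, rfl⟩ (by norm_num), e, e', h,
          Algebra.smul_def, map_ofNat]
        linear_combination varProd * hs'
      rw [map_smul, ← h2, smul_smul]
      norm_num
    rw [key]
    exact Submodule.smul_mem _ _ (add_mem
      (Submodule.apply_mem_map₂ _ (sig_mem (k := 3) ⟨1, rfl⟩ le_rfl) hw)
      (Submodule.apply_mem_map₂ _ (sig_mem (k := 5) ⟨2, rfl⟩ (by norm_num)) hw'))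

theorem mem_F_iff {k : ℕ} {z : grL 1} : z ∈ F k ↔ iota z ∈ powIdeal k :=
  ⟨iota_mem_powIdeal, mem_F_of_iota_mem⟩

/-- The antisymmetric elements of `powIdeal k`. -/
def antiPow (k : ℕ) : Submodule ℂ P4 where
  carrier := {f | swap f = -f ∧ f ∈ powIdeal k}
  add_mem' := by
    rintro f g ⟨hf, hf'⟩ ⟨hg, hg'⟩
    exact ⟨by rw [map_add, hf, hg, neg_add], add_mem hf' hg'⟩
  zero_mem' := ⟨by simp, zero_mem _⟩
  smul_mem' := by
    rintro c f ⟨hf, hf'⟩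
    refine ⟨by rw [map_smul, hf, smul_neg], ?_⟩
    exact ((powIdeal k).restrictScalars ℂ).smul_mem c hf'

theorem exists_iota_eq {k : ℕ} {f : P4} (hf : f ∈ antiPow k) : ∃ z : F k, iota z = f := by
  obtain ⟨hs, hp⟩ := hf
  obtain ⟨g, -, rfl⟩ := mem_powIdeal.1 hp
  have : swap g = -g := by
    rw [map_mul, swap_varProd, ← mul_neg] at hs
    exact mul_left_cancel₀ varProd_ne_zero hs
  obtain ⟨z, hz⟩ := iota_exists this
  exact ⟨⟨z, mem_F_iff.2 (by rwa [hz])⟩, hz⟩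

/-- The isomorphism of `F k` with a space of polynomials. -/
def iotaEquiv (k : ℕ) : F k ≃ₗ[ℂ] antiPow k :=
  LinearEquiv.ofBijective
    ((iota.comp (F k).subtype).codRestrict (antiPow k)
      fun z => ⟨swap_iota _, iota_mem_powIdeal z.2⟩)
    ⟨fun _ _ h => Subtype.ext (iota_injective (congrArg Subtype.val h)), fun f => by
      obtain ⟨z, hz⟩ := exists_iota_eq f.2
      exact ⟨z, Subtype.ext hz⟩⟩

/-- The class in `F k / F (k + 1)` of a polynomial. -/
def cls (k : ℕ) : antiPow k →ₗ[ℂ] gr k := (grMk k).comp (iotaEquiv k).symm.toLinearMap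

theorem cls_eq {k : ℕ} {f : antiPow k} {z : F k} (h : iota z = f) : cls k f = grMk k z := by
  have : (iotaEquiv k).symm f = z := by
    rw [LinearEquiv.symm_apply_eq]
    exact Subtype.ext h.symm
  rw [cls, LinearMap.comp_apply, LinearEquiv.coe_coe, this]

theorem exists_cls_eq {k : ℕ} (f : antiPow k) : ∃ z : F k, cls k f = grMk k z ∧ iota z = f := by
  obtain ⟨z, hz⟩ := exists_iota_eq f.2
  exact ⟨z, cls_eq hz, hz⟩

theorem grMk_eq_iff {k : ℕ} {z w : F k} :
    grMk k z = grMk k w ↔ iota z - iota w ∈ powIdeal (k + 1) := by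
  rw [Submodule.mkQ_apply, Submodule.mkQ_apply, Submodule.Quotient.eq]
  change ((z : grL 1) - w) ∈ F (k + 1) ↔ _
  rw [mem_F_iff, map_sub]

theorem cls_eq_cls_iff {k : ℕ} {f g : antiPow k} :
    cls k f = cls k g ↔ (f : P4) - g ∈ powIdeal (k + 1) := by
  obtain ⟨z, hz, h⟩ := exists_cls_eq f
  obtain ⟨w, hw, h'⟩ := exists_cls_eq g
  rw [hz, hw, grMk_eq_iff, h, h']

theorem mul_mem_antiPow {k r : ℕ} {a f : P4} (ha : swap a = a) (ha' : a ∈ sigIdeal ^ r)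
    (hf : f ∈ antiPow k) : a * f ∈ antiPow (k + r) :=
  ⟨by rw [map_mul, ha, hf.1, mul_neg], mul_mem_powIdeal ha' hf.2⟩

theorem actStep_cls {j : ℕ} (hj : Odd j) (h3 : 3 ≤ j) (s : Sig) (hs : (s : grL 0) = sig j) {k : ℕ}
    (f : antiPow k) (g : antiPow (k + 1)) (h : (g : P4) = sigTilde j * f) :
    actStep s k (cls k f) = cls (k + 1) g := by
  obtain ⟨z, hz, e⟩ := exists_cls_eq f
  rw [hz]
  symm
  refine cls_eq (z := ⟨act s z, act_mem s k z.2⟩) ?_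
  change iota (act s z) = _
  rw [hs, iota_act_sig hj h3, e, h]

theorem actStep_add (s t : Sig) (k : ℕ) (u : gr k) :
    actStep (s + t) k u = actStep s k u + actStep t k u := by
  obtain ⟨z, rfl⟩ := Submodule.mkQ_surjective _ u
  refine congrArg (grMk (k + 1)) (Subtype.ext ?_)
  exact LinearMap.map_add₂ act (s : grL 0) t z

theorem actStep_smul (c : ℂ) (s : Sig) (k : ℕ) (u : gr k) :
    actStep (c • s) k u = c • actStep s k u := by
  obtain ⟨z, rfl⟩ := Submodule.mkQ_surjective _ u
  refine congrArg (grMk (k + 1)) (Subtype.ext ?_)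
  exact LinearMap.map_smul₂ act c (s : grL 0) z

/-! ### The classes of the products by `τ₃₅` -/

/-- The polynomials of `Σ`-degree `k`. -/
abbrev degPiece (k : ℕ) : Submodule ℂ PV := MvPolynomial.weightedHomogeneousSubmodule ℂ sdeg k

theorem swap_ev (p : PV) : swap (ev p) = ev p := by
  have : swap.comp ev = ev := by
    refine MvPolynomial.algHom_ext fun i => ?_
    cases i <;> simp only [AlgHom.comp_apply, ev_x2, ev_x6, ev_x3, ev_x5, swap_sigTilde]
  exact DFunLike.congr_fun this p

theorem tau35_mem : tau35 ∈ antiPow 0 := by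
  refine ⟨swap_tau 3 5, ?_⟩
  obtain ⟨θ, hθ⟩ : varProd ∣ tau35 := varProd_dvd_tau ⟨1, rfl⟩ ⟨2, rfl⟩
  exact mem_powIdeal.2 ⟨θ, by simp, hθ⟩

theorem ev_mul_tau35_mem {k : ℕ} {p : PV} (hp : p ∈ degPiece k) : ev p * tau35 ∈ antiPow k := by
  have := mul_mem_antiPow (swap_ev p) (ev_mem hp) tau35_mem
  rwa [zero_add] at this

/-- The class of the product of `τ₃₅` by the evaluation of a polynomial. -/
def phiPiece (k : ℕ) : degPiece k →ₗ[ℂ] gr k :=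
  (cls k).comp (((LinearMap.mulRight ℂ tau35).comp (ev.toLinearMap.comp
    (degPiece k).subtype)).codRestrict (antiPow k) fun p => ev_mul_tau35_mem p.2)

theorem phiPiece_apply {k : ℕ} (p : degPiece k) :
    phiPiece k p = cls k ⟨ev p * tau35, ev_mul_tau35_mem p.2⟩ := rfl

theorem phiPiece_injective (k : ℕ) : Function.Injective (phiPiece k) := by
  rw [← LinearMap.ker_eq_bot, LinearMap.ker_eq_bot']
  intro p hp
  rw [phiPiece_apply, ← map_zero (cls k), cls_eq_cls_iff] at hp
  rw [Submodule.coe_zero, sub_zero] at hp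
  exact Subtype.ext (eq_zero_of_ev_mul_tau_mem_succ p.2 hp)

/-- The polynomial that gives the action of `σ_(2n+3)`. -/
def actPoly (n : ℕ) : PV := (2 * (n : PV) + 3) *
  (MvPolynomial.C (1 / 3) * invCoeff (n + 2) * MvPolynomial.X .x3 +
    MvPolynomial.C (1 / 5) * invCoeff (n + 1) * (MvPolynomial.X .x5 -
      MvPolynomial.C (5 / 6) * MvPolynomial.X .x2 * MvPolynomial.X .x3))

theorem ev_C (c : ℂ) : ev (MvPolynomial.C c) = MvPolynomial.C c := ev.commutes c

theorem six_mul_C : (6 : P4) * MvPolynomial.C (5 / 6) = 5 := by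
  rw [← map_ofNat (MvPolynomial.C : ℂ →+* P4) 6, ← map_mul, ← map_ofNat MvPolynomial.C 5]
  norm_num

theorem el3_eq : el3 = MvPolynomial.C (1 / 3) * sigTilde 3 := by
  rw [sigTilde_three]
  linear_combination -el3 * ofNat_mul_C_inv (σ := Fin 4) 3

theorem el5_eq : el5 = MvPolynomial.C (1 / 5) *
    (sigTilde 5 - MvPolynomial.C (5 / 6) * sigTilde 2 * sigTilde 3) := by
  have h := ofNat_mul_C_inv (σ := Fin 4) 5
  rw [sigTilde_five, sigTilde_three, sigTilde_two]
  linear_combination -el5 * h - MvPolynomial.C (1 / 5) * el2 * el3 * six_mul_C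

theorem ev_actPoly (n : ℕ) : ev (actPoly n) = oddMain n := by
  rw [actPoly, oddMain, el3_eq, el5_eq]
  simp only [map_mul, map_add, map_sub, map_natCast, map_ofNat, ev_C, ev_x2, ev_x3, ev_x5]
  ring

theorem C_mem (c : ℂ) : (MvPolynomial.C c : PV) ∈ degPiece 0 :=
  MvPolynomial.isWeightedHomogeneous_C sdeg c

theorem X_mem (v : Var) : (MvPolynomial.X v : PV) ∈ degPiece (sdeg v) :=
  MvPolynomial.isWeightedHomogeneous_X ℂ sdeg v

theorem mul_mem_degPiece {k r : ℕ} {p q : PV} (hp : p ∈ degPiece k) (hq : q ∈ degPiece r) :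
    p * q ∈ degPiece (k + r) :=
  MvPolynomial.IsWeightedHomogeneous.mul hp hq

theorem mul_mem_degPiece_left {k : ℕ} {p q : PV} (hp : p ∈ degPiece 0) (hq : q ∈ degPiece k) :
    p * q ∈ degPiece k := by
  have := mul_mem_degPiece hp hq
  rwa [zero_add] at this

theorem d2_mem : d2 ∈ degPiece 0 := neg_mem (mul_mem_degPiece_left (C_mem _) (X_mem .x2))

theorem d4_mem : d4 ∈ degPiece 0 := by
  rw [d4, pow_two]
  exact mul_mem_degPiece_left (C_mem _) (mul_mem_degPiece_left (X_mem .x2) (X_mem .x2))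

theorem d6_mem : d6 ∈ degPiece 0 := by
  rw [d6, pow_succ, pow_two]
  exact add_mem (neg_mem (mul_mem_degPiece_left (C_mem _) (X_mem .x6)))
    (mul_mem_degPiece_left (C_mem _) (mul_mem_degPiece_left
      (mul_mem_degPiece_left (X_mem .x2) (X_mem .x2)) (X_mem .x2)))

theorem invCoeff_mem (n : ℕ) : invCoeff n ∈ degPiece 0 := by
  induction n using Nat.strong_induction_on with
  | _ n ih =>
    match n with
    | 0 => rw [invCoeff]; exact zero_mem _
    | 1 => rw [invCoeff]; exact zero_mem _
    | 2 => rw [invCoeff]; exact MvPolynomial.isWeightedHomogeneous_one ℂ sdeg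
    | n + 3 =>
      rw [invCoeff_add_three]
      exact sub_mem (sub_mem (neg_mem (mul_mem_degPiece_left d2_mem (ih _ (by omega))))
        (mul_mem_degPiece_left d4_mem (ih _ (by omega))))
        (mul_mem_degPiece_left d6_mem (ih _ (by omega)))

theorem actPoly_mem (n : ℕ) : actPoly n ∈ degPiece 1 := by
  have h : 2 * (n : PV) + 3 = MvPolynomial.C (2 * (n : ℂ) + 3) := by
    simp only [map_add, map_mul, map_natCast, map_ofNat]
  rw [actPoly, h]
  exact mul_mem_degPiece_left (C_mem _) (add_mem (mul_mem_degPiece_left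
    (mul_mem_degPiece_left (C_mem _) (invCoeff_mem _)) (X_mem .x3))
    (mul_mem_degPiece_left (mul_mem_degPiece_left (C_mem _) (invCoeff_mem _))
      (sub_mem (X_mem .x5) (mul_mem_degPiece_left (mul_mem_degPiece_left (C_mem _) (X_mem .x2))
        (X_mem .x3)))))

theorem mul_mem_degPiece_one {k : ℕ} {p q : PV} (hp : p ∈ degPiece 1) (hq : q ∈ degPiece k) :
    p * q ∈ degPiece (k + 1) := by
  rw [add_comm]
  exact mul_mem_degPiece hp hq

/-- The error of σ̃_(2n+3) against `oddMain n` lies in `sigIdeal * crossIdeal`, and by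
`sig_cross_mul_tau` its product with τ₃₅ falls one step further in the filtration. -/
theorem actStep_phiPiece (n : ℕ) (s : Sig) (hs : (s : grL 0) = sig (2 * n + 3)) {k : ℕ}
    (p : degPiece k) :
    actStep s k (phiPiece k p) =
      phiPiece (k + 1) ⟨actPoly n * p, mul_mem_degPiece_one (actPoly_mem n) p.2⟩ := by
  have ho : Odd (2 * n + 3) := ⟨n + 1, by ring⟩
  have h3 : 3 ≤ 2 * n + 3 := by omega
  have hm : sigTilde (2 * n + 3) * (ev p * tau35) ∈ antiPow (k + 1) :=
    mul_mem_antiPow (swap_sigTilde _) (mem_sigIdeal_pow_one (sigTilde_odd_mem_sigIdeal ho h3))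
      (ev_mul_tau35_mem p.2)
  have h1 : actStep s k (phiPiece k p) = cls (k + 1) ⟨_, hm⟩ :=
    actStep_cls ho h3 s hs ⟨ev p * tau35, ev_mul_tau35_mem p.2⟩ ⟨_, hm⟩ rfl
  rw [h1, phiPiece_apply]
  refine cls_eq_cls_iff.2 ?_
  have h2 : sigTilde (2 * n + 3) * (ev p * tau35) - ev (actPoly n * p) * tau35 =
      ev p * ((sigTilde (2 * n + 3) - oddMain n) * tau35) := by
    rw [map_mul, ev_actPoly]
    ring
  have h3 := mul_mem_powIdeal (ev_mem p.2) (sig_cross_mul_tau (sigTilde_odd_sub_mem n))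
  rw [← h2, add_comm 2 k] at h3
  exact h3

/-! ### The image of the bracket -/

/-- The combinations of σ̃₃, σ̃₅ come from `sigTilde_odd_sub_mem`. The correction by (5/6) σ̃₂ σ̃₃
is a column operation and drops out of the determinant; the errors in `crossIdeal` are killed by
`cross_mul_tau`. -/
theorem tau_sub_ev_mem (m n : ℕ) : tau (2 * m + 3) (2 * n + 3) -
    ev (((2 * m + 3) * (2 * n + 3) : ℂ) • (MvPolynomial.C (1 / 15) *
      (invCoeff (m + 2) * invCoeff (n + 1) - invCoeff (n + 2) * invCoeff (m + 1)))) * tau35 ∈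
      powIdeal 1 := by
  have key (n : ℕ) : ∃ a ∈ crossIdeal, ∃ b ∈ crossIdeal, sigTilde (2 * n + 3) =
      ((2 * (n : P4) + 3) * (MvPolynomial.C (1 / 3) * ev (invCoeff (n + 2)) -
        MvPolynomial.C (1 / 5) * MvPolynomial.C (5 / 6) * sigTilde 2 * ev (invCoeff (n + 1))) + a) *
        sigTilde 3 +
      ((2 * (n : P4) + 3) * (MvPolynomial.C (1 / 5) * ev (invCoeff (n + 1))) + b) * sigTilde 5 := by
    have h : ∀ f ∈ sigIdeal * crossIdeal, ∃ a ∈ crossIdeal, ∃ b ∈ crossIdeal,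
        f = a * sigTilde 3 + b * sigTilde 5 := by
      intro f hf
      refine Submodule.mul_induction_on hf ?_ ?_
      · intro u hu v hv
        obtain ⟨c, d, rfl⟩ := Ideal.mem_span_pair.1 hu
        exact ⟨c * v, Ideal.mul_mem_left _ _ hv, d * v, Ideal.mul_mem_left _ _ hv, by ring⟩
      · rintro _ _ ⟨a, ha, b, hb, rfl⟩ ⟨a', ha', b', hb', rfl⟩
        exact ⟨a + a', add_mem ha ha', b + b', add_mem hb hb', by ring⟩
    obtain ⟨a, ha, b, hb, e⟩ := h _ (sigTilde_odd_sub_mem n)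
    refine ⟨a, ha, b, hb, ?_⟩
    rw [oddMain, el3_eq, el5_eq] at e
    linear_combination e
  obtain ⟨a, ha, b, hb, e⟩ := key m
  obtain ⟨a', ha', b', hb', e'⟩ := key n
  have h1 := tau_sub_mem (k := 2 * m + 3) (l := 2 * n + 3) ⟨m + 1, by ring⟩ ⟨n + 1, by ring⟩ e e'
  have h15 : (MvPolynomial.C (1 / 15) : P4) = MvPolynomial.C (1 / 3) * MvPolynomial.C (1 / 5) := by
    rw [← map_mul]
    norm_num
  have hc : ev (((2 * m + 3) * (2 * n + 3) : ℂ) • (MvPolynomial.C (1 / 15) *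
      (invCoeff (m + 2) * invCoeff (n + 1) - invCoeff (n + 2) * invCoeff (m + 1)))) =
      (2 * (m : P4) + 3) * (2 * (n : P4) + 3) * (MvPolynomial.C (1 / 3) * MvPolynomial.C (1 / 5) *
      (ev (invCoeff (m + 2)) * ev (invCoeff (n + 1)) -
        ev (invCoeff (n + 2)) * ev (invCoeff (m + 1)))) := by
    rw [Algebra.smul_def, map_mul, AlgHom.commutes]
    simp only [map_mul, map_sub, map_add, map_natCast, map_ofNat, ev_C, h15]
  rw [hc]
  generalize ev (invCoeff (m + 2)) = u2 at *
  generalize ev (invCoeff (m + 1)) = u1 at *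
  generalize ev (invCoeff (n + 2)) = v2 at *
  generalize ev (invCoeff (n + 1)) = v1 at *
  generalize (MvPolynomial.C (1 / 3) : P4) = c3 at *
  generalize (MvPolynomial.C (1 / 5) : P4) = c5 at *
  generalize (MvPolynomial.C (5 / 6) : P4) = c6 at *
  have h2 : (((2 * (m : P4) + 3) * (c3 * u2 - c5 * c6 * sigTilde 2 * u1)) * b' +
      a * ((2 * (n : P4) + 3) * (c5 * v1)) + a * b' -
      (((2 * (n : P4) + 3) * (c3 * v2 - c5 * c6 * sigTilde 2 * v1)) * b +
      a' * ((2 * (m : P4) + 3) * (c5 * u1)) + a' * b)) ∈ crossIdeal :=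
    sub_mem (add_mem (add_mem (Ideal.mul_mem_left _ _ hb') (Ideal.mul_mem_right _ _ ha))
      (Ideal.mul_mem_left _ _ hb')) (add_mem (add_mem (Ideal.mul_mem_left _ _ hb)
      (Ideal.mul_mem_right _ _ ha')) (Ideal.mul_mem_left _ _ hb))
  have h3 := add_mem h1 (cross_mul_tau h2)
  convert h3 using 1
  ring

theorem ihara_comm (f g : FL) : ihara g f = -ihara f g := by
  rw [ihara_apply, ihara_apply, ← lie_skew]; abel

/-- The class of `e i j` as a function of the monomial `A^i B^j`. -/
def rhoZero : P4 →ₗ[ℂ] FL ⧸ lcsS 1 :=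
  (MvPolynomial.basisMonomials (Fin 4) ℂ).constr ℂ fun d => (lcsS 1).mkQ (e (d 0) (d 1))

theorem rhoZero_monomial (i j : ℕ) : rhoZero (vA ^ i * vB ^ j) = (lcsS 1).mkQ (e i j) := by
  have h : vA ^ i * vB ^ j = MvPolynomial.basisMonomials (Fin 4) ℂ
      (Finsupp.single 0 i + Finsupp.single 1 j) := by
    simp [vA, vB, MvPolynomial.X_pow_eq_monomial, MvPolynomial.monomial_mul]
  rw [h, rhoZero, Module.Basis.constr_basis]
  simp

theorem mem_lcs_one_of_ent_eq_zero {z : FL} (hz : z ∈ Lbar) (h : ent vA vB z = 0) :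
    z ∈ lcs 1 := by
  have key : ∃ f : P4, ent vA vB z = vA * vB * f ∧ rhoZero f = (lcsS 1).mkQ z := by
    obtain ⟨s, hs, m, hm, rfl⟩ := Submodule.mem_sup.1 (Lbar_le_eSpan hz)
    rw [map_add, map_add, (lcsS 1).mkQ_apply m, (Submodule.Quotient.mk_eq_zero _).2 hm,
      ent_one vA vB hm, add_zero, add_zero]
    refine Submodule.span_induction ?_ ⟨0, by simp⟩ ?_ ?_ hs
    · rintro _ ⟨p, rfl⟩
      refine ⟨vA ^ p.1 * vB ^ p.2, ?_, rhoZero_monomial _ _⟩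
      rw [ent_e]
      ring
    · rintro u v _ _ ⟨f, hf, hf'⟩ ⟨g, hg, hg'⟩
      exact ⟨f + g, by rw [map_add, hf, hg, mul_add], by rw [map_add, map_add, hf', hg']⟩
    · rintro c u _ ⟨f, hf, hf'⟩
      exact ⟨c • f, by rw [map_smul, hf, mul_smul_comm], by rw [map_smul, map_smul, hf']⟩
  obtain ⟨f, hf, hf'⟩ := key
  rw [h] at hf
  have h0 : f = 0 := by
    refine (mul_eq_zero.1 hf.symm).resolve_left ?_
    simp [vA, vB, MvPolynomial.X_ne_zero]
  rw [h0, map_zero] at hf'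
  exact (Submodule.Quotient.mk_eq_zero _).1 hf'.symm

/-- The Lie bracket vanishes under `ent`, and `D f g`, `D g f` have the same image, the product of
the two values. -/
theorem ihara_mem_one_of_mem {f g : FL} (hf : f ∈ Lbar) (hg : g ∈ Lbar) : ihara f g ∈ lcs 1 := by
  refine mem_lcs_one_of_ent_eq_zero ?_ ?_
  · rw [ihara_apply]
    exact sub_mem (add_mem (mem_Lbar_lie _ _) (D_mem_Lbar _ _)) (D_mem_Lbar _ _)
  · rw [ihara_apply, map_sub, map_add, ent_lie, wt_Lbar _ _ hf, wt_Lbar _ _ hg, ent_D _ _ hf,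
      ent_D _ _ hg]
    ring

/-! ### The image of the bracket is a free module over `ℂ[x₂, x₆]` -/

theorem grMk_eq_phiPiece {k : ℕ} {z : F k} (p : degPiece k)
    (h : iota z - ev p * tau35 ∈ powIdeal (k + 1)) : grMk k z = phiPiece k p := by
  obtain ⟨w, hw, e⟩ := exists_cls_eq ⟨ev p * tau35, ev_mul_tau35_mem p.2⟩
  rw [phiPiece_apply, hw, grMk_eq_iff, e]
  exact h

/-- The span of the chosen lifts of the `σ_k`. -/
def sigLiftSpan : Submodule ℂ (lcsS 0) :=
  Submodule.span ℂ {s | ∃ k, Odd k ∧ 3 ≤ k ∧ s = ⟨sigLift k, sigLift_mem k⟩}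

theorem map_sigLiftSpan : sigLiftSpan.map (grLMk 0) = Sig := by
  rw [sigLiftSpan, Submodule.map_span, Sig]
  congr 1
  ext u
  constructor
  · rintro ⟨_, ⟨k, hk, h3, rfl⟩, rfl⟩
    exact ⟨k, hk, h3, rfl⟩
  · rintro ⟨k, hk, h3, rfl⟩
    exact ⟨_, ⟨k, hk, h3, rfl⟩, rfl⟩

theorem exists_sub_mem_of_mem_Sig {f : lcsS 0} (hf : grLMk 0 f ∈ Sig) :
    ∃ s ∈ sigLiftSpan, (f : FL) - s ∈ lcs 1 := by
  rw [← map_sigLiftSpan] at hf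
  obtain ⟨s, hs, h⟩ := hf
  exact ⟨s, hs, (Submodule.Quotient.eq ((lcsS 1).submoduleOf (lcsS 0))).1 h.symm⟩

theorem grLMk_mem_Sig {s : lcsS 0} (hs : s ∈ sigLiftSpan) : grLMk 0 s ∈ Sig := by
  rw [← map_sigLiftSpan]
  exact Submodule.mem_map_of_mem hs

theorem corner_ihara_mem_powIdeal {f : lcsS 0} (hf : grLMk 0 f ∈ Sig) {m : FL} (hm : m ∈ lcs 1) :
    corner vA vB vA' vB' (ihara f m) ∈ powIdeal 1 := by
  have h : act (grLMk 0 f) (grLMk 1 ⟨m, hm⟩) ∈ F 1 :=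
    Submodule.apply_mem_map₂ _ hf Submodule.mem_top
  exact iota_mem_powIdeal h

theorem corner_ihara_sigLift_sub_mem (m n : ℕ) :
    corner vA vB vA' vB' (ihara (sigLift (2 * m + 3)) (sigLift (2 * n + 3))) -
    ev ((-(1 / 2) * ((2 * m + 3) * (2 * n + 3)) : ℂ) • (MvPolynomial.C (1 / 15) *
      (invCoeff (m + 2) * invCoeff (n + 1) - invCoeff (n + 2) * invCoeff (m + 1)))) * tau35 ∈
      powIdeal 1 := by
  have hm : Odd (2 * m + 3) := ⟨m + 1, by ring⟩
  have hn : Odd (2 * n + 3) := ⟨n + 1, by ring⟩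
  obtain ⟨a, b, e⟩ := corner_ihara_sigLift hm (Nat.le_add_left _ _) hn (Nat.le_add_left _ _)
  have h1 : varProd * (sigTilde (2 * m + 3) * b - sigTilde (2 * n + 3) * a) ∈ powIdeal 1 := by
    refine mem_powIdeal.2 ⟨_, ?_, rfl⟩
    rw [pow_one]
    exact sub_mem
      (Ideal.mul_mem_right _ _ (sigTilde_odd_mem_sigIdeal hm (Nat.le_add_left _ _)))
      (Ideal.mul_mem_right _ _ (sigTilde_odd_mem_sigIdeal hn (Nat.le_add_left _ _)))
  rw [← e] at h1
  have h2 := Submodule.smul_mem ((powIdeal 1).restrictScalars ℂ) (1 / 2 : ℂ)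
    (sub_mem h1 (tau_sub_ev_mem m n))
  rw [two_mul (corner vA vB vA' vB' _), map_smul, smul_mul_assoc] at h2
  rw [map_smul, smul_mul_assoc]
  change _ ∈ (powIdeal 1).restrictScalars ℂ
  convert h2 using 1
  module

/-- The products of `τ₃₅` by polynomials of `Σ`-degree `0`, up to `powIdeal 1`. -/
def bracketSpan : Submodule ℂ P4 :=
  (degPiece 0).map ((LinearMap.mulRight ℂ tau35).comp ev.toLinearMap) ⊔
    (powIdeal 1).restrictScalars ℂ

theorem corner_ihara_mem_bracketSpan {f g : lcsS 0} (hf : grLMk 0 f ∈ Sig)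
    (hg : grLMk 0 g ∈ Sig) : corner vA vB vA' vB' (ihara f g) ∈ bracketSpan := by
  have main : ∀ s ∈ sigLiftSpan, ∀ t ∈ sigLiftSpan,
      corner vA vB vA' vB' (ihara (s : FL) t) ∈ bracketSpan := by
    let B : lcsS 0 →ₗ[ℂ] lcsS 0 →ₗ[ℂ] P4 :=
      (ihara.compl₁₂ (lcsS 0).subtype (lcsS 0).subtype).compr₂ (corner vA vB vA' vB')
    have : Submodule.map₂ B sigLiftSpan sigLiftSpan ≤ bracketSpan := by
      rw [sigLiftSpan, Submodule.map₂_span_span]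
      refine Submodule.span_le.2 ?_
      rintro _ ⟨_, ⟨k, hk, hk3, rfl⟩, _, ⟨l, hl, hl3, rfl⟩, rfl⟩
      obtain ⟨m, rfl⟩ : ∃ n, k = 2 * n + 3 := by
        obtain ⟨m, rfl⟩ := hk
        exact ⟨m - 1, by omega⟩
      obtain ⟨n, rfl⟩ : ∃ n, l = 2 * n + 3 := by
        obtain ⟨m, rfl⟩ := hl
        exact ⟨m - 1, by omega⟩
      have h := corner_ihara_sigLift_sub_mem m n
      refine Submodule.mem_sup.2 ⟨_, Submodule.mem_map_of_mem (r := (-(1 / 2) * ((2 * m + 3) * (2 * n + 3)) : ℂ) •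
        (MvPolynomial.C (1 / 15) * (invCoeff (m + 2) * invCoeff (n + 1) -
          invCoeff (n + 2) * invCoeff (m + 1)))) ?_, _, h, ?_⟩
      · exact Submodule.smul_mem _ _ (mul_mem_degPiece_left (C_mem _) (sub_mem
          (mul_mem_degPiece_left (invCoeff_mem _) (invCoeff_mem _))
          (mul_mem_degPiece_left (invCoeff_mem _) (invCoeff_mem _))))
      · exact add_sub_cancel _ _
    intro s hs t ht
    exact this (Submodule.apply_mem_map₂ B hs ht)
  have hle : (powIdeal 1).restrictScalars ℂ ≤ bracketSpan := le_sup_right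
  obtain ⟨s, hs, hs'⟩ := exists_sub_mem_of_mem_Sig hf
  obtain ⟨t, ht, ht'⟩ := exists_sub_mem_of_mem_Sig hg
  have h1 := hle (corner_ihara_mem_powIdeal hf ht')
  have h2 := hle (corner_ihara_mem_powIdeal (grLMk_mem_Sig ht) hs')
  -- Changing the lifts only adds terms in which an element of Σ acts on `lcs 1`, hence terms in
  -- `powIdeal 1`.
  have h3 : ihara (f : FL) g = ihara (s : FL) t + ihara (f : FL) (g - t) -
      ihara (t : FL) (f - s) := by
    rw [ihara_comm ((f : FL) - s) t, map_sub, map_sub, LinearMap.sub_apply]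
    abel
  rw [h3, map_sub, map_add]
  exact sub_mem (add_mem (main s hs t ht) h1) h2

theorem M0min_le_range : M0min ≤ LinearMap.range (phiPiece 0) := by
  refine Submodule.span_le.2 ?_
  rintro _ ⟨f, g, h, hf, hg, e, rfl⟩
  have h1 := corner_ihara_mem_bracketSpan hf hg
  obtain ⟨_, ⟨p, hp, rfl⟩, r, hr, e'⟩ := Submodule.mem_sup.1 h1
  refine ⟨⟨p, hp⟩, (grMk_eq_phiPiece _ ?_).symm⟩
  change corner vA vB vA' vB' (h : FL) - ev p * tau35 ∈ powIdeal 1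
  rw [e, ← e']
  change ev p * tau35 + r - ev p * tau35 ∈ powIdeal 1
  rwa [add_sub_cancel_left]

theorem twoRow_mem_degPiece (p q : ℕ) : twoRow invCoeff p q ∈ degPiece 0 :=
  sub_mem (mul_mem_degPiece_left (invCoeff_mem _) (invCoeff_mem _))
    (mul_mem_degPiece_left (invCoeff_mem _) (invCoeff_mem _))

theorem phiPiece_twoRow_mem (p q : ℕ) :
    phiPiece 0 ⟨twoRow invCoeff p q, twoRow_mem_degPiece p q⟩ ∈ M0min := by
  have ho (n : ℕ) : Odd (2 * n + 3) := ⟨n + 1, by ring⟩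
  -- The shift to `p + 1` turns the determinant of the bracket into the opposite of `twoRow invCoeff
  -- p q`; the sign and the nonzero scalar go into `c`.
  have h1 := corner_ihara_sigLift_sub_mem (p + 1) q
  set c : ℂ := 1 / 2 * ((2 * (p + 1 : ℕ) + 3) * (2 * q + 3)) * (1 / 15) with hc
  have hc0 : c ≠ 0 := by
    have h (n : ℕ) : (2 * (n : ℂ) + 3) ≠ 0 := by
      have : ((2 * n + 3 : ℕ) : ℂ) ≠ 0 := Nat.cast_ne_zero.2 (by omega)
      push_cast at this
      exact this
    exact mul_ne_zero (mul_ne_zero (by norm_num) (mul_ne_zero (h _) (h _))) (by norm_num)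
  have h2 : (-(1 / 2) * ((2 * (p + 1 : ℕ) + 3) * (2 * q + 3)) : ℂ) • (MvPolynomial.C (1 / 15) *
      (invCoeff (p + 1 + 2) * invCoeff (q + 1) - invCoeff (q + 2) * invCoeff (p + 1 + 1))) =
      c • twoRow invCoeff p q := by
    rw [← MvPolynomial.smul_eq_C_mul, smul_smul, hc, twoRow, neg_mul, neg_mul, neg_smul,
      ← smul_neg]
    congr 1
    ring
  rw [h2] at h1
  clear_value c
  have hp : c • twoRow invCoeff p q ∈ degPiece 0 := Submodule.smul_mem _ c (twoRow_mem_degPiece p q)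
  have hmem : ihara (sigLift (2 * (p + 1) + 3)) (sigLift (2 * q + 3)) ∈ lcsS 1 :=
    ihara_mem_one_of_mem (sigLift_mem _) (sigLift_mem _)
  have h3 : phiPiece 0 ⟨_, hp⟩ ∈ M0min := by
    rw [← grMk_eq_phiPiece (z := ⟨grLMk 1 ⟨_, hmem⟩, Submodule.mem_top⟩) ⟨_, hp⟩ h1]
    exact Submodule.subset_span ⟨⟨_, sigLift_mem (2 * (p + 1) + 3)⟩,
      ⟨_, sigLift_mem (2 * q + 3)⟩, ⟨_, hmem⟩,
      sig_mem (ho _) (Nat.le_add_left _ _), sig_mem (ho _) (Nat.le_add_left _ _), rfl, rfl⟩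
  have h4 : (⟨_, hp⟩ : degPiece 0) = c • ⟨_, twoRow_mem_degPiece p q⟩ := rfl
  rw [h4, map_smul] at h3
  exact (Submodule.smul_mem_iff _ hc0).1 h3

theorem range_le_M0min : LinearMap.range (phiPiece 0) ≤ M0min := by
  rintro _ ⟨⟨p, hp⟩, rfl⟩
  have h1 : Submodule.span ℂ (Set.range fun p : ℕ × ℕ => twoRow invCoeff p.1 p.2) ≤
      (M0min.comap (phiPiece 0)).map (degPiece 0).subtype := by
    refine Submodule.span_le.2 ?_
    rintro _ ⟨q, rfl⟩
    exact ⟨⟨_, twoRow_mem_degPiece q.1 q.2⟩, phiPiece_twoRow_mem q.1 q.2, rfl⟩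
  have h2 : p ∈ (M0min.comap (phiPiece 0)).map (degPiece 0).subtype := by
    refine sdeg_induction (P := fun p => p ∈ (M0min.comap (phiPiece 0)).map (degPiece 0).subtype)
      (zero_mem _) ?_ (fun _ _ => add_mem) (fun c _ => Submodule.smul_mem _ c) hp
    intro i j a b hab
    obtain ⟨rfl, rfl⟩ : a = 0 ∧ b = 0 := by omega
    exact h1 (mon_mem_span_twoRow i j)
  obtain ⟨q, hq, rfl⟩ := h2
  exact hq

/-! ### The higher graded pieces -/

theorem Mmin_le_range (k : ℕ) : Mmin k ≤ LinearMap.range (phiPiece k) := by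
  induction k with
  | zero => exact M0min_le_range
  | succ k ih =>
    rw [Mmin]
    refine iSup_le fun s => ?_
    rintro _ ⟨u, hu, rfl⟩
    obtain ⟨p, rfl⟩ := ih hu
    obtain ⟨s, hs⟩ := s
    have : ∀ hs : s ∈ Sig, actStep ⟨s, hs⟩ k (phiPiece k p) ∈ LinearMap.range (phiPiece (k + 1)) := by
      refine Submodule.span_induction ?_ ?_ ?_ ?_ hs
      · rintro _ ⟨j, hj, h3, rfl⟩ hs
        obtain ⟨n, rfl⟩ : ∃ n, j = 2 * n + 3 := by
          obtain ⟨m, rfl⟩ := hj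
          exact ⟨m - 1, by omega⟩
        exact ⟨_, (actStep_phiPiece n _ rfl p).symm⟩
      · intro hs
        have := actStep_smul 0 ⟨0, hs⟩ k (phiPiece k p)
        rw [zero_smul, zero_smul] at this
        change actStep 0 k _ ∈ _
        rw [this]
        exact zero_mem _
      · intro u v hu' hv' hu hv _
        have := actStep_add ⟨u, hu'⟩ ⟨v, hv'⟩ k (phiPiece k p)
        exact this ▸ add_mem (hu _) (hv _)
      · intro c u hu' hu _
        have := actStep_smul c ⟨u, hu'⟩ k (phiPiece k p)
        exact this ▸ Submodule.smul_mem _ c (hu _)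
    exact this hs

theorem X_mul_mem {v : Var} (hv : sdeg v = 1) {k : ℕ} {q : PV} (hq : q ∈ degPiece k) :
    MvPolynomial.X v * q ∈ degPiece (k + 1) := by
  have := X_mem v
  rw [hv] at this
  exact mul_mem_degPiece_one this hq

theorem actStep_phiPiece_three (k : ℕ) (q : degPiece k)
    (hm : (MvPolynomial.X Var.x3 * (q : PV) : PV) ∈ degPiece (k + 1)) :
    actStep ⟨sig 3, sig_mem ⟨1, rfl⟩ le_rfl⟩ k (phiPiece k q) =
      phiPiece (k + 1) ⟨_, hm⟩ := by
  rw [phiPiece_apply, phiPiece_apply]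
  have h : ev (MvPolynomial.X Var.x3 * (q : PV)) * tau35 = sigTilde 3 * (ev q * tau35) := by
    rw [map_mul, ev_x3, mul_assoc]
  exact actStep_cls (j := 3) ⟨1, rfl⟩ le_rfl _ rfl ⟨ev q * tau35, ev_mul_tau35_mem q.2⟩
    ⟨ev (MvPolynomial.X Var.x3 * (q : PV)) * tau35, ev_mul_tau35_mem hm⟩ h

theorem actStep_phiPiece_five (k : ℕ) (q : degPiece k)
    (hm : (MvPolynomial.X Var.x5 * (q : PV) : PV) ∈ degPiece (k + 1)) :
    actStep ⟨sig 5, sig_mem ⟨2, rfl⟩ (by norm_num)⟩ k (phiPiece k q) =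
      phiPiece (k + 1) ⟨_, hm⟩ := by
  rw [phiPiece_apply, phiPiece_apply]
  have h : ev (MvPolynomial.X Var.x5 * (q : PV)) * tau35 = sigTilde 5 * (ev q * tau35) := by
    rw [map_mul, ev_x5, mul_assoc]
  exact actStep_cls (j := 5) ⟨2, rfl⟩ (by norm_num) _ rfl ⟨ev q * tau35, ev_mul_tau35_mem q.2⟩
    ⟨ev (MvPolynomial.X Var.x5 * (q : PV)) * tau35, ev_mul_tau35_mem hm⟩ h

/-- The elements σ₃ and σ₅ alone suffice: they act exactly as x₃ and x₅, and every polynomial of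
positive Σ-degree lies in the ideal of these two variables. -/
theorem range_le_Mmin (k : ℕ) : LinearMap.range (phiPiece k) ≤ Mmin k := by
  induction k with
  | zero => exact range_le_M0min
  | succ k ih =>
    rintro _ ⟨⟨p, hp⟩, rfl⟩
    obtain ⟨q, r, hq, hr, rfl⟩ := exists_decomposition hp
    have hr' : MvPolynomial.X .x5 ^ k * r ∈ degPiece k := by
      have := mul_mem_degPiece (((MvPolynomial.isWeightedHomogeneous_X ℂ sdeg .x5).pow k)) hr
      simpa [sdeg] using this
    have h1 := add_mem
      (actStep_mem ⟨sig 3, sig_mem ⟨1, rfl⟩ le_rfl⟩ k (ih ⟨⟨q, hq⟩, rfl⟩))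
      (actStep_mem ⟨sig 5, sig_mem ⟨2, rfl⟩ (by norm_num)⟩ k (ih ⟨⟨_, hr'⟩, rfl⟩))
    rw [actStep_phiPiece_three _ ⟨q, hq⟩ (X_mul_mem rfl (q := q) hq),
      actStep_phiPiece_five _ ⟨_, hr'⟩ (X_mul_mem rfl (q := _ * r) hr'), ← map_add] at h1
    convert h1 using 2
    refine Subtype.ext ?_
    change MvPolynomial.X .x3 * q + MvPolynomial.X .x5 ^ (k + 1) * r =
      MvPolynomial.X .x3 * q + MvPolynomial.X .x5 * (MvPolynomial.X .x5 ^ k * r)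
    rw [pow_succ', mul_assoc]

/-! ### The isomorphism -/

/-- The isomorphism in a given `Σ`-degree. -/
def pieceEquiv (k : ℕ) : degPiece k ≃ₗ[ℂ] Mmin k :=
  LinearEquiv.ofBijective
    ((phiPiece k).codRestrict (Mmin k) fun p => range_le_Mmin k ⟨p, rfl⟩)
    ⟨fun _ _ h => phiPiece_injective k (congrArg Subtype.val h), fun u => by
      obtain ⟨p, hp⟩ := Mmin_le_range k u.2
      exact ⟨p, Subtype.ext hp⟩⟩

theorem coe_pieceEquiv {k : ℕ} (p : degPiece k) : (pieceEquiv k p : gr k) = phiPiece k p := rfl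

attribute [local instance] MvPolynomial.weightedDecomposition

/-- The isomorphism from `ℂ[x₂, x₆, x₃, x₅]` to `M^min(Σ)`. -/
def phiEquiv : PV ≃ₗ[ℂ] MMin :=
  (DirectSum.decomposeLinearEquiv degPiece).trans (DirectSum.congrLinearEquiv pieceEquiv)

theorem phiEquiv_of_mem {s : ℕ} {p : PV} (hp : p ∈ degPiece s) :
    phiEquiv p = DirectSum.lof ℂ ℕ (fun k => Mmin k) s (pieceEquiv s ⟨p, hp⟩) := by
  have h : DirectSum.decomposeLinearEquiv degPiece p =
      DirectSum.lof ℂ ℕ (fun k => degPiece k) s ⟨p, hp⟩ :=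
    DirectSum.decomposeLinearEquiv_apply_coe degPiece s ⟨p, hp⟩
  rw [phiEquiv, LinearEquiv.trans_apply, h]
  exact DFinsupp.mapRange_single (f := fun i => pieceEquiv i) (hf := fun i => map_zero _)

theorem comp_phiEquiv_self {s : ℕ} {p : PV} (hp : p ∈ degPiece s) :
    comp (phiEquiv p) s = phiPiece s ⟨p, hp⟩ := by
  rw [comp, phiEquiv_of_mem hp, DirectSum.lof_eq_of, DirectSum.of_eq_same, coe_pieceEquiv]

theorem comp_phiEquiv_of_ne {s : ℕ} {p : PV} (hp : p ∈ degPiece s) {k : ℕ} (hk : k ≠ s) :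
    comp (phiEquiv p) k = 0 := by
  rw [comp, phiEquiv_of_mem hp, DirectSum.lof_eq_of, DirectSum.of_eq_of_ne _ _ _ hk,
    Submodule.coe_zero]

/-! ### Components of elements of M^min and the product relation. -/

theorem comp_add (m n : MMin) (k : ℕ) : comp (m + n) k = comp m k + comp n k := rfl

theorem comp_smul (c : ℂ) (m : MMin) (k : ℕ) : comp (c • m) k = c • comp m k := rfl

theorem comp_zero (k : ℕ) : comp 0 k = 0 := rfl

theorem comp_ext {m n : MMin} (h : ∀ k, comp m k = comp n k) : m = n :=
  DFinsupp.ext fun k => Subtype.ext (h k)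

theorem IsProd.zero (r : ℕ) (a : P4) (k : ℕ) : IsProd r a (0 : gr k) (0 : gr (k + r)) :=
  ⟨0, 0, (map_zero _).symm, (map_zero _).symm, by simp⟩

theorem IsProd.add {r : ℕ} {a : P4} {k : ℕ} {u u' : gr k} {v v' : gr (k + r)}
    (h : IsProd r a u v) (h' : IsProd r a u' v') : IsProd r a (u + u') (v + v') := by
  obtain ⟨z, w, rfl, rfl, e⟩ := h
  obtain ⟨z', w', rfl, rfl, e'⟩ := h'
  refine ⟨z + z', w + w', (map_add _ _ _).symm, (map_add _ _ _).symm, ?_⟩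
  rw [Submodule.coe_add, Submodule.coe_add, map_add, map_add, e, e', mul_add]

theorem IsProd.smul {r : ℕ} {a : P4} {k : ℕ} {u : gr k} {v : gr (k + r)}
    (h : IsProd r a u v) (c : ℂ) : IsProd r a (c • u) (c • v) := by
  obtain ⟨z, w, rfl, rfl, e⟩ := h
  refine ⟨c • z, c • w, (map_smul _ _ _).symm, (map_smul _ _ _).symm, ?_⟩
  rw [Submodule.coe_smul, Submodule.coe_smul, map_smul, map_smul, e, mul_smul_comm]

/-- Multiplication by an element of `sigIdeal ^ r` raises the filtration by r, so the class of the
product does not depend on the representative. -/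
theorem IsProd.unique {r : ℕ} {a : P4} {k : ℕ} {u : gr k} {v v' : gr (k + r)}
    (h : IsProd r a u v) (h' : IsProd r a u v') (ha : a ∈ sigIdeal ^ r) : v = v' := by
  obtain ⟨z, w, rfl, rfl, e⟩ := h
  obtain ⟨z', w', hz, rfl, e'⟩ := h'
  rw [grMk_eq_iff] at hz ⊢
  rw [e, e', ← mul_sub, add_right_comm]
  exact mul_mem_powIdeal ha hz

theorem isProd_phiPiece {k r : ℕ} {q p : PV} (hp : p ∈ degPiece k)
    (hm : q * p ∈ degPiece (k + r)) :
    IsProd r (ev q) (phiPiece k ⟨p, hp⟩) (phiPiece (k + r) ⟨q * p, hm⟩) := by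
  obtain ⟨z, hz, e⟩ := exists_cls_eq ⟨ev p * tau35, ev_mul_tau35_mem hp⟩
  obtain ⟨w, hw, e'⟩ := exists_cls_eq ⟨ev (q * p) * tau35, ev_mul_tau35_mem hm⟩
  refine ⟨z, w, hz, hw, ?_⟩
  change iota z = ev p * tau35 at e
  change iota w = ev (q * p) * tau35 at e'
  rw [e, e', map_mul, mul_assoc]

theorem isProd_phiEquiv (v : Var) (p : PV) (k : ℕ) :
    IsProd (sdeg v) (ev (MvPolynomial.X v)) (comp (phiEquiv p) k)
      (comp (phiEquiv (MvPolynomial.X v * p)) (k + sdeg v)) := by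
  refine PV_induction (P := fun p => IsProd (sdeg v) (ev (MvPolynomial.X v)) (comp (phiEquiv p) k)
      (comp (phiEquiv (MvPolynomial.X v * p)) (k + sdeg v))) ?_ ?_ ?_ ?_ p
  · rw [mul_zero, map_zero, comp_zero, comp_zero]
    exact IsProd.zero _ _ _
  · intro i j a b
    have hp : mon i j a b ∈ degPiece (a + b) := isWeightedHomogeneous_mon i j a b
    have hm : MvPolynomial.X v * mon i j a b ∈ degPiece (a + b + sdeg v) := by
      rw [add_comm]
      exact mul_mem_degPiece (X_mem v) hp
    by_cases h : k = a + b
    · subst h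
      rw [comp_phiEquiv_self hp, comp_phiEquiv_self hm]
      exact isProd_phiPiece hp hm
    · rw [comp_phiEquiv_of_ne hp h, comp_phiEquiv_of_ne hm (by omega)]
      exact IsProd.zero _ _ _
  · intro f g hf hg
    rw [mul_add, map_add, map_add, comp_add, comp_add]
    exact hf.add hg
  · intro c f hf
    rw [mul_smul_comm, map_smul, map_smul, comp_smul, comp_smul]
    exact hf.smul c

/-! ### Homogeneity and the bigrading. -/

theorem weight_wgt (d : Var →₀ ℕ) :
    Finsupp.weight wgt d = 2 * d .x2 + 6 * d .x6 + 3 * d .x3 + 5 * d .x5 := by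
  rw [Finsupp.weight_apply, Finsupp.sum_fintype _ _ (by simp), sum_var]
  simp only [wgt, smul_eq_mul]
  ring

theorem isHomogeneous_linear_pow {f : P4} (hf : f.IsHomogeneous 1) (k : ℕ) :
    (f ^ k).IsHomogeneous k := by
  simpa using hf.pow k

theorem isHomogeneous_vars : vA.IsHomogeneous 1 ∧ vB.IsHomogeneous 1 ∧ vA'.IsHomogeneous 1 ∧
    vB'.IsHomogeneous 1 :=
  ⟨MvPolynomial.isHomogeneous_X _ _, MvPolynomial.isHomogeneous_X _ _,
    MvPolynomial.isHomogeneous_X _ _, MvPolynomial.isHomogeneous_X _ _⟩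

theorem isHomogeneous_sigTilde (k : ℕ) : (sigTilde k).IsHomogeneous k := by
  obtain ⟨a, b, a', b'⟩ := isHomogeneous_vars
  have p {f : P4} (hf : f.IsHomogeneous 1) := isHomogeneous_linear_pow hf k
  exact ((((((((p a).add (p b)).add (p (a.neg.sub b))).add (p a')).add (p b')).add
    (p (a'.neg.sub b'))).add (p (a.neg.sub a'))).add (p (b.neg.sub b'))).add
    (p (((a.add b).add a').add b'))

theorem isHomogeneous_lam (k : ℕ) : (lam k).IsHomogeneous k := by
  obtain ⟨a, b, a', b'⟩ := isHomogeneous_vars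
  have p {f : P4} (hf : f.IsHomogeneous 1) := isHomogeneous_linear_pow hf k
  exact (((((p ((a.add b).add a')).sub (p ((a.add a').add b'))).sub (p ((a.add b).add b'))).add
    (p ((b.add a').add b'))).add (p (a.add b'))).sub (p (a'.add b))

theorem isHomogeneous_tau35 : tau35.IsHomogeneous 8 :=
  ((isHomogeneous_sigTilde 3).mul (isHomogeneous_lam 5)).sub
    ((isHomogeneous_sigTilde 5).mul (isHomogeneous_lam 3))

theorem isHomogeneous_ev {p : PV} {w : ℕ} (hp : MvPolynomial.IsWeightedHomogeneous wgt p w) :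
    (ev p).IsHomogeneous w := by
  rw [p.as_sum, map_sum]
  refine MvPolynomial.IsHomogeneous.sum _ _ _ fun d hd => ?_
  rw [monomial_eq_smul_mon, map_smul]
  refine Submodule.smul_mem (MvPolynomial.homogeneousSubmodule (Fin 4) ℂ w) _ ?_
  rw [← hp (MvPolynomial.mem_support_iff.1 hd), weight_wgt, mon]
  simp only [map_mul, map_pow, ev_x2, ev_x6, ev_x3, ev_x5]
  exact ((((isHomogeneous_sigTilde 2).pow _).mul ((isHomogeneous_sigTilde 6).pow _)).mul
    ((isHomogeneous_sigTilde 3).pow _)).mul ((isHomogeneous_sigTilde 5).pow _)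

theorem isPhi_phiEquiv : IsPhi phiEquiv where
  bigraded w s p hw hs := by
    refine ⟨fun k hk => comp_phiEquiv_of_ne hs hk, ?_⟩
    obtain ⟨z, hz, e⟩ := exists_cls_eq ⟨ev p * tau35, ev_mul_tau35_mem hs⟩
    refine ⟨z, (comp_phiEquiv_self hs).trans hz, ?_⟩
    rw [e]
    exact (isHomogeneous_ev hw).mul isHomogeneous_tau35
  one := by
    have h : (1 : PV) ∈ degPiece 0 := MvPolynomial.isWeightedHomogeneous_one ℂ sdeg
    obtain ⟨z, hz, e⟩ := exists_cls_eq ⟨ev 1 * tau35, ev_mul_tau35_mem h⟩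
    refine ⟨z, (comp_phiEquiv_self h).trans hz, ?_⟩
    change iota z = ev 1 * tau35 at e
    rw [e, map_one, one_mul]
  x2 p k := ev_x2 ▸ isProd_phiEquiv .x2 p k
  x6 p k := ev_x6 ▸ isProd_phiEquiv .x6 p k
  x3 p k := ev_x3 ▸ isProd_phiEquiv .x3 p k
  x5 p k := ev_x5 ▸ isProd_phiEquiv .x5 p k

/-! ### Uniqueness -/

theorem isWeightedHomogeneous_wgt_mon (i j a b : ℕ) :
    MvPolynomial.IsWeightedHomogeneous wgt (mon i j a b) (i * 2 + j * 6 + a * 3 + b * 5) := by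
  have h (v : Var) := MvPolynomial.isWeightedHomogeneous_X ℂ wgt v
  have := (((h .x2).pow i).mul ((h .x6).pow j)).mul ((h .x3).pow a) |>.mul ((h .x5).pow b)
  simpa [wgt, mon] using this

theorem IsPhi.comp_mon_zero {φ : PV ≃ₗ[ℂ] MMin} (h : IsPhi φ) (i j a b k : ℕ) (hk : k ≠ a + b) :
    comp (φ (mon i j a b)) k = 0 :=
  (h.bigraded _ _ _ (isWeightedHomogeneous_wgt_mon i j a b)
    (isWeightedHomogeneous_mon i j a b)).1 k hk

/-- Variables are stripped off one at a time down to the monomial 1. The intertwining conditions for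
x₃ and x₅ say nothing about component 0, where the bigrading gives zero on both sides. -/
theorem IsPhi.comp_mon_eq {φ ψ : PV ≃ₗ[ℂ] MMin} (hφ : IsPhi φ) (hψ : IsPhi ψ) (i j a b k : ℕ) :
    comp (φ (mon i j a b)) k = comp (ψ (mon i j a b)) k := by
  induction b generalizing k with
  | succ b ih =>
    cases k with
    | zero => rw [hφ.comp_mon_zero _ _ _ _ _ (by omega), hψ.comp_mon_zero _ _ _ _ _ (by omega)]
    | succ k =>
      have e : mon i j a (b + 1) = MvPolynomial.X .x5 * mon i j a b := by
        simp only [mon]; ring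
      have h1 := hφ.x5 (mon i j a b) k
      rw [ih] at h1
      rw [e]
      exact h1.unique (hψ.x5 _ k) (mem_sigIdeal_pow_one sigTilde_five_mem)
  | zero =>
  induction a generalizing k with
  | succ a ih =>
    cases k with
    | zero => rw [hφ.comp_mon_zero _ _ _ _ _ (by omega), hψ.comp_mon_zero _ _ _ _ _ (by omega)]
    | succ k =>
      have e : mon i j (a + 1) 0 = MvPolynomial.X .x3 * mon i j a 0 := by
        simp only [mon]; ring
      have h1 := hφ.x3 (mon i j a 0) k
      rw [ih] at h1
      rw [e]
      exact h1.unique (hψ.x3 _ k) (mem_sigIdeal_pow_one sigTilde_three_mem)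
  | zero =>
  induction j generalizing k with
  | succ j ih =>
    have e : mon i (j + 1) 0 0 = MvPolynomial.X .x6 * mon i j 0 0 := by
      simp only [mon]; ring
    have h1 := hφ.x6 (mon i j 0 0) k
    rw [ih] at h1
    rw [e]
    exact h1.unique (hψ.x6 _ k) (by simp)
  | zero =>
  induction i generalizing k with
  | succ i ih =>
    have e : mon (i + 1) 0 0 0 = MvPolynomial.X .x2 * mon i 0 0 0 := by
      simp only [mon]; ring
    have h1 := hφ.x2 (mon i 0 0 0) k
    rw [ih] at h1
    rw [e]
    exact h1.unique (hψ.x2 _ k) (by simp)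
  | zero =>
    by_cases hk : k = 0
    · subst hk
      have e : mon 0 0 0 0 = 1 := by simp [mon]
      obtain ⟨z, hz, h1⟩ := hφ.one
      obtain ⟨w, hw, h2⟩ := hψ.one
      rw [e, hz, hw, grMk_eq_iff, h1, h2, sub_self]
      exact zero_mem _
    · rw [hφ.comp_mon_zero _ _ _ _ _ hk, hψ.comp_mon_zero _ _ _ _ _ hk]

theorem IsPhi.unique {φ ψ : PV ≃ₗ[ℂ] MMin} (hφ : IsPhi φ) (hψ : IsPhi ψ) : φ = ψ := by
  refine LinearEquiv.ext fun p => PV_induction (P := fun p => φ p = ψ p) ?_ ?_ ?_ ?_ p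
  · rw [map_zero, map_zero]
  · exact fun i j a b => comp_ext (hφ.comp_mon_eq hψ i j a b)
  · intro f g hf hg
    rw [map_add, map_add, hf, hg]
  · intro c f hf
    rw [map_smul, map_smul, hf]

/-! ### The action of `Σ` -/

theorem sigAct_phiEquiv (n : ℕ) (s : Sig) (hs : (s : grL 0) = sig (2 * n + 3)) (p : PV) :
    sigAct s (phiEquiv p) = phiEquiv (actPoly n * p) := by
  refine PV_induction (P := fun p => sigAct s (phiEquiv p) = phiEquiv (actPoly n * p))
    ?_ ?_ ?_ ?_ p
  · rw [mul_zero, map_zero, map_zero]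
  · intro i j a b
    have hp : mon i j a b ∈ degPiece (a + b) := isWeightedHomogeneous_mon i j a b
    rw [phiEquiv_of_mem hp, phiEquiv_of_mem (mul_mem_degPiece_one (actPoly_mem n) hp), sigAct,
      DirectSum.toModule_lof, LinearMap.comp_apply]
    congr 1
    exact Subtype.ext (actStep_phiPiece n s hs ⟨_, hp⟩)
  · intro f g hf hg
    rw [mul_add, map_add, map_add, map_add, hf, hg]
  · intro c f hf
    rw [mul_smul_comm, map_smul, map_smul, map_smul, hf]

theorem sigAct_zero (m : MMin) : sigAct 0 m = 0 := by
  have h (k : ℕ) : actStep 0 k = 0 := by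
    refine LinearMap.ext fun u => ?_
    have := actStep_smul 0 0 k u
    rwa [zero_smul, zero_smul] at this
  have h2 : sigAct 0 = 0 := by
    refine DirectSum.linearMap_ext ℂ fun k => LinearMap.ext fun u => ?_
    rw [LinearMap.comp_apply, sigAct, DirectSum.toModule_lof, LinearMap.comp_apply]
    have : (actStep 0 k).restrict (p := Mmin k) (q := Mmin (k + 1))
        (fun _ hu => actStep_mem 0 k hu) u = 0 := Subtype.ext (LinearMap.congr_fun (h k) u)
    rw [this, map_zero]
    rfl
  rw [h2, LinearMap.zero_apply]

/-! ### The coefficients of the generating series -/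

theorem dSer_eq : dSer = 1 + PowerSeries.C d2 * PowerSeries.X ^ 2 +
    PowerSeries.C d4 * PowerSeries.X ^ 4 + PowerSeries.C d6 * PowerSeries.X ^ 6 := by
  have h2 : d2 = -(2 * (MvPolynomial.C (1 / 4) * MvPolynomial.X Var.x2)) := by
    rw [d2, ← mul_assoc, ← map_ofNat MvPolynomial.C 2, ← map_mul]
    norm_num
  have h4 : d4 = (MvPolynomial.C (1 / 4) * MvPolynomial.X Var.x2) ^ 2 := by
    rw [d4, mul_pow, ← map_pow]
    norm_num
  rw [dSer, h2, h4, ← d6]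
  generalize (MvPolynomial.C (1 / 4) * MvPolynomial.X Var.x2 : PV) = y
  rw [map_neg, map_mul, map_pow, map_ofNat]
  ring

/-- The inverse of the series `dSer`. -/
def invSer : PowerSeries PV := PowerSeries.invOfUnit dSer 1

theorem dSer_mul_invSer : dSer * invSer = 1 := by
  refine PowerSeries.mul_invOfUnit _ _ ?_
  rw [dSer_eq]
  simp

/-- This is the coefficient of degree n in d · d⁻¹ = 1; restricted to even n it becomes the
recurrence of `invCoeff`. -/
theorem coeff_invSer_rec (n : ℕ) : PowerSeries.coeff n invSer =
    (if n = 0 then 1 else 0) -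
    (if 2 ≤ n then d2 * PowerSeries.coeff (n - 2) invSer else 0) -
    (if 4 ≤ n then d4 * PowerSeries.coeff (n - 4) invSer else 0) -
    (if 6 ≤ n then d6 * PowerSeries.coeff (n - 6) invSer else 0) := by
  have h := congrArg (PowerSeries.coeff n) dSer_mul_invSer
  rw [dSer_eq, add_mul, add_mul, add_mul, one_mul, mul_assoc, mul_assoc, mul_assoc, map_add,
    map_add, map_add, PowerSeries.coeff_C_mul, PowerSeries.coeff_C_mul, PowerSeries.coeff_C_mul,
    PowerSeries.coeff_X_pow_mul', PowerSeries.coeff_X_pow_mul', PowerSeries.coeff_X_pow_mul',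
    PowerSeries.coeff_one, mul_ite, mul_ite, mul_ite, mul_zero, mul_zero, mul_zero] at h
  rw [← h]
  ring

theorem coeff_invSer_even (n : ℕ) : PowerSeries.coeff (2 * n) invSer = invCoeff (n + 2) := by
  induction n using Nat.strong_induction_on with
  | _ n ih =>
    match n with
    | 0 =>
      rw [coeff_invSer_rec]
      simp [invCoeff]
    | 1 =>
      rw [coeff_invSer_rec, invCoeff_add_three]
      have := ih 0 (by omega)
      simp [invCoeff] at this ⊢
      rw [this]
      ring
    | 2 =>
      rw [coeff_invSer_rec, show 2 + 2 = 1 + 3 from rfl, invCoeff_add_three]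
      have h0 := ih 0 (by omega)
      have h1 := ih 1 (by omega)
      simp [invCoeff] at h0 h1 ⊢
      rw [h0, h1]
      ring
    | n + 3 =>
      have h0 := ih n (by omega)
      have h1 := ih (n + 1) (by omega)
      have h2 := ih (n + 2) (by omega)
      rw [coeff_invSer_rec, if_neg (by omega), if_pos (by omega), if_pos (by omega),
        if_pos (by omega), show 2 * (n + 3) - 2 = 2 * (n + 2) by omega,
        show 2 * (n + 3) - 4 = 2 * (n + 1) by omega, show 2 * (n + 3) - 6 = 2 * n by omega,
        h0, h1, h2, show n + 3 + 2 = n + 2 + 3 by omega, invCoeff_add_three (n + 2)]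
      ring

theorem coeff_invSer_odd (n : ℕ) : PowerSeries.coeff (2 * n + 1) invSer = 0 := by
  induction n using Nat.strong_induction_on with
  | _ n ih =>
    have h (m : ℕ) (hm : m < 2 * n + 1) (ho : Odd m) : PowerSeries.coeff m invSer = 0 := by
      obtain ⟨k, rfl⟩ := ho
      exact ih k (by omega)
    have h' (j : ℕ) (c : PV) (hj : Even j) (h0 : 0 < j) :
        (if j ≤ 2 * n + 1 then c * PowerSeries.coeff (2 * n + 1 - j) invSer else 0) = 0 := by
      split_ifs with hle
      · rw [h _ (by omega) (Nat.Odd.sub_even hle ⟨n, rfl⟩ hj), mul_zero]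
      · rfl
    rw [coeff_invSer_rec, if_neg (by omega), h' 2 _ (by decide) (by norm_num),
      h' 4 _ (by decide) (by norm_num), h' 6 _ (by decide) (by norm_num)]
    simp

theorem coeff_xi (n k : ℕ) : PowerSeries.coeff k (xi n) =
    if n ≤ k then (k : PV) * (MvPolynomial.C (1 / (n : ℂ)) * PowerSeries.coeff (k - n) invSer)
    else 0 := by
  have h (j : ℕ) : PowerSeries.coeff j (PowerSeries.C (MvPolynomial.C (1 / (n : ℂ))) *
      PowerSeries.X ^ n * PowerSeries.invOfUnit dSer 1) =
      if n ≤ j then MvPolynomial.C (1 / (n : ℂ)) * PowerSeries.coeff (j - n) invSer else 0 := by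
    rw [mul_assoc, PowerSeries.coeff_C_mul, PowerSeries.coeff_X_pow_mul', mul_ite, mul_zero,
      invSer]
  rw [xi]
  cases k with
  | zero =>
    rw [PowerSeries.coeff_zero_X_mul]
    simp
  | succ k =>
    rw [PowerSeries.coeff_succ_X_mul, PowerSeries.coeff_derivative, h]
    push_cast
    split_ifs <;> ring

/-- The coefficients of the generating series of the action. -/
theorem coeff_series (k : ℕ) (u v : PV) :
    PowerSeries.coeff k (xi 3 * PowerSeries.C u + xi 5 * PowerSeries.C v) =
      PowerSeries.coeff k (xi 3) * u + PowerSeries.coeff k (xi 5) * v := by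
  rw [map_add, PowerSeries.coeff_mul_C, PowerSeries.coeff_mul_C]

theorem coeff_xi_eq_zero {k : ℕ} (hk : ¬(Odd k ∧ 3 ≤ k)) {n : ℕ} (hn : Odd n) (h3 : 3 ≤ n) :
    PowerSeries.coeff k (xi n) = 0 := by
  rw [coeff_xi]
  split_ifs with hle
  · have he : ¬Odd k := fun h => hk ⟨h, h3.trans hle⟩
    obtain ⟨m, hm⟩ := Nat.Even.sub_odd hle (Nat.not_odd_iff_even.1 he) hn
    rw [hm, coeff_invSer_odd, mul_zero, mul_zero]
  · rfl

theorem coeff_series_odd (n : ℕ) :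
    PowerSeries.coeff (2 * n + 3) (xi 3 * PowerSeries.C (MvPolynomial.X .x3) +
      xi 5 * PowerSeries.C (MvPolynomial.X .x5 -
        MvPolynomial.C (5 / 6) * MvPolynomial.X .x2 * MvPolynomial.X .x3)) = actPoly n := by
  have h3 : PowerSeries.coeff (2 * n + 3) (xi 3) =
      (2 * (n : PV) + 3) * (MvPolynomial.C (1 / 3) * invCoeff (n + 2)) := by
    rw [coeff_xi, if_pos (by omega), show 2 * n + 3 - 3 = 2 * n by omega, coeff_invSer_even]
    push_cast
    rfl
  have h5 : PowerSeries.coeff (2 * n + 3) (xi 5) =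
      (2 * (n : PV) + 3) * (MvPolynomial.C (1 / 5) * invCoeff (n + 1)) := by
    rw [coeff_xi]
    cases n with
    | zero => simp [invCoeff]
    | succ n =>
      rw [if_pos (by omega), show 2 * (n + 1) + 3 - 5 = 2 * n by omega, coeff_invSer_even]
      push_cast
      rfl
  rw [coeff_series, h3, h5, actPoly]
  ring

end

end LcsGrt

theorem mainTheorem6 :
    (∃! φ : MvPolynomial LcsGrt.Var ℂ ≃ₗ[ℂ] LcsGrt.MMin, LcsGrt.IsPhi φ) ∧
    ∀ φ : MvPolynomial LcsGrt.Var ℂ ≃ₗ[ℂ] LcsGrt.MMin, LcsGrt.IsPhi φ →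
      ∀ (k : ℕ) (m : LcsGrt.MMin),
        φ.symm (LcsGrt.sigAct (LcsGrt.sigCoeff k) m) =
          PowerSeries.coeff k
            (LcsGrt.xi 3 * PowerSeries.C (MvPolynomial.X LcsGrt.Var.x3) +
              LcsGrt.xi 5 * PowerSeries.C (MvPolynomial.X LcsGrt.Var.x5 -
                MvPolynomial.C (5 / 6) * MvPolynomial.X LcsGrt.Var.x2 *
                  MvPolynomial.X LcsGrt.Var.x3)) * φ.symm m := by
  refine ⟨⟨LcsGrt.phiEquiv, LcsGrt.isPhi_phiEquiv, fun ψ hψ =>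
    hψ.unique LcsGrt.isPhi_phiEquiv⟩, fun φ hφ k m => ?_⟩
  rw [hφ.unique LcsGrt.isPhi_phiEquiv]
  obtain ⟨p, rfl⟩ := LcsGrt.phiEquiv.surjective m
  rw [LinearEquiv.symm_apply_apply]
  by_cases hk : Odd k ∧ 3 ≤ k
  · obtain ⟨n, rfl⟩ : ∃ n, k = 2 * n + 3 := by
      obtain ⟨⟨j, rfl⟩, h3⟩ := hk
      exact ⟨j - 1, by omega⟩
    have hs : (LcsGrt.sigCoeff (2 * n + 3) : LcsGrt.grL 0) = LcsGrt.sig (2 * n + 3) := by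
      rw [LcsGrt.sigCoeff, dif_pos hk]
    rw [LcsGrt.coeff_series_odd, LcsGrt.sigAct_phiEquiv n _ hs, LinearEquiv.symm_apply_apply]
  · rw [LcsGrt.sigCoeff, dif_neg hk, LcsGrt.sigAct_zero, map_zero, LcsGrt.coeff_series,
      LcsGrt.coeff_xi_eq_zero hk (n := 3) ⟨1, rfl⟩ le_rfl,
      LcsGrt.coeff_xi_eq_zero hk (n := 5) ⟨2, rfl⟩ (by norm_num), zero_mul, zero_mul, add_zero, zero_mul]
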